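/- Let $2\le m\le n-m$ and let $M$ be a path-connected $n$-dimensional Poincaré duality complex with a single top cell: a path-connected Hausdorff CW complex of dimension $n$ with exactly one $n$-cell that is finitely dominated and satisfies Poincaré duality in the sense of Wall, i.e. for some orientation character $w$ there is a class in $H_n(M;\mathbb{Z}^w)$ for which the cap product $H^p(M;L)\to H_{n-p}(M;L\otimes\mathbb{Z}^w)$ is an isomorphism for all $p$ and all local coefficient systems $L$ ($M$ need not be orientable). Let $\overline{M}$ be the $(n-1)$-skeleton of $M$, let $x_0\in\overline{M}$ be any point, let $f\colon S^{n-1}\to\overline{M}$ be the attaching map of the $n$-cell, and let $g\colon S^{n-1}\to S^m\vee S^{n-m}$ be the attaching map of the top cell of $S^m\times S^{n-m}$, this cell being the product of the top cells of the two spheres. Let $M\#(S^m\times S^{n-m})$ be the homotopy pushout (double mapping cylinder) of $\overline{M}\xleftarrow{f}S^{n-1}\xrightarrow{g}S^m\vee S^{n-m}$, based at $x_0$. For pointed spaces write $A\rtimes B=(A\times B)/(\{*\}\times B)$. Then there is a homotopy fibration of pointed spaces $$S^{n-m}\vee(\overline{M}\rtimes\Omega S^m)\longrightarrow M\#(S^m\times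 S^{n-m})\xrightarrow{\;h'\;}S^m$$ in which $h'$ has a right homotopy inverse. Here a homotopy fibration $F\xrightarrow{i}E\xrightarrow{p}B$ consists of pointed maps for which some pointed null homotopy of $p\circ i$ induces a pointed homotopy equivalence from $F$ to the homotopy fibre of $p$, and a right homotopy inverse of $h'$ is a pointed map $s$ with $h'\circ s$ pointed homotopic to the identity. -/

import Mathlib

/-! ## Homology with local coefficients and Poincaré duality -/

namespace LocalCoeff

open CategoryTheory

universe u v

/-- A local system of abelian groups on `X`: a functor on the fundamental groupoid. -/
abbrev LocalSystem (X : Type u) [TopologicalSpace X] :=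
  FundamentalGroupoid X ⥤ AddCommGrpCat.{v}

/-- An orientation character on `X`: signs of path classes, multiplicative under concatenation. -/
abbrev OrientationCharacter (X : Type u) [TopologicalSpace X] :=
  FundamentalGroupoid X ⥤ SingleObj ℤˣ

/-- The singular `k`-simplices of `X`. -/
abbrev Simplex (X : Type u) [TopologicalSpace X] (k : ℕ) := C(stdSimplex ℝ (Fin (k + 1)), X)

variable {X : Type u} [TopologicalSpace X]

/-- The sign of a path class under an orientation character. -/
def sign (w : OrientationCharacter X) {x y : FundamentalGroupoid X} (γ : x ⟶ y) : ℤˣ := w.map γ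

/-- The local system `L ⊗ ℤ^w`: the fibres of `L`, with transport multiplied by the sign `w`. -/
noncomputable def twist (w : OrientationCharacter X) (L : LocalSystem.{u, v} X) :
    LocalSystem.{u, v} X where
  obj x := L.obj x
  map γ := ((sign w γ : ℤˣ) : ℤ) • L.map γ
  map_id x := by
    have : sign w (𝟙 x) = 1 := w.map_id x
    simp [this]
  map_comp {x y z} γ δ := by
    have : sign w (γ ≫ δ) = sign w δ * sign w γ := w.map_comp γ δ
    rw [this, L.map_comp, Preadditive.zsmul_comp, Preadditive.comp_zsmul, smul_smul, mul_comm]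
    simp

/-- The constant local system `ℤ`. -/
noncomputable def constInt (X : Type u) [TopologicalSpace X] : LocalSystem.{u, 0} X :=
  (Functor.const _).obj (AddCommGrpCat.of ℤ)

namespace Simplex

variable {j k : ℕ}

/-- The initial vertex of the standard simplex. -/
noncomputable def v₀ (k : ℕ) : stdSimplex ℝ (Fin (k + 1)) := stdSimplex.vertex 0

/-- The simplex `σ ∘ θ_*`, where `θ_*` is the affine map with the vertex map `θ`. -/
noncomputable def pull (σ : Simplex X k) (θ : Fin (j + 1) → Fin (k + 1)) : Simplex X j :=
  σ.comp ⟨stdSimplex.map θ, stdSimplex.continuous_map θ⟩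

/-- The initial vertex of a singular simplex, as an object of the fundamental groupoid. -/
noncomputable def start (σ : Simplex X k) : FundamentalGroupoid X := ⟨σ (v₀ k)⟩

/-- The straight line between two points of the standard simplex. -/
noncomputable def line (a b : stdSimplex ℝ (Fin (k + 1))) : Path a b where
  toFun t := ⟨AffineMap.lineMap (a : Fin (k + 1) → ℝ) b (t : ℝ),
    (convex_stdSimplex ℝ _).lineMap_mem a.2 b.2 ⟨t.2.1, t.2.2⟩⟩
  continuous_toFun := by
    refine Continuous.subtype_mk ?_ _
    exact AffineMap.lineMap_continuous.comp continuous_subtype_val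
  source' := Subtype.ext (by simp; rfl)
  target' := Subtype.ext (by simp; rfl)

/-- The class of the path, within `σ`, from the initial vertex of `σ` to the initial vertex of its
face `σ.pull θ`. -/
noncomputable def toStart (σ : Simplex X k) (θ : Fin (j + 1) → Fin (k + 1)) :
    σ.start ⟶ (σ.pull θ).start :=
  FundamentalGroupoid.fromPath
    (Path.Homotopic.Quotient.mk ((line (v₀ k) (stdSimplex.map θ (v₀ j))).map σ.continuous))

end Simplex

/-- Singular `k`-chains with coefficients in `L`: finite sums of simplices `σ` with coefficients in
the fibre of `L` over the initial vertex of `σ`. -/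
abbrev Chains (L : LocalSystem.{u, v} X) (k : ℕ) :=
  DirectSum (Simplex X k) fun σ => L.obj σ.start

/-- Singular `k`-cochains with coefficients in `L`. -/
abbrev Cochains (L : LocalSystem.{u, v} X) (k : ℕ) :=
  (σ : Simplex X k) → L.obj σ.start

open Classical in
/-- The boundary of a singular chain: `∂(a σ) = ∑ᵢ (-1)ⁱ (γᵢ a) (dᵢ σ)` with `γᵢ` the transport
within `σ` to the initial vertex of the `i`-th face `dᵢ σ`. -/
noncomputable def boundary (L : LocalSystem.{u, v} X) (k : ℕ) :
    Chains L (k + 1) →+ Chains L k :=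
  DirectSum.toAddMonoid fun σ => ∑ i : Fin (k + 2), ((-1 : ℤ) ^ (i : ℕ)) •
    (DirectSum.of (fun τ : Simplex X k => L.obj τ.start) (σ.pull i.succAbove)).comp
      (L.map (σ.toStart i.succAbove)).hom

/-- The coboundary of a singular cochain: `(δφ)(σ) = ∑ᵢ (-1)ⁱ γᵢ⁻¹ φ(dᵢ σ)`. -/
noncomputable def coboundary (L : LocalSystem.{u, v} X) (k : ℕ) :
    Cochains L k →+ Cochains L (k + 1) where
  toFun φ σ := ∑ i : Fin (k + 2), ((-1 : ℤ) ^ (i : ℕ)) •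
    (L.map (Groupoid.inv (σ.toStart i.succAbove))).hom (φ (σ.pull i.succAbove))
  map_zero' := by ext σ; simp
  map_add' φ ψ := by ext σ; simp [Finset.sum_add_distrib]

/-- The cycles in degree `k`. -/
noncomputable def cycles (L : LocalSystem.{u, v} X) : (k : ℕ) → AddSubgroup (Chains L k)
  | 0 => ⊤
  | k + 1 => (boundary L k).ker

/-- The boundaries in degree `k`. -/
noncomputable def boundaries (L : LocalSystem.{u, v} X) (k : ℕ) : AddSubgroup (Chains L k) :=
  (boundary L k).range

/-- The cocycles in degree `k`. -/
noncomputable def cocycles (L : LocalSystem.{u, v} X) (k : ℕ) : AddSubgroup (Cochains L k) :=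
  (coboundary L k).ker

/-- The coboundaries in degree `k`. -/
noncomputable def coboundaries (L : LocalSystem.{u, v} X) : (k : ℕ) → AddSubgroup (Cochains L k)
  | 0 => ⊥
  | k + 1 => (coboundary L k).range

/-- The vertices of the front face `[v₀, …, v_p]` of a simplex `[v₀, …, v_n]`. -/
def frontFace {p q n : ℕ} (h : p + q = n) (i : Fin (p + 1)) : Fin (n + 1) := ⟨i, by omega⟩

/-- The vertices of the back face `[v_p, …, v_n]` of a simplex `[v₀, …, v_n]`. -/
def backFace {p q n : ℕ} (h : p + q = n) (i : Fin (q + 1)) : Fin (n + 1) := ⟨p + i, by omega⟩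

open Classical in
/-- The cap product with a cochain `φ ∈ C^p(X; L)`, a map
`C_n(X; ℤ^w) → C_{n-p}(X; L ⊗ ℤ^w)`, `b σ ↦ b φ(σ|[v₀, …, v_p]) σ|[v_p, …, v_n]`: the value of `φ`
is moved to the vertex `v₀` and then, together with the integer `b`, to the vertex `v_p`. -/
noncomputable def cap (w : OrientationCharacter X) (L : LocalSystem.{u, v} X) {p q n : ℕ}
    (h : p + q = n) (φ : Cochains L p) :
    Chains (twist w (constInt X)) n →+ Chains (twist w L) q :=
  DirectSum.toAddMonoid fun σ => zmultiplesHom (Chains (twist w L) q)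
    (DirectSum.of (fun τ : Simplex X q => (twist w L).obj τ.start) (σ.pull (backFace h))
      (((twist w L).map (σ.toStart (backFace h))).hom
        ((L.map (Groupoid.inv (σ.toStart (frontFace h)))).hom (φ (σ.pull (frontFace h))))))

/-- Capping with the cycle `μ ∈ C_n(X; ℤ^w)` induces isomorphisms
`H^p(X; L) ≅ H_{n-p}(X; L ⊗ ℤ^w)` for all integers `p` and all local systems `L`. -/
structure IsFundamentalCycle (n : ℕ) (w : OrientationCharacter X)
    (μ : Chains (twist w (constInt X)) n) : Prop where
  isCycle : μ ∈ cycles (twist w (constInt X)) n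
  injective : ∀ (L : LocalSystem.{u, u} X) {p q : ℕ} (h : p + q = n), ∀ φ ∈ cocycles L p,
    cap w L h φ μ ∈ boundaries (twist w L) q → φ ∈ coboundaries L p
  surjective : ∀ (L : LocalSystem.{u, u} X) {p q : ℕ} (h : p + q = n),
    ∀ z ∈ cycles (twist w L) q, ∃ φ ∈ cocycles L p, z - cap w L h φ μ ∈ boundaries (twist w L) q
  cohomology_eq_zero : ∀ (L : LocalSystem.{u, u} X) (p : ℕ), n < p →
    cocycles L p ≤ coboundaries L p
  homology_eq_zero : ∀ (L : LocalSystem.{u, u} X) (q : ℕ), n < q →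
    cycles (twist w L) q ≤ boundaries (twist w L) q

end LocalCoeff

universe u v w

/-- `X` is dominated by a finite CW complex. -/
def IsFinitelyDominated (X : Type u) [TopologicalSpace X] : Prop :=
  ∃ (K : Type u) (_ : TopologicalSpace K) (_ : T2Space K)
    (_ : Topology.CWComplex (Set.univ : Set K)) (_ : Topology.RelCWComplex.Finite (Set.univ : Set K))
    (i : C(X, K)) (r : C(K, X)), (r.comp i).Homotopic (ContinuousMap.id X)

/-- Poincaré duality complexes of formal dimension `n`, in the sense of Wall (orientable or not):
finitely dominated CW complexes that satisfy Poincaré duality with all local coefficients. -/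
structure IsPoincareDualityComplex (n : ℕ) (X : Type u) [TopologicalSpace X]
    [Topology.CWComplex (Set.univ : Set X)] : Prop where
  finitelyDominated : IsFinitelyDominated X
  duality : ∃ (w : LocalCoeff.OrientationCharacter X)
    (μ : LocalCoeff.Chains (LocalCoeff.twist w (LocalCoeff.constInt X)) n),
    LocalCoeff.IsFundamentalCycle n w μ

/-! ## Top cells -/

open Metric in
/-- A presentation of `X` as the result of attaching one `n`-cell to a closed subspace `body`.
The `n`-disc is the unit ball of `Fin n → ℝ`, that is the cube `[-1, 1]ⁿ`. -/
structure TopCell (n : ℕ) (X : Type u) [TopologicalSpace X] where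
  /-- The complement of the open cell. -/
  body : Set X
  /-- The characteristic map of the cell (only its values on the closed disc matter). -/
  char : (Fin n → ℝ) → X
  isClosed_body : IsClosed body
  continuousOn_char : ContinuousOn char (closedBall 0 1)
  mapsTo_body : Set.MapsTo char (sphere 0 1) body
  bijOn_compl : Set.BijOn char (ball 0 1) bodyᶜ
  isClosed_of : ∀ s : Set X, IsClosed (s ∩ body) → IsClosed (closedBall 0 1 ∩ char ⁻¹' s) →
    IsClosed s

/-- The attaching map of the top cell. -/
def TopCell.attach {n : ℕ} {X : Type u} [TopologicalSpace X] (c : TopCell n X) :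
    C(Metric.sphere (0 : Fin n → ℝ) 1, c.body) where
  toFun x := ⟨c.char x, c.mapsTo_body x.2⟩
  continuous_toFun := by
    refine Continuous.subtype_mk ?_ _
    exact (c.continuousOn_char.mono Metric.sphere_subset_closedBall).domRestrict

/-- The CW complex `X` has dimension `n` and exactly one `n`-cell. -/
structure HasSingleTopCell (n : ℕ) (X : Type u) [TopologicalSpace X]
    [Topology.CWComplex (Set.univ : Set X)] : Prop where
  existsUnique_cell : Nonempty (Unique (Topology.RelCWComplex.cell (Set.univ : Set X) n))
  isEmpty_cell : ∀ j, n < j → IsEmpty (Topology.RelCWComplex.cell (Set.univ : Set X) j)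

namespace HasSingleTopCell

open Topology RelCWComplex

variable {n : ℕ} {X : Type u} [TopologicalSpace X] [T2Space X] [CWComplex (Set.univ : Set X)]

theorem mem_skeletonLT_or (h : HasSingleTopCell n X) (x : X) :
    x ∈ (skeletonLT (Set.univ : Set X) n : Set X) ∨
      x ∈ openCell (C := Set.univ) n h.existsUnique_cell.some.default := by
  have hx : x ∈ ⋃ (j : ℕ) (e : cell (Set.univ : Set X) j), openCell j e := by
    rw [CWComplex.iUnion_openCell_eq_complex]; trivial
  simp only [Set.mem_iUnion] at hx
  obtain ⟨j, e, hx⟩ := hx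
  rcases lt_trichotomy j n with hj | rfl | hj
  · exact Or.inl (CWComplex.mem_skeletonLT_iff.2 ⟨j, by exact_mod_cast hj, e, hx⟩)
  · right
    rwa [← h.existsUnique_cell.some.uniq e]
  · exact ((h.isEmpty_cell j hj).false e).elim

theorem disjoint_skeletonLT (h : HasSingleTopCell n X) :
    Disjoint (skeletonLT (Set.univ : Set X) n : Set X)
      (openCell (C := Set.univ) n h.existsUnique_cell.some.default) := by
  rw [Set.disjoint_left]
  intro x hx hx'
  obtain ⟨j, hj, e, hxe⟩ := CWComplex.mem_skeletonLT_iff.1 hx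
  have hj' : j ≠ n := by rintro rfl; exact lt_irrefl _ hj
  exact Set.disjoint_left.1 (CWComplex.disjoint_openCell_of_ne (C := Set.univ)
    (i := e) (j := h.existsUnique_cell.some.default) (fun h => hj' (congrArg Sigma.fst h))) hxe hx'

/-- The top cell of a CW complex with a single top cell. Its body is the `(n-1)`-skeleton, the
union of the cells of dimension less than `n`. -/
noncomputable def topCell (h : HasSingleTopCell n X) : TopCell n X where
  body := (skeletonLT (Set.univ : Set X) n : Set X)
  char := map n h.existsUnique_cell.some.default
  isClosed_body := Subcomplex.closed _
  continuousOn_char := continuousOn _ _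
  mapsTo_body := Set.mapsTo_iff_image_subset.2 (cellFrontier_subset_skeletonLT _ _)
  bijOn_compl := by
    refine ⟨fun x hx hx' => ?_, ?_, fun x hx => ?_⟩
    · exact Set.disjoint_left.1 h.disjoint_skeletonLT hx' (Set.mem_image_of_mem _ hx)
    · have := (map n h.existsUnique_cell.some.default : PartialEquiv (Fin n → ℝ) X).injOn
      rwa [source_eq] at this
    · exact (h.mem_skeletonLT_or x).resolve_left hx
  isClosed_of s h₁ h₂ := by
    rw [CWComplex.closed Set.univ s (Set.subset_univ _)]
    intro j e
    rcases lt_trichotomy j n with hj | rfl | hj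
    · have hs : closedCell j e ⊆ (skeletonLT (Set.univ : Set X) n : Set X) :=
        (closedCell_subset_skeletonLT j e).trans (skeletonLT_mono (by exact_mod_cast hj))
      rw [← Set.inter_eq_right.2 hs, ← Set.inter_assoc]
      exact h₁.inter isClosed_closedCell
    · rw [h.existsUnique_cell.some.uniq e]
      have : s ∩ closedCell (C := Set.univ) j h.existsUnique_cell.some.default =
          map (C := Set.univ) j h.existsUnique_cell.some.default ''
            (Metric.closedBall 0 1 ∩ map (C := Set.univ) j h.existsUnique_cell.some.default ⁻¹' s) := by
        rw [Set.image_inter_preimage, Set.inter_comm]; rfl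
      rw [this]
      refine IsCompact.isClosed (IsCompact.image_of_continuousOn ?_
        ((continuousOn _ _).mono Set.inter_subset_left))
      exact (isCompact_closedBall _ _).of_isClosed_subset h₂ Set.inter_subset_left
    · exact ((h.isEmpty_cell j hj).false e).elim

end HasSingleTopCell

/-! ## Spheres and their products -/

/-- The unit sphere `Sᵏ` in `ℝᵏ⁺¹`. -/
abbrev Sph (k : ℕ) := Metric.sphere (0 : EuclideanSpace ℝ (Fin (k + 1))) 1

namespace Sph

/-- The base point `(1, 0, …, 0)`. -/
noncomputable def base (k : ℕ) : Sph k := ⟨EuclideanSpace.single 0 1, by simp⟩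

/-- The sum of the squares of the coordinates. -/
def sq {k : ℕ} (u : Fin k → ℝ) : ℝ := ∑ i, u i ^ 2

theorem sq_nonneg {k : ℕ} (u : Fin k → ℝ) : 0 ≤ sq u :=
  Finset.sum_nonneg fun i _ => _root_.sq_nonneg (u i)

theorem continuous_sq {k : ℕ} : Continuous (sq : (Fin k → ℝ) → ℝ) := by
  unfold sq; fun_prop

theorem sq_smul {k : ℕ} (a : ℝ) (u : Fin k → ℝ) : sq (a • u) = a ^ 2 * sq u := by
  simp [sq, mul_pow, Finset.mul_sum]

theorem denom_pos {k : ℕ} (u : Fin k → ℝ) : 0 < sq u + (1 - ‖u‖) ^ 2 := by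
  rcases (sq_nonneg u).lt_or_eq with h | h
  · positivity
  · have hu : u = 0 := by
      ext i
      have := (Finset.sum_eq_zero_iff_of_nonneg fun i _ => _root_.sq_nonneg (u i)).1 h.symm i
        (Finset.mem_univ i)
      simpa using this
    simp [hu, sq]

/-- The point of `ℝᵏ⁺¹` underlying `Sph.collapse`. -/
noncomputable def collapseFun {k : ℕ} (u : Fin k → ℝ) : EuclideanSpace ℝ (Fin (k + 1)) :=
  WithLp.toLp 2 (Fin.cons ((sq u - (1 - ‖u‖) ^ 2) / (sq u + (1 - ‖u‖) ^ 2))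
    fun i => 2 * (1 - ‖u‖) * u i / (sq u + (1 - ‖u‖) ^ 2))

/-- The characteristic map of the top cell of `Sᵏ`: on the open cube, the homeomorphism
`u ↦ u / (1 - ‖u‖)` to `ℝᵏ` followed by the inverse of the stereographic projection from the base
point; the boundary of the cube goes to the base point. -/
noncomputable def collapse {k : ℕ} (u : Fin k → ℝ) : Sph k := ⟨collapseFun u, by
  have h := denom_pos u
  rw [mem_sphere_zero_iff_norm, EuclideanSpace.norm_eq, Real.sqrt_eq_one, Fin.sum_univ_succ]
  simp only [collapseFun, Fin.cons_zero, Fin.cons_succ, Real.norm_eq_abs, sq_abs, div_pow,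
    mul_pow, ← Finset.sum_div, ← Finset.mul_sum]
  change _ + _ * sq u / _ = 1
  field_simp
  ring⟩

theorem continuous_collapse {k : ℕ} : Continuous (collapse : (Fin k → ℝ) → Sph k) := by
  refine Continuous.subtype_mk ((PiLp.continuous_toLp 2 _).comp (continuous_pi fun i => ?_)) _
  refine Fin.cases ?_ (fun i => ?_) i
  · simp only [Fin.cons_zero]
    exact Continuous.div (by have := @continuous_sq k; fun_prop)
      (by have := @continuous_sq k; fun_prop) fun u => (denom_pos u).ne'
  · simp only [Fin.cons_succ]
    exact Continuous.div (by fun_prop)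
      (by have := @continuous_sq k; fun_prop) fun u => (denom_pos u).ne'

theorem collapse_zero_coord {k : ℕ} (u : Fin k → ℝ) :
    (collapse u).1 0 = (sq u - (1 - ‖u‖) ^ 2) / (sq u + (1 - ‖u‖) ^ 2) := rfl

theorem collapse_succ_coord {k : ℕ} (u : Fin k → ℝ) (i : Fin k) :
    (collapse u).1 i.succ = 2 * (1 - ‖u‖) * u i / (sq u + (1 - ‖u‖) ^ 2) := rfl

theorem base_zero_coord (k : ℕ) : (base k).1 0 = 1 := by simp [base]

theorem collapse_eq_base_iff {k : ℕ} (u : Fin k → ℝ) : collapse u = base k ↔ ‖u‖ = 1 := by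
  have h := denom_pos u
  constructor
  · intro hu
    have h0 := congrArg (fun p : Sph k => p.1 0) hu
    simp only [collapse_zero_coord, base_zero_coord] at h0
    rw [div_eq_one_iff_eq h.ne'] at h0
    nlinarith
  · intro hu
    have h' : sq u ≠ 0 := by simpa [hu] using h.ne'
    refine Subtype.ext (PiLp.ext fun i => ?_)
    refine Fin.cases ?_ (fun i => ?_) i
    · rw [collapse_zero_coord, base_zero_coord, hu]; simp [h']
    · rw [collapse_succ_coord, hu]; simp [base]

theorem collapse_injOn {k : ℕ} :
    Set.InjOn (collapse : (Fin k → ℝ) → Sph k) (Metric.ball 0 1) := by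
  have key : ∀ u : Fin k → ℝ, ‖u‖ < 1 →
      u = (1 + ‖fun i : Fin k => (collapse u).1 i.succ / (1 - (collapse u).1 0)‖)⁻¹ •
        fun i : Fin k => (collapse u).1 i.succ / (1 - (collapse u).1 0) := by
    intro u hu
    have hd := denom_pos u
    have hs : 0 < 1 - ‖u‖ := by linarith
    have hz : (fun i : Fin k => (collapse u).1 i.succ / (1 - (collapse u).1 0)) =
        (1 - ‖u‖)⁻¹ • u := by
      ext i
      rw [collapse_zero_coord, collapse_succ_coord, one_sub_div hd.ne', div_div_div_cancel_right₀ hd.ne',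
        Pi.smul_apply, smul_eq_mul]
      have : sq u + (1 - ‖u‖) ^ 2 - (sq u - (1 - ‖u‖) ^ 2) = 2 * (1 - ‖u‖) ^ 2 := by ring
      rw [this]
      field_simp
    rw [hz, norm_smul, norm_inv, Real.norm_of_nonneg hs.le, smul_smul]
    have : (1 + (1 - ‖u‖)⁻¹ * ‖u‖)⁻¹ * (1 - ‖u‖)⁻¹ = 1 := by
      field_simp
      simp
    rw [this, one_smul]
  intro u hu v hv huv
  rw [key u (by simpa using hu), key v (by simpa using hv), huv]

theorem exists_collapse_eq {k : ℕ} (p : Sph k) (hp : p ≠ base k) :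
    ∃ u ∈ Metric.ball (0 : Fin k → ℝ) 1, collapse u = p := by
  have hsum : p.1 0 ^ 2 + ∑ i : Fin k, p.1 i.succ ^ 2 = 1 := by
    have := p.2
    rw [mem_sphere_zero_iff_norm, EuclideanSpace.norm_eq, Real.sqrt_eq_one,
      Fin.sum_univ_succ] at this
    simpa [sq_abs] using this
  have hnn : 0 ≤ ∑ i : Fin k, p.1 i.succ ^ 2 := Finset.sum_nonneg fun i _ => _root_.sq_nonneg _
  have hlt : p.1 0 < 1 := by
    refine lt_of_le_of_ne (by nlinarith) fun h => hp ?_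
    have h0 : ∑ i : Fin k, p.1 i.succ ^ 2 = 0 := by rw [h] at hsum; linarith
    have h1 := (Finset.sum_eq_zero_iff_of_nonneg fun i _ => _root_.sq_nonneg (p.1 (Fin.succ i))).1 h0
    refine Subtype.ext (PiLp.ext fun i => ?_)
    refine Fin.cases ?_ (fun i => ?_) i
    · rw [h, base_zero_coord]
    · have := h1 i (Finset.mem_univ i)
      simpa [base] using this
  set z : Fin k → ℝ := fun i => p.1 i.succ / (1 - p.1 0) with hz
  have hz0 : 0 ≤ ‖z‖ := norm_nonneg z
  have hc : 0 < 1 - p.1 0 := by linarith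
  have hsq : sq z * (1 - p.1 0) ^ 2 = 1 - p.1 0 ^ 2 := by
    have : sq z = (∑ i : Fin k, p.1 i.succ ^ 2) / (1 - p.1 0) ^ 2 := by
      simp only [sq, hz, div_pow, Finset.sum_div]
    rw [this, div_mul_cancel₀ _ (by positivity)]
    linarith
  have hsq' : sq z * (1 - p.1 0) = 1 + p.1 0 := by
    have : (sq z * (1 - p.1 0) - (1 + p.1 0)) * (1 - p.1 0) = 0 := by linarith
    rcases mul_eq_zero.1 this with h | h <;> linarith
  have hn : ‖(1 + ‖z‖)⁻¹ • z‖ = ‖z‖ / (1 + ‖z‖) := by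
    rw [norm_smul, norm_inv, Real.norm_of_nonneg (by positivity)]
    field_simp
  have hs : 1 - ‖(1 + ‖z‖)⁻¹ • z‖ = (1 + ‖z‖)⁻¹ := by
    rw [hn]; field_simp; ring
  have hD : sq z + 1 = 2 / (1 - p.1 0) := by
    rw [eq_div_iff hc.ne']; linarith
  have hN : sq z - 1 = 2 * p.1 0 / (1 - p.1 0) := by
    rw [eq_div_iff hc.ne']; linarith
  have e1 : sq ((1 + ‖z‖)⁻¹ • z) + ((1 + ‖z‖)⁻¹) ^ 2 = (1 + ‖z‖)⁻¹ ^ 2 * (2 / (1 - p.1 0)) := by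
    rw [sq_smul, ← hD]; ring
  have e2 : sq ((1 + ‖z‖)⁻¹ • z) - ((1 + ‖z‖)⁻¹) ^ 2 =
      (1 + ‖z‖)⁻¹ ^ 2 * (2 * p.1 0 / (1 - p.1 0)) := by
    rw [sq_smul, ← hN]; ring
  refine ⟨(1 + ‖z‖)⁻¹ • z, ?_, Subtype.ext (PiLp.ext fun i => ?_)⟩
  · rw [mem_ball_zero_iff, hn, div_lt_one (by positivity)]; linarith
  · refine Fin.cases ?_ (fun i => ?_) i
    · rw [collapse_zero_coord, hs, e1, e2]
      field_simp
    · rw [collapse_succ_coord, hs, e1, Pi.smul_apply, smul_eq_mul]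
      simp only [hz]
      field_simp

theorem exists_prod_collapse_eq {m k : ℕ} (p : Sph m × Sph k) (h₁ : p.1 ≠ base m)
    (h₂ : p.2 ≠ base k) : ∃ x ∈ Metric.ball (0 : Fin (m + k) → ℝ) 1,
      (collapse fun i => x (Fin.castAdd k i), collapse fun j => x (Fin.natAdd m j)) = p := by
  obtain ⟨u, hu, hu'⟩ := exists_collapse_eq p.1 h₁
  obtain ⟨v, hv, hv'⟩ := exists_collapse_eq p.2 h₂
  rw [mem_ball_zero_iff, pi_norm_lt_iff zero_lt_one] at hu hv
  refine ⟨Fin.append u v, ?_, Prod.ext ?_ ?_⟩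
  · rw [mem_ball_zero_iff, pi_norm_lt_iff zero_lt_one]
    exact fun i => Fin.addCases (fun i => by simpa using hu i) (fun i => by simpa using hv i) i
  · simpa using hu'
  · simpa using hv'

end Sph

open Metric in
/-- The cell structure of `Sᵐ × Sᵏ` over `Sᵐ ∨ Sᵏ`: the top cell is the product of the top cells of
the factors. -/
noncomputable def sphereProdTopCell (m k : ℕ) : TopCell (m + k) (Sph m × Sph k) where
  body := {p | p.1 = Sph.base m ∨ p.2 = Sph.base k}
  char x := (Sph.collapse fun i => x (Fin.castAdd k i), Sph.collapse fun j => x (Fin.natAdd m j))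
  isClosed_body := (isClosed_eq continuous_fst continuous_const).union
    (isClosed_eq continuous_snd continuous_const)
  continuousOn_char := by
    refine Continuous.continuousOn (Continuous.prodMk ?_ ?_) <;>
      exact Sph.continuous_collapse.comp (by fun_prop)
  mapsTo_body := by
    intro x hx
    rw [mem_sphere_zero_iff_norm] at hx
    simp only [Set.mem_ofPred_eq, Sph.collapse_eq_base_iff]
    by_contra! hne
    have h1 : ‖fun i => x (Fin.castAdd k i)‖ ≤ 1 :=
      (pi_norm_le_iff_of_nonneg zero_le_one).2 fun i => hx ▸ norm_le_pi_norm x _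
    have h2 : ‖fun j => x (Fin.natAdd m j)‖ ≤ 1 :=
      (pi_norm_le_iff_of_nonneg zero_le_one).2 fun i => hx ▸ norm_le_pi_norm x _
    have h1' := (pi_norm_lt_iff zero_lt_one).1 (lt_of_le_of_ne h1 hne.1)
    have h2' := (pi_norm_lt_iff zero_lt_one).1 (lt_of_le_of_ne h2 hne.2)
    exact hx.not_lt ((pi_norm_lt_iff zero_lt_one).2 fun i => Fin.addCases h1' h2' i)
  bijOn_compl := by
    refine ⟨fun x hx => ?_, fun x hx y hy hxy => ?_, fun p hp => ?_⟩
    · rw [mem_ball_zero_iff, pi_norm_lt_iff zero_lt_one] at hx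
      simp only [Set.mem_compl_iff, Set.mem_ofPred_eq, Sph.collapse_eq_base_iff, not_or]
      exact ⟨((pi_norm_lt_iff zero_lt_one).2 fun i => hx _).ne,
        ((pi_norm_lt_iff zero_lt_one).2 fun i => hx _).ne⟩
    · rw [mem_ball_zero_iff, pi_norm_lt_iff zero_lt_one] at hx hy
      rw [Prod.mk.injEq] at hxy
      have e1 := Sph.collapse_injOn
        (mem_ball_zero_iff.2 ((pi_norm_lt_iff zero_lt_one).2 fun i => hx _))
        (mem_ball_zero_iff.2 ((pi_norm_lt_iff zero_lt_one).2 fun i => hy _)) hxy.1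
      have e2 := Sph.collapse_injOn
        (mem_ball_zero_iff.2 ((pi_norm_lt_iff zero_lt_one).2 fun i => hx _))
        (mem_ball_zero_iff.2 ((pi_norm_lt_iff zero_lt_one).2 fun i => hy _)) hxy.2
      ext i
      exact Fin.addCases (fun i => congrFun e1 i) (fun i => congrFun e2 i) i
    · simp only [Set.mem_compl_iff, Set.mem_ofPred_eq, not_or] at hp
      exact Sph.exists_prod_collapse_eq p hp.1 hp.2
  isClosed_of s h₁ h₂ := by
    have hcont : Continuous fun x : Fin (m + k) → ℝ =>
        (Sph.collapse fun i => x (Fin.castAdd k i), Sph.collapse fun j => x (Fin.natAdd m j)) := by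
      refine Continuous.prodMk ?_ ?_ <;> exact Sph.continuous_collapse.comp (by fun_prop)
    have hc := ((isCompact_closedBall (0 : Fin (m + k) → ℝ) 1).of_isClosed_subset h₂
      Set.inter_subset_left).image hcont
    have : s = s ∩ {p | p.1 = Sph.base m ∨ p.2 = Sph.base k} ∪ (fun x : Fin (m + k) → ℝ =>
        (Sph.collapse fun i => x (Fin.castAdd k i), Sph.collapse fun j => x (Fin.natAdd m j))) ''
          (closedBall 0 1 ∩ (fun x : Fin (m + k) → ℝ => (Sph.collapse fun i => x (Fin.castAdd k i),
            Sph.collapse fun j => x (Fin.natAdd m j))) ⁻¹' s) := by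
      apply Set.Subset.antisymm
      · intro p hp
        by_cases hb : p.1 = Sph.base m ∨ p.2 = Sph.base k
        · exact Or.inl ⟨hp, hb⟩
        · rw [not_or] at hb
          obtain ⟨x, hx, rfl⟩ := Sph.exists_prod_collapse_eq p hb.1 hb.2
          exact Or.inr ⟨x, ⟨ball_subset_closedBall hx, hp⟩, rfl⟩
      · rintro p (hp | ⟨x, hx, rfl⟩)
        · exact hp.1
        · exact hx.2
    rw [this]
    exact h₁.union hc.isClosed

/-! ## Constructions of homotopy theory -/

/-- The identifications in the double mapping cylinder of `f` and `g`. -/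
inductive HomotopyPushout.Rel {S : Type w} {A : Type u} {B : Type v} (f : S → A) (g : S → B) :
    A ⊕ (S × unitInterval) ⊕ B → A ⊕ (S × unitInterval) ⊕ B → Prop
  | left (s : S) : HomotopyPushout.Rel f g (.inr (.inl (s, 0))) (.inl (f s))
  | right (s : S) : HomotopyPushout.Rel f g (.inr (.inl (s, 1))) (.inr (.inr (g s)))

/-- The homotopy pushout (double mapping cylinder) of `A ← S → B`. -/
def HomotopyPushout {S : Type w} {A : Type u} {B : Type v} [TopologicalSpace S]
    [TopologicalSpace A] [TopologicalSpace B] (f : C(S, A)) (g : C(S, B)) :=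
  Quot (HomotopyPushout.Rel f g)

/-- The quotient topology. -/
instance {S : Type w} {A : Type u} {B : Type v} [TopologicalSpace S] [TopologicalSpace A]
    [TopologicalSpace B] (f : C(S, A)) (g : C(S, B)) : TopologicalSpace (HomotopyPushout f g) :=
  inferInstanceAs (TopologicalSpace (Quot _))

/-- The inclusion of `A` into the homotopy pushout of `A ← S → B`. -/
def HomotopyPushout.inl {S : Type w} {A : Type u} {B : Type v} [TopologicalSpace S]
    [TopologicalSpace A] [TopologicalSpace B] (f : C(S, A)) (g : C(S, B)) (a : A) :
    HomotopyPushout f g :=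
  Quot.mk _ (.inl a)

/-- The connected sum of two spaces with top cells of the same dimension: the homotopy pushout
of the two attaching maps. (Up to homeomorphism, a smaller concentric open disc is deleted from each
of the top cells and the boundary spheres are joined by a tube.) -/
abbrev ConnectedSum {n : ℕ} {X : Type u} {Y : Type v} [TopologicalSpace X] [TopologicalSpace Y]
    (c : TopCell n X) (d : TopCell n Y) :=
  HomotopyPushout c.attach d.attach

/-- The wedge `X ∨ Y` of pointed spaces. -/
def Wedge (X : Type u) (Y : Type v) (x₀ : X) (y₀ : Y) :=
  Quot fun a b : X ⊕ Y => a = .inl x₀ ∧ b = .inr y₀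

/-- The quotient topology. -/
instance (X : Type u) (Y : Type v) [TopologicalSpace X] [TopologicalSpace Y] (x₀ : X) (y₀ : Y) :
    TopologicalSpace (Wedge X Y x₀ y₀) :=
  inferInstanceAs (TopologicalSpace (Quot _))

/-- The base point of a wedge. -/
def Wedge.base {X : Type u} {Y : Type v} (x₀ : X) (y₀ : Y) : Wedge X Y x₀ y₀ := Quot.mk _ (.inl x₀)

/-- The half-smash `A ⋊ B`, the quotient of `A × B` that collapses `{a₀} × B` to a point. -/
def HalfSmash (A : Type u) (B : Type v) (a₀ : A) :=
  Quot fun p q : A × B => p.1 = a₀ ∧ q.1 = a₀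

/-- The quotient topology. -/
instance (A : Type u) (B : Type v) [TopologicalSpace A] [TopologicalSpace B] (a₀ : A) :
    TopologicalSpace (HalfSmash A B a₀) :=
  inferInstanceAs (TopologicalSpace (Quot _))

/-- The image of `{a₀} × B` in `A ⋊ B`, for nonempty `B`. -/
def HalfSmash.base {A : Type u} {B : Type v} [Inhabited B] (a₀ : A) : HalfSmash A B a₀ :=
  Quot.mk _ (a₀, default)

/-- The homotopy fibre of `p` over `b`: points `e` with a path from `p e` to `b`. -/
def HomotopyFiber {E : Type u} {B : Type v} [TopologicalSpace E] [TopologicalSpace B] (p : C(E, B))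
    (b : B) :=
  {x : E × C(unitInterval, B) // x.2 0 = p x.1 ∧ x.2 1 = b}

/-- The subspace topology of `E × B^I`, with the compact-open topology on `B^I`. -/
instance {E : Type u} {B : Type v} [TopologicalSpace E] [TopologicalSpace B] (p : C(E, B))
    (b : B) : TopologicalSpace (HomotopyFiber p b) :=
  inferInstanceAs (TopologicalSpace (Subtype _))

/-- The base point of the homotopy fibre over `p e₀`. -/
def HomotopyFiber.base {E : Type u} {B : Type v} [TopologicalSpace E] [TopologicalSpace B]
    (p : C(E, B)) (e₀ : E) {b₀ : B} (h : p e₀ = b₀) : HomotopyFiber p b₀ :=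
  ⟨(e₀, ContinuousMap.const unitInterval b₀), h.symm, rfl⟩

/-- The pointed map `f : (X, x₀) → (Y, y₀)` is a pointed homotopy equivalence. -/
def IsPointedHomotopyEquiv {X : Type u} {Y : Type v} [TopologicalSpace X] [TopologicalSpace Y]
    (f : C(X, Y)) (x₀ : X) (y₀ : Y) : Prop :=
  f x₀ = y₀ ∧ ∃ g : C(Y, X), g y₀ = x₀ ∧
    (g.comp f).HomotopicRel (ContinuousMap.id X) {x₀} ∧
    (f.comp g).HomotopicRel (ContinuousMap.id Y) {y₀}

/-- The pointed maps `i : (F, f₀) → (E, e₀)` and `p : (E, e₀) → (B, b₀)` form a homotopy fibration: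
`p ∘ i` has a pointed null homotopy for which the induced map from `F` to the homotopy fibre of `p`
is a pointed homotopy equivalence. Such a null homotopy is the same as a pointed map `φ` from `F` to
the homotopy fibre that lifts `i`. -/
def IsHomotopyFibration {F : Type u} {E : Type v} {B : Type w} [TopologicalSpace F]
    [TopologicalSpace E] [TopologicalSpace B] (i : C(F, E)) (p : C(E, B)) (f₀ : F) (e₀ : E)
    (b₀ : B) : Prop :=
  i f₀ = e₀ ∧ ∃ h : p e₀ = b₀, ∃ φ : C(F, HomotopyFiber p b₀),
    (∀ x, (φ x).1.1 = i x) ∧ IsPointedHomotopyEquiv φ f₀ (HomotopyFiber.base p e₀ h)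

/-- The pointed map `p : (E, e₀) → (B, b₀)` has a right homotopy inverse. -/
def HasRightHomotopyInverse {E : Type u} {B : Type v} [TopologicalSpace E] [TopologicalSpace B]
    (p : C(E, B)) (e₀ : E) (b₀ : B) : Prop :=
  ∃ s : C(B, E), s b₀ = e₀ ∧ (p.comp s).HomotopicRel (ContinuousMap.id B) {b₀}

/-! Write `A` for the skeleton, `N` for the connected sum and `k` for `n - m`. Collapsing `A` to the
centre of the top cell of the product, followed by the antipode in the first factor, gives `coord :
N → Sᵐ × Sᵏ`. It sends `A` to `(base, -base)` and is a homeomorphism from the rest of `N` onto the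
complement of that point (`SphereProd.exists_inverse`). The map `h'` is the first coordinate,
`toSphere`. A slice `Sᵐ × {y}` with `y ≠ -base` is a section; dragging it to the base point inside
the fibre yields the right inverse (`hasRightHomotopyInverse`).

The homotopy fibre `F` of `h'` is cut up twice. Over `y ≠ -base` the space `N` is `Sᵐ × (Sᵏ ∖ pt)`,
so that piece of `F` is equivalent to `Sᵏ ∖ pt`; the piece over `y ≠ base` is called `Part`. A copy
of `Sᵏ` over `-base` lifts to `F` and is an equivalence over the first piece and over the
intersection. Hence `F` arises from `Part` by attaching `Sᵏ` along the contractible `Sᵏ ∖ {base}`,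
and `F ≃ Sᵏ ∨ Part` (`nonempty_fiber`).

`Part` is cut by the first coordinate `z`. Where `z ≠ -base`, the space `N` deforms to `A`, which
lies in a single fibre of `h'`, and the piece is `A × ΩSᵐ`. The rest is compared with the
contractible path space of `Sᵐ`, whose part with `z ≠ -base` is `ΩSᵐ`. So `Part` is the homotopy
pushout of `A × ΩSᵐ ← ΩSᵐ → *`, that is `A ⋊ ΩSᵐ` (`nonempty_part`).

Both cuts use `HomotopyPushout.nonempty_cover_section`, which rests on homotopy invariance and
pasting of double mapping cylinders. Passing to strict wedges and half-smashes, and from free to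
pointed equivalences, requires well-pointed spaces (`nonempty_strict_pushout`,
`IsWellPointed.exists_isPointedHomotopyEquiv`); skeleta are well-pointed at every point
(`isWellPointed_skeletonLT`). -/

section

open Topology unitInterval ContinuousMap Metric

universe u₁ u₂ u₃ u₄ u₅ u₆

/-! ### Homotopy equivalences and cancellation properties. -/

section HomotopyEquivalences

variable {X : Type u₁} {Y : Type u₂} {Z : Type u₃} {W : Type u₄}
  [TopologicalSpace X] [TopologicalSpace Y] [TopologicalSpace Z] [TopologicalSpace W]

/-- A homotopy with the interval as second factor. -/
theorem ContinuousMap.homotopic_of_prod {f g : C(X, Y)} (F : C(X × I, Y))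
    (h0 : ∀ x, F (x, 0) = f x) (h1 : ∀ x, F (x, 1) = g x) : f.Homotopic g :=
  ⟨⟨F.comp ⟨Prod.swap, continuous_swap⟩, fun x => by simp [h0], fun x => by simp [h1]⟩⟩

theorem ContinuousMap.Homotopic.exists_prod {f g : C(X, Y)} (h : f.Homotopic g) :
    ∃ F : C(X × I, Y), (∀ x, F (x, 0) = f x) ∧ ∀ x, F (x, 1) = g x := by
  obtain ⟨H⟩ := h
  exact ⟨H.toContinuousMap.comp ⟨Prod.swap, continuous_swap⟩, fun x => by simp,
    fun x => by simp⟩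

theorem ContinuousMap.Homotopic.comp_left {f g : C(X, Y)} (h : f.Homotopic g) (k : C(Y, Z)) :
    (k.comp f).Homotopic (k.comp g) := (Homotopic.refl k).comp h

theorem ContinuousMap.Homotopic.comp_right {f g : C(Y, Z)} (h : f.Homotopic g) (k : C(X, Y)) :
    (f.comp k).Homotopic (g.comp k) := h.comp (Homotopic.refl k)

/-- The map `f` is a homotopy equivalence. -/
def IsHomotopyEquiv (f : C(X, Y)) : Prop :=
  ∃ g : C(Y, X), (g.comp f).Homotopic (.id X) ∧ (f.comp g).Homotopic (.id Y)

namespace IsHomotopyEquiv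

theorem nonempty {f : C(X, Y)} (h : IsHomotopyEquiv f) : Nonempty (X ≃ₕ Y) :=
  let ⟨g, h1, h2⟩ := h; ⟨⟨f, g, h1, h2⟩⟩

theorem of_equiv (e : X ≃ₕ Y) : IsHomotopyEquiv e.toFun := ⟨e.invFun, e.left_inv, e.right_inv⟩

theorem id : IsHomotopyEquiv (ContinuousMap.id X) := ⟨.id X, .refl _, .refl _⟩

theorem comp {g : C(Y, Z)} {f : C(X, Y)} (hg : IsHomotopyEquiv g) (hf : IsHomotopyEquiv f) :
    IsHomotopyEquiv (g.comp f) := by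
  obtain ⟨f', h1, h2⟩ := hf
  obtain ⟨g', h3, h4⟩ := hg
  refine ⟨f'.comp g', ?_, ?_⟩
  · exact ((h3.comp_right f).comp_left f').trans h1
  · exact ((h2.comp_right g').comp_left g).trans h4

theorem congr {f g : C(X, Y)} (hf : IsHomotopyEquiv f) (h : f.Homotopic g) :
    IsHomotopyEquiv g := by
  obtain ⟨f', h1, h2⟩ := hf
  exact ⟨f', (h.symm.comp_left f').trans h1, (h.symm.comp_right f').trans h2⟩

/-- A map with homotopy inverses on both sides. -/
theorem of_left_right {f : C(X, Y)} {l r : C(Y, X)} (hl : (l.comp f).Homotopic (.id X))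
    (hr : (f.comp r).Homotopic (.id Y)) : IsHomotopyEquiv f := by
  refine ⟨l, hl, ?_⟩
  have : l.Homotopic r := (hr.symm.comp_left l).trans (hl.comp_right r)
  exact (this.comp_left f).trans hr

theorem of_comp_right {g : C(Y, Z)} {f : C(X, Y)} (hgf : IsHomotopyEquiv (g.comp f))
    (hf : IsHomotopyEquiv f) : IsHomotopyEquiv g := by
  obtain ⟨f', h1, h2⟩ := hf
  have h : IsHomotopyEquiv ((g.comp f).comp f') := hgf.comp ⟨f, h2, h1⟩
  exact h.congr (h2.comp_left g)

theorem of_comp_left {g : C(Y, Z)} {f : C(X, Y)} (hgf : IsHomotopyEquiv (g.comp f))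
    (hg : IsHomotopyEquiv g) : IsHomotopyEquiv f := by
  obtain ⟨g', h1, h2⟩ := hg
  have h : IsHomotopyEquiv (g'.comp (g.comp f)) := IsHomotopyEquiv.comp ⟨g, h2, h1⟩ hgf
  exact h.congr (h1.comp_right f)

/-- A form of the two-out-of-six property. -/
theorem of_two_of_six {h : C(Z, W)} {g : C(Y, Z)} {f : C(X, Y)}
    (hgf : IsHomotopyEquiv (g.comp f)) (hhg : IsHomotopyEquiv (h.comp g)) :
    IsHomotopyEquiv h := by
  have hg : IsHomotopyEquiv g := by
    obtain ⟨a, -, ha⟩ := hgf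
    obtain ⟨b, hb, -⟩ := hhg
    exact of_left_right (l := b.comp h) (r := f.comp a) hb ha
  exact of_comp_right hhg hg

/-- A section `k` of `r` is a homotopy equivalence if the identity is homotopic to a map that is
constant along `r`. -/
theorem of_section {K : Type u₅} {V : Type u₆} [TopologicalSpace K] [TopologicalSpace V]
    {k : C(K, V)} {r : C(V, K)} (h : ∀ x, r (k x) = x) (Γ : C(V × I, V))
    (h0 : ∀ v, Γ (v, 0) = v) (h1 : ∀ v, Γ (v, 1) = Γ (k (r v), 1)) : IsHomotopyEquiv k := by
  refine ⟨r, ?_, ?_⟩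
  · have : r.comp k = .id K := by ext x; exact h x
    rw [this]
  -- `Γ` joins both `id` and `k ∘ r` to the same map `Γ (·, 1)`.
  · have e1 : (ContinuousMap.id V).Homotopic (Γ.comp ⟨fun v => (v, 1), by fun_prop⟩) :=
      homotopic_of_prod Γ h0 fun v => rfl
    refine Homotopic.trans ?_ e1.symm
    refine homotopic_of_prod (Γ.comp ⟨fun v => (k (r v.1), v.2), by fun_prop⟩) ?_ ?_
    · intro v; simp [h0]
    · intro v; simp [← h1]

/-- The inclusion of a weak deformation retract is a homotopy equivalence. -/
theorem of_deformation {K : Type u₅} {V : Type u₆} [TopologicalSpace K] [TopologicalSpace V]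
    {α : C(K, V)} {R : C(V, K)} (Γ : C(V × I, V)) (Γ' : C(K × I, K))
    (h0 : ∀ v, Γ (v, 0) = v) (h1 : ∀ v, Γ (v, 1) = α (R v))
    (h0' : ∀ x, Γ' (x, 0) = x) (h1' : ∀ x, Γ' (x, 1) = R (α x)) : IsHomotopyEquiv α :=
  ⟨R, (homotopic_of_prod Γ' h0' h1').symm, (homotopic_of_prod Γ h0 h1).symm⟩

end IsHomotopyEquiv

end HomotopyEquivalences

/-! ### Concatenation of families of paths. -/

section Lines

variable {S : Type u₁} {Y : Type u₂} [TopologicalSpace S] [TopologicalSpace Y]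

/-- The nearest point of the unit interval. -/
noncomputable abbrev clampI (x : ℝ) : I := Set.projIcc 0 1 zero_le_one x

@[fun_prop]
theorem Continuous.clampI {f : Y → ℝ} (h : Continuous f) : Continuous fun y => clampI (f y) :=
  continuous_projIcc.comp h

theorem clampI_coe (t : I) : clampI (t : ℝ) = t := Set.projIcc_val _ t

theorem clampI_of_le {x : ℝ} (h : x ≤ 0) : clampI x = 0 := Set.projIcc_of_le_left _ h

theorem clampI_of_ge {x : ℝ} (h : 1 ≤ x) : clampI x = 1 := Set.projIcc_of_right_le _ h

theorem coe_clampI (x : ℝ) : (clampI x : ℝ) = max 0 (min 1 x) := Set.coe_projIcc _ _ _ _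

theorem coe_clampI_of_mem {x : ℝ} (h0 : 0 ≤ x) (h1 : x ≤ 1) : (clampI x : ℝ) = x := by
  rw [coe_clampI, min_eq_right h1, max_eq_right h0]

/-- The concatenation of two families of paths, parametrised by `[-1, 0]` and `[0, 1]`. -/
noncomputable def lineMap (p q : C(S × I, Y)) (h : ∀ s, p (s, 1) = q (s, 0)) : C(S × ℝ, Y) where
  toFun x := if x.2 ≤ 0 then p (x.1, clampI (1 + x.2)) else q (x.1, clampI x.2)
  continuous_toFun := by
    refine Continuous.if_le (by fun_prop) (by fun_prop) (by fun_prop) (by fun_prop) ?_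
    intro x hx
    rw [hx, add_zero, clampI_of_ge le_rfl, clampI_of_le le_rfl, h]

theorem lineMap_of_nonpos {p q : C(S × I, Y)} (h : ∀ s, p (s, 1) = q (s, 0)) (s : S) {x : ℝ}
    (hx : x ≤ 0) : lineMap p q h (s, x) = p (s, clampI (1 + x)) := if_pos hx

theorem lineMap_of_nonneg {p q : C(S × I, Y)} (h : ∀ s, p (s, 1) = q (s, 0)) (s : S) {x : ℝ}
    (hx : 0 ≤ x) : lineMap p q h (s, x) = q (s, clampI x) := by
  rcases hx.lt_or_eq with hx' | rfl
  · exact if_neg hx'.not_ge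
  · rw [lineMap_of_nonpos h s le_rfl, add_zero, clampI_of_ge le_rfl, clampI_of_le le_rfl, h]

end Lines

/-! ### The universal property of double mapping cylinders. -/

namespace HomotopyPushout

variable {S : Type u₁} {A : Type u₂} {B : Type u₃} {Y : Type u₄}
  [TopologicalSpace S] [TopologicalSpace A] [TopologicalSpace B] [TopologicalSpace Y]

section Universal

variable (f : C(S, A)) (g : C(S, B))

/-- The inclusion of the first space. -/
def left : C(A, HomotopyPushout f g) where
  toFun a := inl f g a
  continuous_toFun := continuous_quot_mk.comp continuous_inl

/-- The inclusion of the second space. -/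
def right : C(B, HomotopyPushout f g) where
  toFun b := Quot.mk _ (.inr (.inr b))
  continuous_toFun := continuous_quot_mk.comp (continuous_inr.comp continuous_inr)

/-- The inclusion of the cylinder. -/
def cyl : C(S × I, HomotopyPushout f g) where
  toFun x := Quot.mk _ (.inr (.inl x))
  continuous_toFun := continuous_quot_mk.comp (continuous_inr.comp continuous_inl)

@[simp]
theorem cyl_zero (s : S) : cyl f g (s, 0) = left f g (f s) := Quot.sound (.left s)

@[simp]
theorem cyl_one (s : S) : cyl f g (s, 1) = right f g (g s) := Quot.sound (.right s)

variable {f g}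

theorem ind {p : HomotopyPushout f g → Prop} (hl : ∀ a, p (left f g a))
    (hc : ∀ s t, p (cyl f g (s, t))) (hr : ∀ b, p (right f g b)) (x : HomotopyPushout f g) :
    p x := by
  refine Quot.ind ?_ x
  rintro (a | ⟨s, t⟩ | b)
  exacts [hl a, hc s t, hr b]

theorem isOpen_iff {U : Set (HomotopyPushout f g)} : IsOpen U ↔ IsOpen (left f g ⁻¹' U) ∧
    IsOpen (cyl f g ⁻¹' U) ∧ IsOpen (right f g ⁻¹' U) := by
  refine ⟨fun h => ⟨h.preimage (left f g).continuous, h.preimage (cyl f g).continuous,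
    h.preimage (right f g).continuous⟩, fun ⟨h1, h2, h3⟩ => ?_⟩
  have hq : IsOpen ((Quot.mk (HomotopyPushout.Rel f g)) ⁻¹' U) :=
    isOpen_sum_iff.2 ⟨h1, isOpen_sum_iff.2 ⟨h2, h3⟩⟩
  exact isQuotientMap_quot_mk.isOpen_preimage.1 hq

/-- A map out of an open subset of a homotopy pushout. -/
theorem continuousOn_of {F : HomotopyPushout f g → Y} {O : Set (HomotopyPushout f g)}
    (hO : IsOpen O) (hl : ContinuousOn (F ∘ left f g) (left f g ⁻¹' O))
    (hc : ContinuousOn (F ∘ cyl f g) (cyl f g ⁻¹' O))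
    (hr : ContinuousOn (F ∘ right f g) (right f g ⁻¹' O)) : ContinuousOn F O := by
  rw [continuousOn_open_iff hO]
  intro t ht
  rw [isOpen_iff]
  exact ⟨hl.isOpen_inter_preimage (hO.preimage (left f g).continuous) ht,
    hc.isOpen_inter_preimage (hO.preimage (cyl f g).continuous) ht,
    hr.isOpen_inter_preimage (hO.preimage (right f g).continuous) ht⟩

/-- The underlying function of `desc`. -/
def descFun {Y : Type u₄} (a : A → Y) (c : S × I → Y) (b : B → Y) (h0 : ∀ s, c (s, 0) = a (f s))
    (h1 : ∀ s, c (s, 1) = b (g s)) : HomotopyPushout f g → Y :=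
  Quot.lift (Sum.elim a (Sum.elim c b)) (by rintro _ _ (s | s); exacts [h0 s, h1 s])

/-- The map out of a homotopy pushout given by maps out of its parts. -/
def desc (a : C(A, Y)) (c : C(S × I, Y)) (b : C(B, Y)) (h0 : ∀ s, c (s, 0) = a (f s))
    (h1 : ∀ s, c (s, 1) = b (g s)) : C(HomotopyPushout f g, Y) where
  toFun := descFun a c b h0 h1
  continuous_toFun := by
    refine continuous_quot_lift _ ?_
    exact continuous_sumElim.2 ⟨a.continuous, continuous_sumElim.2 ⟨c.continuous, b.continuous⟩⟩

section

variable (a : C(A, Y)) (c : C(S × I, Y)) (b : C(B, Y)) (h0 : ∀ s, c (s, 0) = a (f s))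
    (h1 : ∀ s, c (s, 1) = b (g s))

@[simp]
theorem desc_left (x : A) : desc a c b h0 h1 (left f g x) = a x := rfl

@[simp]
theorem desc_right (x : B) : desc a c b h0 h1 (right f g x) = b x := rfl

@[simp]
theorem desc_cyl (x : S × I) : desc a c b h0 h1 (cyl f g x) = c x := rfl

end

theorem hom_ext {u v : C(HomotopyPushout f g, Y)} (hl : ∀ a, u (left f g a) = v (left f g a))
    (hc : ∀ s t, u (cyl f g (s, t)) = v (cyl f g (s, t)))
    (hr : ∀ b, u (right f g b) = v (right f g b)) : u = v :=
  ContinuousMap.ext (ind hl hc hr)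

/-- Homotopies of maps out of a homotopy pushout. -/
theorem homotopic_of {u v : C(HomotopyPushout f g, Y)} (a : C(A × I, Y)) (c : C((S × I) × I, Y))
    (b : C(B × I, Y)) (h0 : ∀ s r, c ((s, 0), r) = a (f s, r))
    (h1 : ∀ s r, c ((s, 1), r) = b (g s, r)) (ha0 : ∀ x, a (x, 0) = u (left f g x))
    (ha1 : ∀ x, a (x, 1) = v (left f g x)) (hc0 : ∀ s t, c ((s, t), 0) = u (cyl f g (s, t)))
    (hc1 : ∀ s t, c ((s, t), 1) = v (cyl f g (s, t))) (hb0 : ∀ x, b (x, 0) = u (right f g x))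
    (hb1 : ∀ x, b (x, 1) = v (right f g x)) : u.Homotopic v := by
  let F : C(HomotopyPushout f g, C(I, Y)) := desc a.curry c.curry b.curry
    (fun s => by ext r; exact h0 s r) (fun s => by ext r; exact h1 s r)
  refine homotopic_of_prod F.uncurry (fun x => ?_) fun x => ?_
  · induction x using ind with
    | hl x => exact ha0 x
    | hc s t => exact hc0 s t
    | hr x => exact hb0 x
  · induction x using ind with
    | hl x => exact ha1 x
    | hc s t => exact hc1 s t
    | hr x => exact hb1 x

end Universal

end HomotopyPushout

theorem symm_clampI (x : ℝ) : unitInterval.symm (clampI x) = clampI (1 - x) := by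
  apply Subtype.ext
  rw [unitInterval.coe_symm_eq, coe_clampI, coe_clampI]
  rcases le_total x 0 with h | h <;> rcases le_total x 1 with h' | h' <;>
    (simp [h, h']; try linarith)

/-! ### Homotopy invariance of double mapping cylinders. -/

namespace HomotopyPushout

section Slide

variable {S : Type u₁} {A : Type u₂} {B : Type u₃}
  [TopologicalSpace S] [TopologicalSpace A] [TopologicalSpace B]

/-- The map of homotopy pushouts induced by a homotopy `N` of the first map. -/
noncomputable def slide {f f' : C(S, A)} (g : C(S, B)) (N : C(S × I, A))
    (h0 : ∀ s, N (s, 0) = f s) (h1 : ∀ s, N (s, 1) = f' s) :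
    C(HomotopyPushout f g, HomotopyPushout f' g) :=
  desc (left f' g)
    ((lineMap ((left f' g).comp N) (cyl f' g) fun s => by simp [h1]).comp
      ⟨fun x : S × I => (x.1, 2 * (x.2 : ℝ) - 1), by fun_prop⟩)
    (right f' g)
    (fun s => by
      simp only [comp_apply, coe_mk, Set.Icc.coe_zero]
      rw [lineMap_of_nonpos _ _ (by norm_num), clampI_of_le (by norm_num)]
      simp [h0])
    (fun s => by
      simp only [comp_apply, coe_mk, Set.Icc.coe_one]
      rw [lineMap_of_nonneg _ _ (by norm_num), clampI_of_ge (by norm_num)]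
      simp)

/-- On the cylinder, the composite runs along `N`, back along its reverse `N'`, and then through the
cylinder. All this happens on one line `L`, with `N'` on `[-1, 0]` and the cylinder on `[0, 1]`, so
interpolating positions on the line is a homotopy to the identity. -/
theorem slide_comp_slide {f f' : C(S, A)} (g : C(S, B)) (N N' : C(S × I, A))
    (h0 : ∀ s, N (s, 0) = f s) (h1 : ∀ s, N (s, 1) = f' s)
    (h0' : ∀ s, N' (s, 0) = f' s) (h1' : ∀ s, N' (s, 1) = f s)
    (h : ∀ s t, N' (s, t) = N (s, unitInterval.symm t)) :
    ((slide g N' h0' h1').comp (slide g N h0 h1)).Homotopic (.id _) := by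
  obtain ⟨L, hL⟩ : ∃ L, L = lineMap ((left f g).comp N') (cyl f g) fun s => by simp [h1'] :=
    ⟨_, rfl⟩
  -- The position `max (-2t) (4t - 3)` takes the values `0`, `-1`, `0`, `1` at `t = 0, 1/2, 3/4, 1`;
  -- it is interpolated linearly to `t`, with both ends fixed.
  refine homotopic_of ((left f g).comp ⟨Prod.fst, continuous_fst⟩)
    (L.comp ⟨fun x : (S × I) × I => (x.1.1, (1 - (x.2 : ℝ)) *
      max (-2 * (x.1.2 : ℝ)) (4 * x.1.2 - 3) + x.2 * x.1.2), by fun_prop⟩)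
    ((right f g).comp ⟨Prod.fst, continuous_fst⟩) ?_ ?_ ?_ ?_ ?_ ?_ ?_ ?_
  · intro s r
    have : max (-2 * (0 : ℝ)) (4 * 0 - 3) = 0 := by norm_num
    simp only [comp_apply, coe_mk, Set.Icc.coe_zero, this]
    rw [hL, lineMap_of_nonneg _ _ (by norm_num), clampI_of_le (by norm_num)]
    simp
  · intro s r
    have : max (-2 * (1 : ℝ)) (4 * 1 - 3) = 1 := by norm_num
    simp only [comp_apply, coe_mk, Set.Icc.coe_one, this]
    rw [hL, lineMap_of_nonneg _ _ (by norm_num), clampI_of_ge (by norm_num)]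
    simp
  · intro x; simp [slide]
  · intro x; simp
  · intro s t
    simp only [comp_apply, coe_mk, Set.Icc.coe_zero, sub_zero, one_mul, zero_mul, add_zero]
    have ht := t.2.1
    have ht' := t.2.2
    rcases le_total (t : ℝ) (1 / 2) with hh | hh
    · rw [max_eq_left (by linarith)]
      rw [hL, lineMap_of_nonpos _ _ (by linarith)]
      simp only [slide, desc_cyl, comp_apply, coe_mk]
      rw [lineMap_of_nonpos _ _ (by linarith)]
      simp only [comp_apply, desc_left, h, symm_clampI]
      congr 4
      ring
    · rw [max_eq_right (by linarith)]
      simp only [slide, desc_cyl, comp_apply, coe_mk]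
      rw [lineMap_of_nonneg _ _ (by linarith)]
      simp only [comp_apply, desc_cyl, coe_mk]
      rw [coe_clampI_of_mem (by linarith) (by linarith), ← hL]
      congr 2
      ring
  · intro s t
    simp only [comp_apply, coe_mk, Set.Icc.coe_one, sub_self, zero_mul, one_mul, zero_add]
    rw [hL, lineMap_of_nonneg _ _ t.2.1, clampI_coe]
    rfl
  · intro x; simp [slide]
  · intro x; simp

theorem isHomotopyEquiv_slide {f f' : C(S, A)} (g : C(S, B)) (N : C(S × I, A))
    (h0 : ∀ s, N (s, 0) = f s) (h1 : ∀ s, N (s, 1) = f' s) :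
    IsHomotopyEquiv (slide g N h0 h1) := by
  let N' : C(S × I, A) := N.comp ⟨fun x => (x.1, unitInterval.symm x.2), by fun_prop⟩
  have h0' : ∀ s, N' (s, 0) = f' s := fun s => by simp [N', h1]
  have h1' : ∀ s, N' (s, 1) = f s := fun s => by simp [N', h0]
  refine ⟨slide g N' h0' h1', ?_, ?_⟩
  · exact slide_comp_slide g N N' h0 h1 h0' h1' fun s t => rfl
  · exact slide_comp_slide g N' N h0' h1' h0 h1 fun s t => by simp [N']

end Slide

section Map

variable {S : Type u₁} {A : Type u₂} {B : Type u₃} {S' : Type u₄} {A' : Type u₅} {B' : Type u₆}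
  [TopologicalSpace S] [TopologicalSpace A] [TopologicalSpace B]
  [TopologicalSpace S'] [TopologicalSpace A'] [TopologicalSpace B']

/-- The map induced by a map of spans. -/
def map {f : C(S, A)} {g : C(S, B)} {f' : C(S', A')} {g' : C(S', B')} (a : C(A, A'))
    (s : C(S, S')) (b : C(B, B')) (hf : f'.comp s = a.comp f) (hg : g'.comp s = b.comp g) :
    C(HomotopyPushout f g, HomotopyPushout f' g') :=
  desc ((left f' g').comp a) ((cyl f' g').comp (s.prodMap (.id I))) ((right f' g').comp b)
    (fun x => by simpa using congrArg (left f' g') (DFunLike.congr_fun hf x))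
    (fun x => by simpa using congrArg (right f' g') (DFunLike.congr_fun hg x))

section

variable {f : C(S, A)} {g : C(S, B)} {f' : C(S', A')} {g' : C(S', B')} {a : C(A, A')}
    {s : C(S, S')} {b : C(B, B')} (hf : f'.comp s = a.comp f) (hg : g'.comp s = b.comp g)

@[simp]
theorem map_left (x : A) : map a s b hf hg (left f g x) = left f' g' (a x) := rfl

@[simp]
theorem map_cyl (x : S) (t : I) : map a s b hf hg (cyl f g (x, t)) = cyl f' g' (s x, t) := rfl

@[simp]
theorem map_right (x : B) : map a s b hf hg (right f g x) = right f' g' (b x) := rfl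

end

/-- Exchange of the two ends. -/
def swap (f : C(S, A)) (g : C(S, B)) : C(HomotopyPushout f g, HomotopyPushout g f) :=
  desc (right g f) ((cyl g f).comp ⟨fun x => (x.1, unitInterval.symm x.2), by fun_prop⟩)
    (left g f) (fun s => by simp) (fun s => by simp)

theorem swap_swap (f : C(S, A)) (g : C(S, B)) : (swap g f).comp (swap f g) = .id _ :=
  hom_ext (fun a => rfl) (fun s t => by simp [swap]) (fun b => rfl)

theorem isHomotopyEquiv_swap (f : C(S, A)) (g : C(S, B)) : IsHomotopyEquiv (swap f g) :=
  ⟨swap g f, by rw [swap_swap], by rw [swap_swap]⟩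

/-- The map induced by a map of the first spaces. -/
abbrev mapLeft (f : C(S, A)) (g : C(S, B)) (a : C(A, A')) :
    C(HomotopyPushout f g, HomotopyPushout (a.comp f) g) :=
  map a (.id S) (.id B) rfl rfl

/-- The map induced by a map of the second spaces. -/
abbrev mapRight (f : C(S, A)) (g : C(S, B)) (b : C(B, B')) :
    C(HomotopyPushout f g, HomotopyPushout f (b.comp g)) :=
  map (.id A) (.id S) b rfl rfl

/-- The map induced by a map of the middle spaces. -/
abbrev mapMid (f : C(S, A)) (g : C(S, B)) (s : C(S', S)) :
    C(HomotopyPushout (f.comp s) (g.comp s), HomotopyPushout f g) :=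
  map (.id A) s (.id B) rfl rfl

/-- Sliding along the homotopy from `a ∘ f` to `f` is an equivalence and undoes the map: while `A`
moves along `K`, the remaining piece of `N` in front of the cylinder is shortened from length `1` to
`0`. -/
theorem isHomotopyEquiv_mapLeft_of_homotopic (f : C(S, A)) (g : C(S, B)) {a : C(A, A)}
    (ha : a.Homotopic (.id A)) : IsHomotopyEquiv (mapLeft f g a) := by
  obtain ⟨K, K0, K1⟩ := ha.exists_prod
  let N : C(S × I, A) := K.comp ⟨fun x => (f x.1, x.2), by fun_prop⟩
  have hN0 : ∀ s, N (s, 0) = a.comp f s := fun s => by simp [N, K0]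
  have hN1 : ∀ s, N (s, 1) = f s := fun s => by simp [N, K1]
  refine IsHomotopyEquiv.of_comp_left (g := slide g N hN0 hN1) ?_
    (isHomotopyEquiv_slide g N hN0 hN1)
  refine IsHomotopyEquiv.congr IsHomotopyEquiv.id (Homotopic.symm ?_)
  let L := lineMap ((left f g).comp N) (cyl f g) fun s => by simp [hN1]
  have hL : ∀ x, L x = lineMap ((left f g).comp N) (cyl f g) (fun s => by simp [hN1]) x :=
    fun _ => rfl
  refine homotopic_of ((left f g).comp K)
    (L.comp ⟨fun x : (S × I) × I =>
      (x.1.1, ((x.2 : ℝ) - 1) + (2 - x.2) * x.1.2), by fun_prop⟩)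
    ((right f g).comp ⟨Prod.fst, continuous_fst⟩) ?_ ?_ ?_ ?_ ?_ ?_ ?_ ?_
  · intro s r
    simp only [comp_apply, coe_mk, Set.Icc.coe_zero, mul_zero, add_zero]
    rw [hL, lineMap_of_nonpos _ _ (by linarith [r.2.2])]
    simp only [comp_apply, add_sub_cancel, clampI_coe]
    rfl
  · intro s r
    simp only [comp_apply, coe_mk, Set.Icc.coe_one]
    rw [hL, lineMap_of_nonneg _ _ (by linarith), clampI_of_ge (by linarith)]
    simp
  · intro x
    exact congrArg (left f g) (K0 x)
  · intro x; simp [K1]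
  · intro s t
    change L (s, ((0 : ℝ) - 1) + (2 - 0) * t) = L (s, 2 * (t : ℝ) - 1)
    congr 2
    ring
  · intro s t
    simp only [comp_apply, coe_mk, Set.Icc.coe_one, id_apply]
    rw [hL, lineMap_of_nonneg _ _ (by linarith [t.2.1])]
    congr 2
    rw [sub_self, zero_add, show (2 - 1 : ℝ) * t = t by ring, clampI_coe]
  · intro x; rfl
  · intro x; rfl

/-- The composites of the maps induced by `a` and a homotopy inverse `b`, in both orders, come from
self-maps homotopic to the identity. So the middle map has inverses on both sides, and `a` follows
by cancellation. -/
theorem isHomotopyEquiv_mapLeft (f : C(S, A)) (g : C(S, B)) {a : C(A, A')}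
    (ha : IsHomotopyEquiv a) : IsHomotopyEquiv (mapLeft f g a) := by
  obtain ⟨b, h1, h2⟩ := ha
  have key : ∀ {A₁ : Type u₂} {A₂ : Type u₅} [TopologicalSpace A₁] [TopologicalSpace A₂]
      (f : C(S, A₁)) (a : C(A₁, A₂)) (b : C(A₂, A₁)), (b.comp a).Homotopic (.id A₁) →
      IsHomotopyEquiv ((mapLeft (a.comp f) g b).comp (mapLeft f g a)) := by
    intro A₁ A₂ _ _ f a b h
    have e : mapLeft f g (b.comp a) = (mapLeft (a.comp f) g b).comp (mapLeft f g a) :=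
      hom_ext (fun _ => rfl) (fun _ _ => rfl) fun _ => rfl
    exact e ▸ isHomotopyEquiv_mapLeft_of_homotopic f g h
  -- The same statement with the universe levels of the two spaces exchanged.
  have key' : ∀ {A₁ : Type u₅} {A₂ : Type u₂} [TopologicalSpace A₁] [TopologicalSpace A₂]
      (f : C(S, A₁)) (a : C(A₁, A₂)) (b : C(A₂, A₁)), (b.comp a).Homotopic (.id A₁) →
      IsHomotopyEquiv ((mapLeft (a.comp f) g b).comp (mapLeft f g a)) := by
    intro A₁ A₂ _ _ f a b h
    have e : mapLeft f g (b.comp a) = (mapLeft (a.comp f) g b).comp (mapLeft f g a) :=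
      hom_ext (fun _ => rfl) (fun _ _ => rfl) fun _ => rfl
    exact e ▸ isHomotopyEquiv_mapLeft_of_homotopic f g h
  have e1 := key f a b h1
  have e2 := key' (a.comp f) b a h2
  have hb : IsHomotopyEquiv (mapLeft (a.comp f) g b) := by
    obtain ⟨r, -, hr⟩ := e1
    obtain ⟨l, hl, -⟩ := e2
    exact IsHomotopyEquiv.of_left_right (l := l.comp (mapLeft (b.comp (a.comp f)) g a))
      (r := (mapLeft f g a).comp r) hl hr
  exact IsHomotopyEquiv.of_comp_left e1 hb

theorem isHomotopyEquiv_mapRight (f : C(S, A)) (g : C(S, B)) {b : C(B, B')}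
    (hb : IsHomotopyEquiv b) : IsHomotopyEquiv (mapRight f g b) := by
  have h := (isHomotopyEquiv_swap (b.comp g) f).comp
    ((isHomotopyEquiv_mapLeft g f hb).comp (isHomotopyEquiv_swap f g))
  refine (congrArg IsHomotopyEquiv ?_).mp h
  refine hom_ext (fun a => rfl) (fun s t => ?_) (fun b => rfl)
  change cyl _ _ (s, unitInterval.symm (unitInterval.symm t)) = cyl _ _ (s, t)
  simp

/-- Slides along `f ∘ K` and `g ∘ K` at the two ends give an equivalence `e` in the opposite
direction. The composite with `e` still has the form `cyl (K (x, ·), ·)` on the cylinder, and both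
parameters can be straightened. -/
theorem isHomotopyEquiv_mapMid_of_homotopic (f : C(S, A)) (g : C(S, B)) {s : C(S, S)}
    (hs : s.Homotopic (.id S)) : IsHomotopyEquiv (mapMid f g s) := by
  obtain ⟨K, K0, K1⟩ := hs.exists_prod
  let N : C(S × I, A) := f.comp (K.comp ⟨fun x => (x.1, unitInterval.symm x.2), by fun_prop⟩)
  have hN0 : ∀ x, N (x, 0) = f x := fun x => by simp [N, K1]
  have hN1 : ∀ x, N (x, 1) = f.comp s x := fun x => by simp [N, K0]
  let N' : C(S × I, B) := g.comp (K.comp ⟨fun x => (x.1, unitInterval.symm x.2), by fun_prop⟩)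
  have hN0' : ∀ x, N' (x, 0) = g x := fun x => by simp [N', K1]
  have hN1' : ∀ x, N' (x, 1) = g.comp s x := fun x => by simp [N', K0]
  let e := (swap (g.comp s) (f.comp s)).comp
    ((slide (f.comp s) N' hN0' hN1').comp ((swap (f.comp s) g).comp (slide g N hN0 hN1)))
  have he : IsHomotopyEquiv e :=
    (isHomotopyEquiv_swap _ _).comp ((isHomotopyEquiv_slide _ _ _ _).comp
      ((isHomotopyEquiv_swap _ _).comp (isHomotopyEquiv_slide _ _ _ _)))
  refine IsHomotopyEquiv.of_comp_right (f := e) ?_ he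
  refine IsHomotopyEquiv.congr IsHomotopyEquiv.id (Homotopic.symm ?_)
  -- At time `0` the parameter of `K` falls from `1` to `0` for `t ≤ 1/2`, stays at `0` up to `3/4`
  -- while the cylinder coordinate `4t - 2` grows from `0` to `1`, and then returns to `1`. At time
  -- `1` the parameters are `1` and `t`.
  refine homotopic_of ((left f g).comp ⟨Prod.fst, continuous_fst⟩)
    ((cyl f g).comp ⟨fun x : (S × I) × I => (K (x.1.1, clampI ((1 - (x.2 : ℝ)) *
        max 0 (max (1 - 2 * (x.1.2 : ℝ)) (4 * x.1.2 - 3)) + x.2)),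
      clampI ((1 - (x.2 : ℝ)) * max 0 (min 1 (4 * (x.1.2 : ℝ) - 2)) + x.2 * x.1.2)), by fun_prop⟩)
    ((right f g).comp ⟨Prod.fst, continuous_fst⟩) ?_ ?_ ?_ ?_ ?_ ?_ ?_ ?_
  · intro s r
    have h1 : max 0 (max (1 - 2 * (0 : ℝ)) (4 * 0 - 3)) = 1 := by norm_num
    have h2 : max 0 (min 1 (4 * (0 : ℝ) - 2)) = 0 := by norm_num
    simp only [comp_apply, coe_mk, Set.Icc.coe_zero, h1, h2]
    rw [clampI_of_ge (by linarith), clampI_of_le (by simp)]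
    simp [K1]
  · intro s r
    have h1 : max 0 (max (1 - 2 * (1 : ℝ)) (4 * 1 - 3)) = 1 := by norm_num
    have h2 : max 0 (min 1 (4 * (1 : ℝ) - 2)) = 1 := by norm_num
    simp only [comp_apply, coe_mk, Set.Icc.coe_one, h1, h2]
    rw [clampI_of_ge (by linarith), clampI_of_ge (by linarith)]
    simp [K1]
  · intro x; rfl
  · intro x; rfl
  · intro x t
    have ht := t.2.1
    have ht' := t.2.2
    simp only [comp_apply, coe_mk, Set.Icc.coe_zero, sub_zero, one_mul, zero_mul, add_zero]
    simp only [e, slide, comp_apply, desc_cyl, coe_mk]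
    rcases le_total (t : ℝ) (1 / 2) with hh | hh
    · rw [lineMap_of_nonpos _ _ (by linarith)]
      rw [max_eq_left (a := 1 - 2 * (t : ℝ)) (by linarith), max_eq_right (by linarith),
        min_eq_right (by linarith), max_eq_left (by linarith), clampI_of_le le_rfl]
      simp only [comp_apply, swap, desc_left, desc_right, coe_mk, N, symm_clampI, cyl_zero]
      change _ = left f g (f _)
      ring_nf
    · rw [lineMap_of_nonneg _ _ (by linarith)]
      simp only [comp_apply, desc_cyl, coe_mk, swap, symm_clampI]
      rw [coe_clampI_of_mem (by linarith) (by linarith)]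
      rcases le_total (t : ℝ) (3 / 4) with hk | hk
      · rw [lineMap_of_nonneg _ _ (by linarith), max_eq_left (by
          rw [max_le_iff]; constructor <;> linarith),
          min_eq_right (by linarith), max_eq_right (by linarith), clampI_of_le le_rfl, K0]
        simp only [comp_apply, desc_cyl, coe_mk, symm_clampI]
        change _ = cyl f g (s x, clampI _)
        congr 3
        ring
      · rw [lineMap_of_nonpos _ _ (by linarith), max_eq_right (a := 1 - 2 * (t : ℝ))
          (by linarith), max_eq_right (by linarith), min_eq_left (by linarith),
          max_eq_right (by linarith), clampI_of_ge le_rfl]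
        simp only [comp_apply, desc_left, desc_right, coe_mk, N', symm_clampI, cyl_one]
        change _ = right f g (g _)
        ring_nf
  · intro x t
    simp only [comp_apply, coe_mk, Set.Icc.coe_one, sub_self, zero_mul, zero_add, one_mul,
      clampI_coe, id_apply]
    rw [clampI_of_ge le_rfl, K1]
    rfl
  · intro x; rfl
  · intro x; rfl

theorem isHomotopyEquiv_mapMid (f : C(S, A)) (g : C(S, B)) {s : C(S', S)}
    (hs : IsHomotopyEquiv s) : IsHomotopyEquiv (mapMid f g s) := by
  obtain ⟨r, h1, h2⟩ := hs
  refine IsHomotopyEquiv.of_two_of_six (g := mapMid (f.comp s) (g.comp s) r)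
    (f := mapMid ((f.comp s).comp r) ((g.comp s).comp r) s) ?_ ?_
  · have e : mapMid (f.comp s) (g.comp s) (r.comp s) = (mapMid (f.comp s) (g.comp s) r).comp
        (mapMid ((f.comp s).comp r) ((g.comp s).comp r) s) :=
      hom_ext (fun _ => rfl) (fun _ _ => rfl) fun _ => rfl
    exact e ▸ isHomotopyEquiv_mapMid_of_homotopic (f.comp s) (g.comp s) h1
  · have e : mapMid f g (s.comp r) = (mapMid f g s).comp (mapMid (f.comp s) (g.comp s) r) :=
      hom_ext (fun _ => rfl) (fun _ _ => rfl) fun _ => rfl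
    exact e ▸ isHomotopyEquiv_mapMid_of_homotopic f g h2

/-- Homotopy pushouts are homotopy invariant. -/
theorem nonempty_homotopyEquiv {f : C(S, A)} {g : C(S, B)} {f' : C(S', A')} {g' : C(S', B')}
    {a : C(A, A')} {s : C(S, S')} {b : C(B, B')} (ha : IsHomotopyEquiv a)
    (hs : IsHomotopyEquiv s) (hb : IsHomotopyEquiv b)
    (hf : (a.comp f).Homotopic (f'.comp s)) (hg : (b.comp g).Homotopic (g'.comp s)) :
    Nonempty (HomotopyPushout f g ≃ₕ HomotopyPushout f' g') := by
  obtain ⟨N, N0, N1⟩ := hf.exists_prod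
  obtain ⟨N', N0', N1'⟩ := hg.exists_prod
  -- The three spaces are replaced one at a time. Since the squares commute only up to homotopy,
  -- slides correct the maps in between, with `swap` to reach the second leg.
  have e1 := (isHomotopyEquiv_mapLeft f g ha).nonempty
  have e2 := (isHomotopyEquiv_mapRight (a.comp f) g hb).nonempty
  have e3 := (isHomotopyEquiv_slide (b.comp g) N N0 N1).nonempty
  have e4 := (isHomotopyEquiv_swap (f'.comp s) (b.comp g)).nonempty
  have e5 := (isHomotopyEquiv_slide (f'.comp s) N' N0' N1').nonempty
  have e6 := (isHomotopyEquiv_swap (g'.comp s) (f'.comp s)).nonempty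
  have e7 := (isHomotopyEquiv_mapMid f' g' hs).nonempty
  exact ⟨e1.some.trans <| e2.some.trans <| e3.some.trans <| e4.some.trans <| e5.some.trans <|
    e6.some.trans e7.some⟩

end Map

/-! ### Pasting of double mapping cylinders. -/

section Paste

variable {S : Type u₁} {A : Type u₂} {B : Type u₃} {C : Type u₄}
  [TopologicalSpace S] [TopologicalSpace A] [TopologicalSpace B] [TopologicalSpace C]

/-- Pasting of homotopy pushouts. -/
theorem nonempty_paste (f : C(C, A)) (c : C(S, C)) (g : C(S, B)) :
    Nonempty (HomotopyPushout f (left c g) ≃ₕ HomotopyPushout (f.comp c) g) := by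
  let u : C(HomotopyPushout c g, HomotopyPushout (f.comp c) g) :=
    desc ((left _ _).comp f) (cyl (f.comp c) g) (right _ _)
    (fun s => by simp) (fun s => by simp)
  let F : C(HomotopyPushout f (left c g), HomotopyPushout (f.comp c) g) :=
    desc (left _ _) ((left _ _).comp (f.comp ⟨Prod.fst, continuous_fst⟩)) u
    (fun s => by simp) (fun s => by simp [u])
  -- `L` crosses the cylinder of `C` over `c s` and then the cylinder of `S`. The map `F` collapses
  -- the first of these, and `G` stretches one cylinder over both.
  let L : C(S × ℝ, HomotopyPushout f (left c g)) :=
    lineMap ((cyl f (left c g)).comp ⟨fun x => (c x.1, x.2), by fun_prop⟩)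
    ((right f (left c g)).comp (cyl c g)) fun s => by simp
  have hL0 : ∀ s (x : ℝ), x ≤ 0 → L (s, x) = cyl f (left c g) (c s, clampI (1 + x)) :=
    fun s x hx => lineMap_of_nonpos _ _ hx
  have hL1 : ∀ s (x : ℝ), 0 ≤ x → L (s, x) = right f (left c g) (cyl c g (s, clampI x)) :=
    fun s x hx => lineMap_of_nonneg _ _ hx
  clear_value L
  let G : C(HomotopyPushout (f.comp c) g, HomotopyPushout f (left c g)) := desc (left _ _)
    (L.comp ⟨fun x : S × I => (x.1, 2 * (x.2 : ℝ) - 1), by fun_prop⟩)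
    ((right _ _).comp (right c g))
    (fun s => by
      simp only [comp_apply, coe_mk, Set.Icc.coe_zero]
      rw [hL0 _ _ (by norm_num), clampI_of_le (by norm_num)]
      simp)
    (fun s => by
      simp only [comp_apply, coe_mk, Set.Icc.coe_one]
      rw [hL1 _ _ (by norm_num), clampI_of_ge (by norm_num)]
      simp)
  refine ⟨⟨F, G, ?_, ?_⟩⟩
  · let b : C((HomotopyPushout c g) × I, HomotopyPushout f (left c g)) :=
      (desc (Y := C(I, HomotopyPushout f (left c g))) (f := c) (g := g) (cyl f (left c g)).curry
        (L.comp ⟨fun x : (S × I) × I => (x.1.1, ((x.2 : ℝ) - 1) + (2 - x.2) * x.1.2),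
          by fun_prop⟩).curry
        ((right f (left c g)).comp ((right c g).comp ⟨Prod.fst, continuous_fst⟩)).curry
        (fun s => by
          ext r
          simp only [curry_apply, comp_apply, coe_mk, Set.Icc.coe_zero]
          rw [hL0 _ _ (by linarith [r.2.2])]
          simp [clampI_coe])
        (fun s => by
          ext r
          simp only [curry_apply, comp_apply, coe_mk, Set.Icc.coe_one]
          rw [hL1 _ _ (by linarith), clampI_of_ge (by linarith)]
          simp)).uncurry
    refine homotopic_of ((left _ _).comp ⟨Prod.fst, continuous_fst⟩)
      ((cyl _ _).comp ⟨fun x : (C × I) × I => (x.1.1, x.1.2 * x.2), by fun_prop⟩) b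
      ?_ ?_ ?_ ?_ ?_ ?_ ?_ ?_
    · intro x r; simp
    · intro x r
      simp only [comp_apply, coe_mk, one_mul]
      rfl
    · intro x; rfl
    · intro x; rfl
    · intro x t
      simp only [comp_apply, coe_mk, mul_zero, cyl_zero]
      rfl
    · intro x t; simp
    · intro x
      induction x using ind with
      | hl x =>
        change cyl f (left c g) (x, 0) = left _ _ (f x)
        simp
      | hc s t =>
        change L (s, ((0 : ℝ) - 1) + (2 - 0) * t) = L (s, 2 * (t : ℝ) - 1)
        ring_nf
      | hr x => rfl
    · intro x
      induction x using ind with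
      | hl x =>
        change cyl f (left c g) (x, 1) = right _ _ (left c g x)
        simp
      | hc s t =>
        change L (s, ((1 : ℝ) - 1) + (2 - 1) * t) = right _ _ (cyl c g (s, t))
        rw [show ((1 : ℝ) - 1) + (2 - 1) * t = t by ring, hL1 _ _ t.2.1, clampI_coe]
      | hr x => rfl
  · refine homotopic_of ((left _ _).comp ⟨Prod.fst, continuous_fst⟩)
      ((cyl _ _).comp ⟨fun x : (S × I) × I => (x.1.1,
        clampI ((1 - (x.2 : ℝ)) * (2 * x.1.2 - 1) + x.2 * x.1.2)), by fun_prop⟩)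
      ((right _ _).comp ⟨Prod.fst, continuous_fst⟩) ?_ ?_ ?_ ?_ ?_ ?_ ?_ ?_
    · intro s r
      simp only [comp_apply, coe_mk, Set.Icc.coe_zero]
      rw [clampI_of_le (by linarith [r.2.2])]
      simp
    · intro s r
      simp only [comp_apply, coe_mk, Set.Icc.coe_one]
      rw [clampI_of_ge (by linarith)]
      simp
    · intro x; rfl
    · intro x; rfl
    · intro s t
      simp only [comp_apply, coe_mk, Set.Icc.coe_zero, sub_zero, one_mul, zero_mul, add_zero]
      change _ = F (L (s, 2 * (t : ℝ) - 1))
      rcases le_total (2 * (t : ℝ) - 1) 0 with h | h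
      · rw [hL0 _ _ h, clampI_of_le h]
        rw [cyl_zero]
        rfl
      · rw [hL1 _ _ h]
        rfl
    · intro s t
      simp [clampI_coe]
    · intro x; rfl
    · intro x; rfl

end Paste

/-! ### Open covers as homotopy pushouts. -/

section Cover

variable {X : Type u₁} [TopologicalSpace X] (τ : C(X, I))

/-- The inclusion between subtypes. -/
def subtypeIncl {p q : X → Prop} (h : ∀ x, p x → q x) : C({x // p x}, {x // q x}) where
  toFun x := ⟨x.1, h x.1 x.2⟩
  continuous_toFun := by fun_prop

/-- The homotopy pushout of the open cover `{τ < 1}`, `{0 < τ}`. -/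
abbrev Cover :=
  HomotopyPushout (subtypeIncl (p := fun x => 0 < τ x ∧ τ x < 1) (q := fun x => τ x < 1)
    fun _ h => h.2) (subtypeIncl (q := fun x => 0 < τ x) fun _ h => h.1)

/-- The projection from the homotopy pushout of a cover. -/
def coverProj : C(Cover τ, X) :=
  desc ⟨Subtype.val, continuous_subtype_val⟩
    ((⟨Subtype.val, continuous_subtype_val⟩ : C({x // 0 < τ x ∧ τ x < 1}, X)).comp
      ⟨Prod.fst, continuous_fst⟩)
    ⟨Subtype.val, continuous_subtype_val⟩ (fun _ => rfl) fun _ => rfl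

/-- The homotopy pushout of the cover `{τ < 1}`, `{0 < τ}` is homotopy equivalent to the space. -/
theorem isHomotopyEquiv_coverProj : IsHomotopyEquiv (coverProj τ) := by
  let i := subtypeIncl (p := fun x => 0 < τ x ∧ τ x < 1) (q := fun x => τ x < 1) fun _ h => h.2
  let j := subtypeIncl (p := fun x => 0 < τ x ∧ τ x < 1) (q := fun x => 0 < τ x) fun _ h => h.1
  -- `P x c` is the point over `x` with cylinder coordinate `c`, which is 0 near `τ = 0`
  -- and `1` near `τ = 1`
  let P : X × I → Cover τ := fun x =>
    if h : 0 < τ x.1 ∧ τ x.1 < 1 then cyl i j (⟨x.1, h⟩, x.2)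
    else if h' : τ x.1 < 1 then left i j ⟨x.1, h'⟩
    else right i j ⟨x.1, zero_lt_one.trans_le (not_lt.1 h')⟩
  have hP : ∀ x c (h : 0 < τ x ∧ τ x < 1), P (x, c) = cyl i j (⟨x, h⟩, c) :=
    fun x c h => dif_pos h
  have hP0 : ∀ x (c : I) (h : τ x < 1), c = 0 → P (x, c) = left i j ⟨x, h⟩ := by
    rintro x c h rfl
    by_cases h' : 0 < τ x ∧ τ x < 1
    · rw [hP x _ h', cyl_zero]; rfl
    · simp only [P]; rw [dif_neg h', dif_pos h]
  have hP1 : ∀ x (c : I) (h : 0 < τ x), c = 1 → P (x, c) = right i j ⟨x, h⟩ := by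
    rintro x c h rfl
    by_cases h' : τ x < 1
    · rw [hP x _ ⟨h, h'⟩, cyl_one]; rfl
    · simp only [P]; rw [dif_neg (fun hh => h' hh.2), dif_neg h']
  clear_value P
  -- `P` changes its defining formula where `τ` reaches `0` or `1`. It is continuous along `(x, c)`
  -- if `c` is locally constant there with the value of the respective end, or if that value of `τ`
  -- does not occur.
  have key : ∀ {Z : Type u₁} [TopologicalSpace Z] (x : C(Z, X)) (c : C(Z, I)),
      ((∀ z, 0 < τ (x z)) ∨ ∀ z, (τ (x z) : ℝ) ≤ 1 / 3 → c z = 0) →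
      ((∀ z, τ (x z) < 1) ∨ ∀ z, 2 / 3 ≤ (τ (x z) : ℝ) → c z = 1) →
      Continuous fun z => P (x z, c z) := by
    intro Z _ x c h0 h1
    rw [continuous_iff_continuousAt]
    intro z
    have hτ : Continuous fun z => (τ (x z) : ℝ) := by fun_prop
    by_cases hz : 0 < τ (x z)
    · by_cases hz' : τ (x z) < 1
      · have hO : IsOpen {z | 0 < τ (x z) ∧ τ (x z) < 1} :=
          (isOpen_lt continuous_const (by fun_prop)).inter
            (isOpen_lt (by fun_prop) continuous_const)
        refine ContinuousOn.continuousAt ?_ (hO.mem_nhds ⟨hz, hz'⟩)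
        rw [continuousOn_iff_continuous_domRestrict]
        have : Continuous fun z : {z | 0 < τ (x z) ∧ τ (x z) < 1} =>
            cyl i j (⟨x z, z.2⟩, c z) := by fun_prop
        convert this using 2 with z
        exact hP _ _ z.2
      · have h1 := h1.resolve_left fun h => hz' (h z)
        have hO : IsOpen {z | 2 / 3 < (τ (x z) : ℝ)} := isOpen_lt continuous_const hτ
        have hm : 1 ≤ (τ (x z) : ℝ) := not_lt.1 hz'
        refine ContinuousOn.continuousAt ?_ (hO.mem_nhds (lt_of_lt_of_le (by norm_num) hm))
        rw [continuousOn_iff_continuous_domRestrict]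
        have hl : ∀ z : {z | 2 / 3 < (τ (x z) : ℝ)}, 0 < τ (x z) := fun z => by
          have := z.2.out
          rw [← Subtype.coe_lt_coe]
          exact lt_trans (by norm_num) this
        have : Continuous fun z : {z | 2 / 3 < (τ (x z) : ℝ)} => right i j ⟨x z, hl z⟩ := by
          fun_prop
        convert this using 2 with z
        exact hP1 _ _ _ (h1 _ z.2.out.le)
    · have h0 := h0.resolve_left fun h => hz (h z)
      have hO : IsOpen {z | (τ (x z) : ℝ) < 1 / 3} := isOpen_lt hτ continuous_const
      have hm : (τ (x z) : ℝ) ≤ 0 := not_lt.1 hz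
      refine ContinuousOn.continuousAt ?_ (hO.mem_nhds (lt_of_le_of_lt hm (by norm_num)))
      rw [continuousOn_iff_continuous_domRestrict]
      have hl : ∀ z : {z | (τ (x z) : ℝ) < 1 / 3}, τ (x z) < 1 := fun z => by
        have := z.2.out
        rw [← Subtype.coe_lt_coe]
        exact this.trans (by norm_num)
      have : Continuous fun z : {z | (τ (x z) : ℝ) < 1 / 3} => left i j ⟨x z, hl z⟩ := by fun_prop
      convert this using 2 with z
      exact hP0 _ _ _ (h0 _ z.2.out.le)
  -- the cylinder coordinate of the section
  let κ : C(X, I) := ⟨fun x => clampI (3 * (τ x : ℝ) - 1), by fun_prop⟩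
  have κ0 : ∀ x, (τ x : ℝ) ≤ 1 / 3 → κ x = 0 := fun x h => clampI_of_le (by linarith)
  have κ1 : ∀ x, 2 / 3 ≤ (τ x : ℝ) → κ x = 1 := fun x h => clampI_of_ge (by linarith)
  let sec : C(X, Cover τ) := ⟨fun x => P (x, κ x), key (.id X) κ (.inr κ0) (.inr κ1)⟩
  have hsec : (coverProj τ).comp sec = .id X := by
    ext x
    change coverProj τ (P (x, κ x)) = x
    by_cases h : τ x < 1
    · by_cases h' : 0 < τ x
      · rw [hP _ _ ⟨h', h⟩]; rfl
      · rw [hP0 _ _ h (κ0 _ ?_)]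
        · rfl
        · have : (τ x : ℝ) ≤ 0 := not_lt.1 h'
          linarith
    · have h' : 1 ≤ (τ x : ℝ) := not_lt.1 h
      rw [hP1 _ _ (zero_lt_one.trans_le (not_lt.1 h)) (κ1 _ (by linarith))]
      rfl
  refine ⟨sec, ?_, by rw [hsec]⟩
  -- The homotopy keeps the point of `X` and interpolates the cylinder coordinate from `κ` to the
  -- given one, which is `0` on the left and `1` on the right end.
  let ca : C({x // τ x < 1} × I, I) :=
    ⟨fun x => clampI ((1 - (x.2 : ℝ)) * κ x.1.1), by fun_prop⟩
  let cb : C({x // 0 < τ x} × I, I) :=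
    ⟨fun x => clampI ((x.2 : ℝ) + (1 - (x.2 : ℝ)) * κ x.1.1), by fun_prop⟩
  let a : C({x // τ x < 1} × I, Cover τ) := ⟨fun x => P (x.1.1, ca x),
    key (⟨fun x => x.1.1, by fun_prop⟩ : C({x // τ x < 1} × I, X)) ca
      (.inr fun z hz => clampI_of_le (by
        rw [show κ z.1.1 = 0 from κ0 _ hz]; simp)) (.inl fun z => z.1.2)⟩
  let b : C({x // 0 < τ x} × I, Cover τ) := ⟨fun x => P (x.1.1, cb x),
    key (⟨fun x => x.1.1, by fun_prop⟩ : C({x // 0 < τ x} × I, X)) cb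
      (.inl fun z => z.1.2) (.inr fun z hz => clampI_of_ge (by
        rw [show κ z.1.1 = 1 from κ1 _ hz]; simp))⟩
  refine homotopic_of a ((cyl i j).comp ⟨fun x : ({x // 0 < τ x ∧ τ x < 1} × I) × I =>
    (x.1.1, clampI (x.2 * x.1.2 + (1 - (x.2 : ℝ)) * κ x.1.1.1)), by fun_prop⟩) b
      ?_ ?_ ?_ ?_ ?_ ?_ ?_ ?_
  · intro s r
    change _ = P (s.1, _)
    rw [hP s.1 _ s.2]
    simp [ca]; rfl
  · intro s r
    change _ = P (s.1, _)
    rw [hP s.1 _ s.2]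
    simp [cb]; rfl
  · intro x
    change P (x.1, _) = P (x.1, _)
    simp [ca, clampI_coe]; rfl
  · intro x
    exact hP0 _ _ x.2 (clampI_of_le (by simp))
  · intro s t
    change _ = P (s.1, _)
    rw [hP _ _ s.2]
    simp [clampI_coe]
    rfl
  · intro s t
    simp [clampI_coe]
    rfl
  · intro x
    change P (x.1, _) = P (x.1, _)
    simp [cb, clampI_coe]; rfl
  · intro x
    exact hP1 _ _ x.2 (clampI_of_ge (by simp))

/-- Let `σ : K → X` be a map that is a homotopy equivalence over the second set `{0 < τ}` of a
cover and over the intersection. Then `X` arises from the first set `{τ < 1}` by attaching `K`. -/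
theorem nonempty_cover_section {K : Type u₂} [TopologicalSpace K] (s : C(K, X)) (τK : C(K, I))
    (hK : ∀ x, τK x = τ (s x)) (sU : C({x // τK x < 1}, {x // τ x < 1}))
    (hU : ∀ x, (sU x).1 = s x.1) (sV : C({x // 0 < τK x}, {x // 0 < τ x}))
    (hV : ∀ x, (sV x).1 = s x.1)
    (sW : C({x // 0 < τK x ∧ τK x < 1}, {x // 0 < τ x ∧ τ x < 1}))
    (hW : ∀ x, (sW x).1 = s x.1) (eV : IsHomotopyEquiv sV) (eW : IsHomotopyEquiv sW) :
    Nonempty (X ≃ₕ HomotopyPushout sU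
      (⟨Subtype.val, continuous_subtype_val⟩ : C({x // τK x < 1}, K))) := by
  let iX := subtypeIncl (p := fun x => 0 < τ x ∧ τ x < 1) (q := fun x => τ x < 1) fun _ h => h.2
  let jX := subtypeIncl (p := fun x => 0 < τ x ∧ τ x < 1) (q := fun x => 0 < τ x) fun _ h => h.1
  let iK := subtypeIncl (p := fun x => 0 < τK x ∧ τK x < 1) (q := fun x => τK x < 1)
    fun _ h => h.2
  let jK := subtypeIncl (p := fun x => 0 < τK x ∧ τK x < 1) (q := fun x => 0 < τK x)
    fun _ h => h.1
  -- `X` is the homotopy pushout of its cover. The second set and the intersection may be replaced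
  -- by those of `K`. Pasting then reassembles `K` from its own cover, glued to `{τ < 1}` along `{τK
  -- < 1}`.
  have e1 := (isHomotopyEquiv_coverProj τ).nonempty
  have e2 : Nonempty (HomotopyPushout (sU.comp iK) jK ≃ₕ HomotopyPushout iX jX) := by
    refine nonempty_homotopyEquiv (a := .id _) (s := sW) (b := sV) .id eW eV ?_ ?_
    · have : (ContinuousMap.id _).comp (sU.comp iK) = iX.comp sW := by
        ext x
        change (sU (iK x)).1 = (sW x).1
        rw [hU, hW]; rfl
      rw [this]
    · have : sV.comp jK = jX.comp sW := by
        ext x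
        change (sV (jK x)).1 = (sW x).1
        rw [hV, hW]; rfl
      rw [this]
  have e3 := nonempty_paste sU iK jK
  have e4 : Nonempty (HomotopyPushout sU (left iK jK) ≃ₕ HomotopyPushout sU
      (⟨Subtype.val, continuous_subtype_val⟩ : C({x // τK x < 1}, K))) :=
    nonempty_homotopyEquiv (a := .id _) (s := .id _) .id .id (isHomotopyEquiv_coverProj τK)
      (.refl _) (.refl _)
  exact ⟨e1.some.symm.trans <| e2.some.symm.trans <| e3.some.symm.trans e4.some⟩

end Cover

end HomotopyPushout

/-! ### Lifts, homotopy fibres and transport. -/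

section Lifts

variable {X : Type u₁} {Y : Type u₂} {Z : Type u₃}
  [TopologicalSpace X] [TopologicalSpace Y] [TopologicalSpace Z]

/-- A map into the range of an embedding lifts. -/
theorem Topology.IsEmbedding.exists_lift {v : X → Y} (hv : IsEmbedding v) (f : C(Z, Y))
    (hf : ∀ z, f z ∈ Set.range v) : ∃ g : C(Z, X), ∀ z, v (g z) = f z := by
  choose g hg using hf
  exact ⟨⟨g, hv.continuous_iff.2 (by simpa only [Function.comp_def, hg] using f.continuous)⟩, hg⟩

/-- A family of loops as a map to the loop space. -/
theorem ContinuousMap.exists_path {y y' : Y} (γ : C(Z × I, Y)) (h0 : ∀ z, γ (z, 0) = y)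
    (h1 : ∀ z, γ (z, 1) = y') : ∃ g : C(Z, Path y y'), ∀ z t, g z t = γ (z, t) :=
  ⟨⟨fun z => ⟨γ.curry z, h0 z, h1 z⟩, Path.continuous_uncurry_iff.1 γ.continuous⟩,
    fun _ _ => rfl⟩

end Lifts

namespace HomotopyFiber

variable {E : Type u₁} {B : Type u₂} {Z : Type u₃}
  [TopologicalSpace E] [TopologicalSpace B] [TopologicalSpace Z] {p : C(E, B)} {b : B}

/-- The projection to the total space. -/
def proj (p : C(E, B)) (b : B) : C(HomotopyFiber p b, E) where
  toFun x := x.1.1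
  continuous_toFun := continuous_fst.comp continuous_subtype_val

/-- The evaluation of the path. -/
def path (p : C(E, B)) (b : B) : C(HomotopyFiber p b × I, B) where
  toFun x := x.1.1.2 x.2
  continuous_toFun := by
    have h : Continuous fun x : HomotopyFiber p b => x.1.2 :=
      continuous_snd.comp continuous_subtype_val
    exact (h.comp continuous_fst).eval continuous_snd

@[simp]
theorem path_zero (x : HomotopyFiber p b) : path p b (x, 0) = p (proj p b x) := x.2.1

@[simp]
theorem path_one (x : HomotopyFiber p b) : path p b (x, 1) = b := x.2.2

theorem ext {x y : HomotopyFiber p b} (h : proj p b x = proj p b y)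
    (h' : ∀ t, path p b (x, t) = path p b (y, t)) : x = y :=
  Subtype.ext (Prod.ext h (ContinuousMap.ext h'))

/-- The map to a homotopy fibre given by a map to the total space and a family of paths. -/
def lift (e : C(Z, E)) (γ : C(Z × I, B)) (h0 : ∀ z, γ (z, 0) = p (e z)) (h1 : ∀ z, γ (z, 1) = b) :
    C(Z, HomotopyFiber p b) where
  toFun z := ⟨(e z, γ.curry z), h0 z, h1 z⟩
  continuous_toFun := Continuous.subtype_mk (e.continuous.prodMk γ.curry.continuous) _

@[simp]
theorem proj_lift (e : C(Z, E)) (γ : C(Z × I, B)) (h0 : ∀ z, γ (z, 0) = p (e z))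
    (h1 : ∀ z, γ (z, 1) = b) (z : Z) : proj p b (lift e γ h0 h1 z) = e z := rfl

@[simp]
theorem path_lift (e : C(Z, E)) (γ : C(Z × I, B)) (h0 : ∀ z, γ (z, 0) = p (e z))
    (h1 : ∀ z, γ (z, 1) = b) (z : Z) (t : I) : path p b (lift e γ h0 h1 z, t) = γ (z, t) := rfl

/-- The transport of points of the homotopy fibre along a homotopy in the total space. -/
theorem exists_transport (H : C(Z × I, E)) (γ : C(Z × I, B)) (h0 : ∀ z, γ (z, 0) = p (H (z, 0)))
    (h1 : ∀ z, γ (z, 1) = b) : ∃ T : C(Z × I, HomotopyFiber p b),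
      (∀ z r, proj p b (T (z, r)) = H (z, r)) ∧ (∀ z t, path p b (T (z, 0), t) = γ (z, t)) ∧
      ∀ z r t, (∃ r', path p b (T (z, r), t) = p (H (z, r'))) ∨
        ∃ t', path p b (T (z, r), t) = γ (z, t') := by
  -- On the negative axis `L (z, -r)` is `p (H (z, r))`, on `[0, 1]` it is the old path. The
  -- transported path at time `r` is the segment from `-r` to `1`, that is, the old path preceded by
  -- the track of `H` run backwards.
  obtain ⟨L, hn, hp⟩ : ∃ L : C(Z × ℝ, B),
      (∀ z x, x ≤ 0 → L (z, x) = p (H (z, σ (clampI (1 + x))))) ∧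
      ∀ z x, 0 ≤ x → L (z, x) = γ (z, clampI x) :=
    ⟨lineMap (p.comp (H.comp ⟨fun z : Z × I => (z.1, σ z.2), by fun_prop⟩)) γ
      (by intro z; simp [h0]), fun z _ hx => lineMap_of_nonpos _ z hx,
      fun z _ hx => lineMap_of_nonneg _ z hx⟩
  refine ⟨lift H (L.comp ⟨fun x : (Z × I) × I => (x.1.1, -(x.1.2 : ℝ) + (1 + x.1.2) * x.2),
    by fun_prop⟩) ?_ ?_, fun z r => rfl, fun z t => ?_, fun z r t => ?_⟩
  · rintro ⟨z, r⟩
    change L (z, _) = _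
    have hr : (0 : ℝ) ≤ r := r.2.1
    rw [hn _ _ (by simpa using hr)]
    have : σ (clampI (1 + (-(r : ℝ) + (1 + r) * ((0 : I) : ℝ)))) = r := by
      rw [symm_clampI]
      simp [clampI_coe]
    rw [this]
  · rintro ⟨z, r⟩
    change L (z, _) = _
    rw [hp _ _ (by simp), clampI_of_ge (by simp), h1]
  · change L (z, -((0 : I) : ℝ) + (1 + ((0 : I) : ℝ)) * t) = _
    have ht : (0 : ℝ) ≤ t := t.2.1
    rw [hp _ _ (by simpa using ht)]
    simp [clampI_coe]
  · rcases le_total (-(r : ℝ) + (1 + r) * t) 0 with h | h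
    · exact Or.inl ⟨_, hn _ _ h⟩
    · exact Or.inr ⟨_, hp _ _ h⟩

/-- Let `X` be a part of the homotopy fibre and `α : A → E` a map to the fibre whose image is a
deformation retract, relative to `A`, of the part of `E` under `X`. Then `X ≃ A × ΩB`. -/
theorem exists_isHomotopyEquiv_prod_loops {A : Type u₄} {X : Type u₅} [TopologicalSpace A]
    [TopologicalSpace X] {v : X → HomotopyFiber p b} (hv : IsEmbedding v) (α : C(A, E))
    (hα : ∀ a, p (α a) = b) (hαv : ∀ a y, proj p b y = α a → y ∈ Set.range v) (ρ : C(X × I, E))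
    (r : C(X, A)) (h0 : ∀ x, ρ (x, 0) = proj p b (v x)) (h1 : ∀ x, ρ (x, 1) = α (r x))
    (hρ : ∀ x t y, proj p b y = ρ (x, t) → y ∈ Set.range v)
    (hr : ∀ x a, proj p b (v x) = α a → r x = a ∧ ∀ t, ρ (x, t) = α a) :
    ∃ φ : C(A × Path b b, X), IsHomotopyEquiv φ ∧ (∀ x, proj p b (v (φ x)) = α x.1) ∧
      ∀ x t, path p b (v (φ x), t) = x.2 t := by
  obtain ⟨φ, hφ⟩ := hv.exists_lift (lift (p := p) (b := b) (Z := A × Path b b)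
    (α.comp ⟨Prod.fst, continuous_fst⟩) ⟨fun x => x.1.2 x.2, by fun_prop⟩ (by simp [hα]) (by simp))
    (fun x => hαv x.1 _ rfl)
  have hφ1 : ∀ x, proj p b (v (φ x)) = α x.1 := fun x => by rw [hφ]; rfl
  have hφ2 : ∀ x t, path p b (v (φ x), t) = x.2 t := fun x t => by rw [hφ]; rfl
  refine ⟨φ, ?_, hφ1, hφ2⟩
  -- Transport along the deformation `ρ` ends over `A`, inside one fibre of `p`, so the path has
  -- become a loop. This gives the candidate inverse `(r, ω)`.
  obtain ⟨T, hT1, hT2, -⟩ := exists_transport (p := p) (b := b) ρ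
    ((path p b).comp ⟨fun x : X × I => (v x.1, x.2), by have := hv.continuous; fun_prop⟩)
    (fun x => by simp [h0]) (by simp)
  obtain ⟨Γ, hΓ⟩ := hv.exists_lift T (fun x => hρ x.1 x.2 _ (hT1 _ _))
  obtain ⟨ω, hω⟩ := ContinuousMap.exists_path (y := b) (y' := b)
    ((path p b).comp ⟨fun x : X × I => (T (x.1, 1), x.2), by fun_prop⟩)
    (fun x => by
      change path p b (T (x, 1), 0) = b
      rw [path_zero, hT1, h1, hα]) (by simp)
  -- Over `A` the deformation is stationary, so the transport of points of the form `φ x` remains in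
  -- `A × ΩB` and is the homotopy for the other composite.
  have hc : ∀ (x : A × Path b b) t, ρ (φ x, t) = α x.1 := fun x t => (hr _ _ (hφ1 x)).2 t
  obtain ⟨ω', hω'⟩ := ContinuousMap.exists_path (y := b) (y' := b)
    ((path p b).comp ⟨fun x : ((A × Path b b) × I) × I => (T (φ x.1.1, x.1.2), x.2), by fun_prop⟩)
    (fun x => by
      change path p b (T (φ x.1, x.2), 0) = b
      rw [path_zero, hT1, hc, hα]) (by simp)
  refine IsHomotopyEquiv.of_deformation (R := r.prodMk ω) Γ
    ((ContinuousMap.prodMk ⟨fun x : (A × Path b b) × I => x.1.1, by fun_prop⟩ ω')) ?_ ?_ ?_ ?_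
  · intro x
    apply hv.injective
    refine ext ?_ fun t => ?_
    · rw [hΓ, hT1, h0]
    · rw [hΓ, hT2]; rfl
  · intro x
    apply hv.injective
    refine ext ?_ fun t => ?_
    · rw [hΓ, hT1, h1, hφ1]; rfl
    · rw [hΓ, hφ2]
      exact (hω x t).symm
  · intro x
    refine Prod.ext rfl ?_
    ext t
    refine (hω' (x, 0) t).trans ?_
    change path p b (T (φ x, 0), t) = _
    rw [hT2]
    exact hφ2 x t
  · intro x
    refine Prod.ext (hr _ _ (hφ1 x)).1.symm ?_
    ext t
    refine (hω' (x, 1) t).trans ?_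
    exact (hω (φ x) t).symm

end HomotopyFiber

/-! ### The pinch map of a connected sum. -/

namespace TopCell

open HomotopyPushout

variable {n : ℕ} {Y : Type u₁} {A : Type u₂} [TopologicalSpace Y] [TopologicalSpace A]
  (d : TopCell n Y) (f : C(sphere (0 : Fin n → ℝ) 1, A))

theorem char_mem_body_iff {v : Fin n → ℝ} (hv : ‖v‖ ≤ 1) : d.char v ∈ d.body ↔ ‖v‖ = 1 := by
  refine ⟨fun h => ?_, fun h => d.mapsTo_body (by simpa using h)⟩
  by_contra h'
  exact d.bijOn_compl.mapsTo (by simpa using lt_of_le_of_ne hv h') h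

theorem char_zero_notMem : d.char 0 ∉ d.body := by
  rw [char_mem_body_iff d (by simp)]; simp

theorem eq_of_char_eq {v w : Fin n → ℝ} (hv : ‖v‖ ≤ 1) (hw : ‖w‖ < 1) (h : d.char v = d.char w) :
    v = w := by
  have hv' : ‖v‖ < 1 := by
    refine lt_of_le_of_ne hv fun h1 => ?_
    have := (d.char_mem_body_iff hv).2 h1
    rw [h, d.char_mem_body_iff hw.le] at this
    exact hw.ne this
  exact d.bijOn_compl.injOn (by simpa using hv') (by simpa using hw) h

theorem norm_smul_coe (s : sphere (0 : Fin n → ℝ) 1) (t : I) : ‖(t : ℝ) • (s : Fin n → ℝ)‖ = t := by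
  have hs : ‖(s : Fin n → ℝ)‖ = 1 := by simpa using s.2
  rw [norm_smul, hs, mul_one, Real.norm_of_nonneg t.2.1]

theorem norm_smul_coe_le (s : sphere (0 : Fin n → ℝ) 1) (t : I) :
    ‖(t : ℝ) • (s : Fin n → ℝ)‖ ≤ 1 := by
  rw [norm_smul_coe]; exact t.2.2

/-- The map from the connected sum that collapses `A` to the centre of the cell. -/
def pinch : C(HomotopyPushout f d.attach, Y) :=
  desc (.const _ (d.char 0))
    ⟨fun x : sphere (0 : Fin n → ℝ) 1 × I => d.char ((x.2 : ℝ) • (x.1 : Fin n → ℝ)), by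
      refine d.continuousOn_char.comp_continuous (by fun_prop) fun x => ?_
      simpa using norm_smul_coe_le x.1 x.2⟩
    ⟨Subtype.val, continuous_subtype_val⟩ (fun s => by simp) (fun s => by simp; rfl)

@[simp]
theorem pinch_left (a : A) : d.pinch f (left f d.attach a) = d.char 0 := rfl

theorem pinch_cyl (s : sphere (0 : Fin n → ℝ) 1) (t : I) :
    d.pinch f (cyl f d.attach (s, t)) = d.char ((t : ℝ) • (s : Fin n → ℝ)) := rfl

@[simp]
theorem pinch_right (b : d.body) : d.pinch f (right f d.attach b) = b := rfl

theorem pinch_cyl_mem_body_iff (s : sphere (0 : Fin n → ℝ) 1) (t : I) :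
    d.pinch f (cyl f d.attach (s, t)) ∈ d.body ↔ t = 1 := by
  rw [pinch_cyl, char_mem_body_iff d (norm_smul_coe_le s t), norm_smul_coe]
  exact ⟨fun h => Subtype.ext h, fun h => by rw [h]; rfl⟩

theorem exists_smul_eq {v : Fin n → ℝ} (hv : ‖v‖ ≤ 1) (h0 : v ≠ 0) :
    ∃ (s : sphere (0 : Fin n → ℝ) 1) (t : I), (t : ℝ) • (s : Fin n → ℝ) = v :=
  ⟨⟨‖v‖⁻¹ • v, by simp [norm_smul, h0]⟩, ⟨‖v‖, norm_nonneg v, hv⟩, by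
    simp [smul_smul, h0]⟩

/-- Away from `A`, a point of the connected sum is a point of `Y`. -/
theorem exists_pinch_eq {y : Y} (hy : y ≠ d.char 0) : ∃ p, d.pinch f p = y := by
  by_cases hb : y ∈ d.body
  · exact ⟨right f d.attach ⟨y, hb⟩, rfl⟩
  · obtain ⟨v, hv, rfl⟩ := d.bijOn_compl.surjOn hb
    rw [mem_ball_zero_iff] at hv
    obtain ⟨s, t, h⟩ := exists_smul_eq hv.le (fun h => hy (by rw [h]))
    exact ⟨cyl f d.attach (s, t), by rw [pinch_cyl, h]⟩

/-- In the open disc, polar coordinates away from the centre are unique because the characteristic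
map is injective there. At `t = 1` it need not be injective, and the comparison is made in the body,
where the end of the cylinder has been glued. -/
theorem cyl_eq_of_pinch_eq {p : HomotopyPushout f d.attach} {s : sphere (0 : Fin n → ℝ) 1} {t : I}
    (h : d.pinch f p = d.char ((t : ℝ) • (s : Fin n → ℝ))) (h0 : d.pinch f p ≠ d.char 0) :
    p = cyl f d.attach (s, t) := by
  rcases eq_or_ne t 1 with rfl | ht
  · have h' : d.pinch f p = d.attach s := by rw [h]; simp; rfl
    rw [cyl_one]
    induction p using HomotopyPushout.ind with
    | hl a => exact absurd rfl h0
    | hc s' t' =>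
      have : t' = 1 := by rw [← d.pinch_cyl_mem_body_iff f s', h']; exact (d.attach s).2
      subst this
      rw [cyl_one] at h' ⊢
      exact congrArg _ (Subtype.ext h')
    | hr b => exact congrArg _ (Subtype.ext h')
  · have ht1 : (t : ℝ) < 1 := lt_of_le_of_ne t.2.2 fun h => ht (Subtype.ext h)
    have hb : d.pinch f p ∉ d.body := by
      rw [h, char_mem_body_iff d (norm_smul_coe_le s t), norm_smul_coe]
      exact ht1.ne
    induction p using HomotopyPushout.ind with
    | hl a => exact absurd rfl h0
    | hc s' t' =>
      rw [pinch_cyl] at h h0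
      have e := d.eq_of_char_eq (norm_smul_coe_le s' t') (by rwa [norm_smul_coe]) h
      have e' : t' = t := by
        have := congrArg norm e
        rw [norm_smul_coe, norm_smul_coe] at this
        exact Subtype.ext this
      subst e'
      have : (t' : ℝ) ≠ 0 := fun h' => h0 (by rw [h', zero_smul])
      rw [show s' = s from Subtype.ext (smul_right_injective _ this e)]
    | hr b => exact absurd b.2 hb

theorem pinch_injOn {p q : HomotopyPushout f d.attach} (h : d.pinch f p = d.pinch f q)
    (h0 : d.pinch f p ≠ d.char 0) : p = q := by
  by_cases hb : d.pinch f q ∈ d.body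
  · have key : ∀ p, d.pinch f p = d.pinch f q → p = right f d.attach ⟨_, hb⟩ := by
      intro p hp
      induction p using HomotopyPushout.ind with
      | hl a => exact (d.char_zero_notMem (hp ▸ hb :)).elim
      | hc s t =>
        have : t = 1 := by rw [← d.pinch_cyl_mem_body_iff f s, hp]; exact hb
        subst this
        rw [cyl_one] at hp ⊢
        exact congrArg _ (Subtype.ext hp)
      | hr b => exact congrArg _ (Subtype.ext hp)
    rw [key p h, ← key q rfl]
  · obtain ⟨v, hv, hv'⟩ := d.bijOn_compl.surjOn hb
    rw [mem_ball_zero_iff] at hv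
    obtain ⟨s, t, hst⟩ := exists_smul_eq hv.le (fun h' => h0 (by rw [h, ← hv', h']))
    rw [← hst] at hv'
    rw [d.cyl_eq_of_pinch_eq f (h.trans hv'.symm) h0, ← d.cyl_eq_of_pinch_eq f hv'.symm (h ▸ h0)]

/-- The inverse of `pinch`, away from `A`. -/
theorem exists_unpinch : ∃ j : C({y // y ≠ d.char 0}, HomotopyPushout f d.attach),
    (∀ y, d.pinch f (j y) = y) ∧ ∀ p (h : d.pinch f p ≠ d.char 0), j ⟨d.pinch f p, h⟩ = p := by
  choose j hj using fun y : {y // y ≠ d.char 0} => d.exists_pinch_eq f y.2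
  have hj' : ∀ p (h : d.pinch f p ≠ d.char 0), j ⟨d.pinch f p, h⟩ = p := fun p h =>
    d.pinch_injOn f (hj _) (by rw [hj]; exact h)
  refine ⟨⟨j, ?_⟩, hj, hj'⟩
  rw [continuous_iff_isClosed]
  intro Z hZ
  -- The inverse is continuous since the image of a closed set becomes closed once the centre is
  -- added. This is tested on the body and on the closed disc, where the preimage is a compact image
  -- under `(s, t) ↦ t • s` together with the origin.
  have hcl : IsClosed (d.pinch f '' Z ∪ {d.char 0}) := by
    refine d.isClosed_of _ ?_ ?_
    · have : (d.pinch f '' Z ∪ {d.char 0}) ∩ d.body = Subtype.val '' (right f d.attach ⁻¹' Z) := by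
        ext y
        constructor
        · rintro ⟨⟨p, hp, rfl⟩ | rfl, hy⟩
          · refine ⟨⟨_, hy⟩, ?_, rfl⟩
            have : right f d.attach ⟨d.pinch f p, hy⟩ = p :=
              d.pinch_injOn f rfl (fun h => d.char_zero_notMem (h ▸ hy))
            rwa [Set.mem_preimage, this]
          · exact absurd hy d.char_zero_notMem
        · rintro ⟨b, hb, rfl⟩
          exact ⟨Or.inl ⟨_, hb, rfl⟩, b.2⟩
      rw [this]
      exact d.isClosed_body.isClosedMap_subtype_val _ (hZ.preimage (right f d.attach).continuous)
    · have : closedBall 0 1 ∩ d.char ⁻¹' (d.pinch f '' Z ∪ {d.char 0}) = {0} ∪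
          (fun x : sphere (0 : Fin n → ℝ) 1 × I => (x.2 : ℝ) • (x.1 : Fin n → ℝ)) ''
            (cyl f d.attach ⁻¹' Z) := by
        ext v
        rw [Set.mem_inter_iff, mem_closedBall_zero_iff]
        constructor
        · rintro ⟨hv, h⟩
          rcases eq_or_ne v 0 with rfl | hv0
          · exact Or.inl rfl
          have hne : d.char v ≠ d.char 0 := fun h => hv0 (d.eq_of_char_eq hv (by simp) h)
          obtain ⟨s, t, rfl⟩ := exists_smul_eq hv hv0
          rcases h with ⟨p, hp, h⟩ | h
          · refine Or.inr ⟨(s, t), ?_, rfl⟩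
            rw [Set.mem_preimage, ← d.cyl_eq_of_pinch_eq f h (h ▸ hne)]
            exact hp
          · exact absurd h hne
        · rintro (rfl | ⟨⟨s, t⟩, h, rfl⟩)
          · exact ⟨by simp, Or.inr rfl⟩
          · exact ⟨norm_smul_coe_le s t, Or.inl ⟨_, h, rfl⟩⟩
      rw [this]
      refine isClosed_singleton.union (IsCompact.isClosed ?_)
      exact (hZ.preimage (cyl f d.attach).continuous).isCompact.image (by fun_prop)
  convert hcl.preimage continuous_subtype_val using 1
  ext y
  constructor
  · intro h
    exact Or.inl ⟨j y, h, hj y⟩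
  · rintro (⟨p, hp, h⟩ | h)
    · have hy : d.pinch f p ≠ d.char 0 := h ▸ y.2
      have e : (⟨d.pinch f p, hy⟩ : {y // y ≠ d.char 0}) = y := Subtype.ext h
      have := hj' p hy
      rw [e] at this
      rwa [Set.mem_preimage, this]
    · exact absurd h y.2

/-- The complement of the body of the second space deforms to `A`. -/
theorem exists_deformation (a₀ : A) :
    ∃ (r : C({p // d.pinch f p ∉ d.body}, A))
      (ρ : C({p // d.pinch f p ∉ d.body} × I, HomotopyPushout f d.attach)),
      (∀ p, ρ (p, 0) = p.1) ∧ (∀ p, ρ (p, 1) = left f d.attach (r p)) ∧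
      (∀ p t, d.pinch f (ρ (p, t)) ∉ d.body) ∧
      ∀ p a, p.1 = left f d.attach a → r p = a ∧ ∀ t, ρ (p, t) = left f d.attach a := by
  have hO : IsOpen {p | d.pinch f p ∉ d.body} :=
    (d.isClosed_body.preimage (d.pinch f).continuous).isOpen_compl
  have hcyl : ∀ s t, cyl f d.attach (s, t) ∈ {p | d.pinch f p ∉ d.body} → t < 1 := by
    intro s t h
    refine lt_of_le_of_ne le_top fun h1 => h ?_
    exact (d.pinch_cyl_mem_body_iff f s t).2 h1
  -- The functions must be total for the quotient, but only the cylinder with `t < 1` and `A` lie in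
  -- the set of interest. The value `a₀` and the constant paths elsewhere merely make them well
  -- defined; continuity is claimed on the open set only.
  let r₀ : HomotopyPushout f d.attach → A := descFun id (fun x => if x.2 < 1 then f x.1 else a₀)
    (fun _ => a₀) (fun s => if_pos one_pos) (fun s => if_neg (lt_irrefl _))
  let L : C(sphere (0 : Fin n → ℝ) 1 × I, C(I, HomotopyPushout f d.attach)) :=
    ContinuousMap.curry ⟨fun x => cyl f d.attach (x.1.1, σ x.2 * x.1.2), by fun_prop⟩
  let ρ₀ : HomotopyPushout f d.attach → C(I, HomotopyPushout f d.attach) :=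
    descFun (fun a => .const _ (left f d.attach a))
      (fun x => if x.2 < 1 then L x else .const _ (right f d.attach (d.attach x.1)))
      (fun b => .const _ (right f d.attach b))
      (fun s => by
        refine (if_pos one_pos).trans ?_
        ext t
        change cyl f d.attach (s, σ t * 0) = _
        rw [mul_zero, cyl_zero]; rfl)
      (fun s => if_neg (lt_irrefl _))
  have hr : ContinuousOn r₀ {p | d.pinch f p ∉ d.body} := by
    refine continuousOn_of hO continuous_id.continuousOn ?_ ?_
    · have : Continuous fun x : sphere (0 : Fin n → ℝ) 1 × I => f x.1 := by fun_prop
      refine this.continuousOn.congr fun x hx => ?_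
      exact if_pos (hcyl x.1 x.2 hx)
    · exact continuous_const.continuousOn
  have hρ : ContinuousOn ρ₀ {p | d.pinch f p ∉ d.body} := by
    refine continuousOn_of hO ?_ ?_ ?_
    · exact (ContinuousMap.const'.comp (left f d.attach)).continuous.continuousOn
    · refine L.continuous.continuousOn.congr fun x hx => ?_
      exact if_pos (hcyl x.1 x.2 hx)
    · exact (ContinuousMap.const'.comp (right f d.attach)).continuous.continuousOn
  have hρc : ∀ s t, t < 1 → ∀ x, ρ₀ (cyl f d.attach (s, t)) x = cyl f d.attach (s, σ x * t) :=
    fun s t ht x => congrArg (fun l : C(I, HomotopyPushout f d.attach) => l x)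
      (if_pos ht : _ = L (s, t))
  have hrc : ∀ s t, t < 1 → r₀ (cyl f d.attach (s, t)) = f s := fun s t ht => if_pos ht
  refine ⟨⟨fun p => r₀ p.1, (continuousOn_iff_continuous_domRestrict.1 hr)⟩,
    ⟨fun x => ρ₀ x.1.1 x.2, ?_⟩, ?_, ?_, ?_, ?_⟩
  · have := continuousOn_iff_continuous_domRestrict.1 hρ
    exact (this.comp continuous_fst).eval continuous_snd
  · rintro ⟨p, hp⟩
    change ρ₀ p 0 = p
    induction p using HomotopyPushout.ind with
    | hl a => rfl
    | hc s t => rw [hρc s t (hcyl s t hp)]; simp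
    | hr b => rfl
  · rintro ⟨p, hp⟩
    change ρ₀ p 1 = left f d.attach (r₀ p)
    induction p using HomotopyPushout.ind with
    | hl a => rfl
    | hc s t => rw [hρc s t (hcyl s t hp), hrc s t (hcyl s t hp)]; simp
    | hr b => exact absurd b.2 hp
  · rintro ⟨p, hp⟩ t
    change d.pinch f (ρ₀ p t) ∉ d.body
    induction p using HomotopyPushout.ind with
    | hl a => exact hp
    | hc s t' =>
      have ht := hcyl s t' hp
      rw [hρc s t' ht, pinch_cyl_mem_body_iff]
      refine (lt_of_le_of_lt ?_ ht).ne
      exact mul_le_of_le_one_left' le_top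
    | hr b => exact absurd b.2 hp
  · rintro ⟨p, hp⟩ a rfl
    exact ⟨rfl, fun t => rfl⟩

end TopCell

/-! ### Spheres minus a point. -/

namespace Sph

variable {k : ℕ}

theorem norm_eq_one (x : Sph k) : ‖x.1‖ = 1 := by simpa using x.2

theorem neg_ne_self (x : Sph k) : -x ≠ x := by
  intro h
  have h' : -x.1 = x.1 := congrArg Subtype.val h
  have : x.1 = 0 := by
    have h2 : (2 : ℝ) • x.1 = 0 := by
      rw [two_smul]
      nth_rewrite 1 [← h']
      simp
    simpa using h2
  have h1 := norm_eq_one x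
  simp [this] at h1

theorem collapse_zero : collapse (0 : Fin k → ℝ) = -base k := by
  refine Subtype.ext (PiLp.ext fun i => ?_)
  refine Fin.cases ?_ (fun i => ?_) i
  · rw [collapse_zero_coord]
    simp [sq, base]
  · rw [collapse_succ_coord]
    simp [base]

/-- Comparing norms forces `s = t`, and then `x = -a`. So the segment between points that are not
antipodal misses the origin and can be projected to the sphere. -/
theorem smul_ne_neg_smul {x a : Sph k} (h : x ≠ -a) {s t : ℝ} (hs : 0 ≤ s) (ht : 0 ≤ t)
    (hst : 0 < s + t) : s • x.1 ≠ -(t • a.1) := by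
  intro e
  have en := congrArg norm e
  rw [norm_neg, norm_smul, norm_smul, norm_eq_one, norm_eq_one, mul_one, mul_one,
    Real.norm_of_nonneg hs, Real.norm_of_nonneg ht] at en
  subst en
  have hs' : s ≠ 0 := by linarith
  rw [← smul_neg] at e
  exact h (Subtype.ext (smul_right_injective _ hs' e))

/-- The complement of a point of a sphere contracts to the antipode. -/
theorem exists_contraction {a c : Sph k} (hc : c = -a) : ∃ κ : C({x : Sph k // x ≠ c} × I, Sph k),
    (∀ x, κ (x, 0) = x) ∧ (∀ x, κ (x, 1) = a) ∧ (∀ x t, κ (x, t) ≠ c) ∧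
      ∀ x t, x.1 = a → κ (x, t) = a := by
  subst hc
  let w : {x : Sph k // x ≠ -a} × I → EuclideanSpace ℝ (Fin (k + 1)) :=
    fun x => (1 - (x.2 : ℝ)) • x.1.1.1 + (x.2 : ℝ) • a.1
  have hw : ∀ x, w x ≠ 0 := fun x h => smul_ne_neg_smul x.1.2 (sub_nonneg.2 x.2.2.2) x.2.2.1
    (by simp) (eq_neg_of_add_eq_zero_left h)
  have hn : ∀ x, 0 < ‖w x‖ := fun x => norm_pos_iff.2 (hw x)
  have hwc : Continuous w := by fun_prop
  refine ⟨⟨fun x => ⟨‖w x‖⁻¹ • w x, ?_⟩, ?_⟩, ?_, ?_, ?_, ?_⟩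
  · simp [norm_smul, (hn x).ne']
  · exact Continuous.subtype_mk ((hwc.norm.inv₀ fun x => (hn x).ne').smul hwc) _
  · intro x
    have : w (x, 0) = x.1.1 := by simp [w]
    refine Subtype.ext ?_
    change ‖w (x, 0)‖⁻¹ • w (x, 0) = _
    rw [this, norm_eq_one]; simp
  · intro x
    have : w (x, 1) = a.1 := by simp [w]
    refine Subtype.ext ?_
    change ‖w (x, 1)‖⁻¹ • w (x, 1) = _
    rw [this, norm_eq_one]; simp
  · intro x t h
    have h' : ‖w (x, t)‖⁻¹ • w (x, t) = -a.1 := congrArg Subtype.val h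
    rw [inv_smul_eq_iff₀ (hn _).ne'] at h'
    -- If the normalised segment met `-a`, a nonnegative multiple of `x` would be a positive
    -- multiple of `-a`.
    have e : (1 - (t : ℝ)) • x.1.1 = -((t + ‖w (x, t)‖) • a.1) := by
      rw [add_smul, neg_add, ← smul_neg _ a.1, ← smul_neg _ a.1, ← h']
      simp only [w]
      module
    refine smul_ne_neg_smul x.2 (sub_nonneg.2 t.2.2) ?_ ?_ e
    · exact add_nonneg t.2.1 (norm_nonneg _)
    · have := hn (x, t); linarith
  · intro x t h
    have : w (x, t) = a.1 := by simp only [w, h]; module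
    refine Subtype.ext ?_
    change ‖w (x, t)‖⁻¹ • w (x, t) = _
    rw [this, norm_eq_one]; simp

theorem sum_sq (x : Sph k) : ∑ i, x.1 i ^ 2 = 1 := by
  have := x.2
  rw [mem_sphere_zero_iff_norm, EuclideanSpace.norm_eq, Real.sqrt_eq_one] at this
  simpa [sq_abs] using this

theorem coord_sq_le (x : Sph k) : x.1 0 ^ 2 ≤ 1 := by
  rw [← sum_sq x]
  exact Finset.single_le_sum (f := fun i => x.1 i ^ 2) (fun i _ => _root_.sq_nonneg _)
    (Finset.mem_univ 0)

theorem eq_base_of_coord {x : Sph k} (h : x.1 0 = 1) : x = base k := by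
  have hs := sum_sq x
  rw [Fin.sum_univ_succ, h] at hs
  have h0 : ∑ i : Fin k, x.1 i.succ ^ 2 = 0 := by linarith
  have h1 := (Finset.sum_eq_zero_iff_of_nonneg fun i _ => _root_.sq_nonneg (x.1 (Fin.succ i))).1 h0
  refine Subtype.ext (PiLp.ext fun i => ?_)
  refine Fin.cases ?_ (fun i => ?_) i
  · rw [h, base_zero_coord]
  · have := h1 i (Finset.mem_univ i)
    simpa [base] using this

/-- The first coordinate, rescaled to the unit interval. -/
noncomputable def height (k : ℕ) : C(Sph k, I) where
  toFun x := clampI ((1 + x.1 0) / 2)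
  continuous_toFun := by fun_prop

theorem coe_height (x : Sph k) : (height k x : ℝ) = (1 + x.1 0) / 2 := by
  have := abs_le.1 ((sq_le_one_iff_abs_le_one _).1 (coord_sq_le x))
  exact coe_clampI_of_mem (by linarith) (by linarith)

theorem height_lt_one_iff (x : Sph k) : height k x < 1 ↔ x ≠ base k := by
  have := abs_le.1 ((sq_le_one_iff_abs_le_one _).1 (coord_sq_le x))
  have hlt : height k x < 1 ↔ (height k x : ℝ) < 1 := Iff.rfl
  rw [hlt, coe_height]
  constructor
  · rintro h rfl
    rw [base_zero_coord] at h
    linarith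
  · intro h
    have : x.1 0 ≠ 1 := fun h' => h (eq_base_of_coord h')
    have := lt_of_le_of_ne (by linarith) this
    linarith

theorem height_pos_iff (x : Sph k) : 0 < height k x ↔ x ≠ -base k := by
  have e : height k (-x) = σ (height k x) := by
    refine Subtype.ext ?_
    rw [unitInterval.coe_symm_eq, coe_height, coe_height]
    simp; ring
  have := height_lt_one_iff (-x)
  rw [e, unitInterval.symm_lt_comm, unitInterval.symm_one] at this
  rw [this, ne_eq, ne_eq, neg_eq_iff_eq_neg]

theorem pathConnectedSpace (hk : 1 ≤ k) : PathConnectedSpace (Sph k) := by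
  rw [← isPathConnected_iff_pathConnectedSpace]
  refine isPathConnected_sphere ?_ 0 zero_le_one
  rw [← Module.finrank_eq_rank, finrank_euclideanSpace_fin]
  exact_mod_cast (by omega : 1 < k + 1)

end Sph

/-! ### The homotopy fibre of the first coordinate: the part that contains `A`. -/

namespace SphereProd

open HomotopyPushout

variable {m k : ℕ} {A : Type u₁} [TopologicalSpace A]
  (f : C(sphere (0 : Fin (m + k) → ℝ) 1, A))

/-- The antipode in the first factor. -/
noncomputable def reflect (m k : ℕ) : C(Sph m × Sph k, Sph m × Sph k) :=
  ⟨fun x => (-x.1, x.2), by fun_prop⟩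

theorem reflect_reflect (x : Sph m × Sph k) : reflect m k (reflect m k x) = x :=
  Prod.ext (neg_neg _) rfl

/-- The two coordinates of a point of the connected sum with `Sᵐ × Sᵏ`. -/
noncomputable def coord :
    C(HomotopyPushout f (sphereProdTopCell m k).attach, Sph m × Sph k) :=
  (reflect m k).comp ((sphereProdTopCell m k).pinch f)

theorem char_zero : (sphereProdTopCell m k).char 0 = (-Sph.base m, -Sph.base k) :=
  Prod.ext Sph.collapse_zero Sph.collapse_zero

theorem char_zero_eq : (sphereProdTopCell m k).char 0 = reflect m k (Sph.base m, -Sph.base k) :=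
  char_zero

@[simp]
theorem coord_left (a : A) : coord f (left f _ a) = (Sph.base m, -Sph.base k) := by
  change reflect m k ((sphereProdTopCell m k).char 0) = _
  rw [char_zero_eq, reflect_reflect]

theorem pinch_mem_body_iff (p : HomotopyPushout f (sphereProdTopCell m k).attach) :
    (sphereProdTopCell m k).pinch f p ∈ (sphereProdTopCell m k).body ↔
      (coord f p).1 = -Sph.base m ∨ (coord f p).2 = Sph.base k := by
  refine or_congr ?_ Iff.rfl
  exact neg_inj.symm

/-- This supplies coordinates on the complement of `A`: the homotopies below move points there by
moving their two coordinates, as long as `(base, -base)` is avoided. -/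
theorem exists_inverse :
    ∃ j : C({y : Sph m × Sph k // y ≠ (Sph.base m, -Sph.base k)},
      HomotopyPushout f (sphereProdTopCell m k).attach),
    (∀ y, coord f (j y) = y) ∧ ∀ p h, j ⟨coord f p, h⟩ = p := by
  obtain ⟨j, h1, h2⟩ := (sphereProdTopCell m k).exists_unpinch f
  have key : ∀ y : Sph m × Sph k, y ≠ (Sph.base m, -Sph.base k) →
      reflect m k y ≠ (sphereProdTopCell m k).char 0 := by
    intro y hy h
    rw [char_zero_eq] at h
    exact hy (by rw [← reflect_reflect y, h, reflect_reflect])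
  refine ⟨j.comp ⟨fun y => ⟨reflect m k y, key _ y.2⟩, by fun_prop⟩, fun y => ?_, fun p h => ?_⟩
  · change reflect m k ((sphereProdTopCell m k).pinch f (j _)) = _
    rw [h1]
    exact reflect_reflect _
  · have e : reflect m k (coord f p) = (sphereProdTopCell m k).pinch f p := reflect_reflect _
    have h' := key _ h
    change j ⟨reflect m k (coord f p), h'⟩ = p
    refine (congrArg j (Subtype.ext e)).trans (h2 p (e ▸ h'))

/-- A path from `A` into the tube, in the fibre over the base point. -/
theorem exists_joinedIn [PathConnectedSpace A] (hk : 1 ≤ k) (a₀ : A) :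
    ∃ p, JoinedIn {p | (coord f p).1 = Sph.base m ∧ (coord f p).2 ≠ Sph.base k}
      (left f (sphereProdTopCell m k).attach a₀) p ∧ (coord f p).2 ≠ -Sph.base k := by
  have : Nonempty (Fin k) := ⟨⟨0, hk⟩⟩
  -- The component of `y` in the first factor is `0`, and `collapse 0` is the antipode of the base
  -- point, which `reflect` turns back. Hence the whole ray through `y` lies over the base point of
  -- `Sᵐ`.
  let y : Fin (m + k) → ℝ := Fin.append (fun _ => 0) fun _ => 1
  have hy1 : ∀ t : ℝ, (fun i => (t • y) (Fin.castAdd k i)) = (0 : Fin m → ℝ) := by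
    intro t; ext i; simp [y]
  have hy2 : ∀ t : ℝ, (fun i => (t • y) (Fin.natAdd m i)) = fun _ : Fin k => t := by
    intro t; ext i; simp [y]
  have hy : ‖y‖ = 1 := by
    refine le_antisymm ((pi_norm_le_iff_of_nonneg zero_le_one).2 fun i => ?_) ?_
    · refine Fin.addCases (fun i => ?_) (fun i => ?_) i <;> simp [y]
    · have := norm_le_pi_norm y (Fin.natAdd m ⟨0, hk⟩)
      simp only [y, Fin.append_right] at this
      simpa using this
  let s : sphere (0 : Fin (m + k) → ℝ) 1 := ⟨y, by simpa using hy⟩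
  have hc : ∀ t, coord f (cyl f _ (s, t)) =
      (Sph.base m, Sph.collapse fun _ : Fin k => (t : ℝ)) := by
    intro t
    refine Prod.ext ?_ ?_
    · change -Sph.collapse (fun i => ((t : ℝ) • y) (Fin.castAdd k i)) = _
      rw [hy1, Sph.collapse_zero, neg_neg]
    · change Sph.collapse (fun i => ((t : ℝ) • y) (Fin.natAdd m i)) = _
      rw [hy2]
  have hn : ∀ t : I, ‖fun _ : Fin k => (t : ℝ)‖ = t := by
    intro t
    rw [pi_norm_const, Real.norm_of_nonneg t.2.1]
  -- Any interior parameter would do: `0` would have second coordinate `-base`, and `1` would have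
  -- second coordinate `base`.
  let h : I := ⟨1 / 2, by norm_num, by norm_num⟩
  refine ⟨cyl f _ (s, h), ?_, ?_⟩
  · have e1 : JoinedIn {p | (coord f p).1 = Sph.base m ∧ (coord f p).2 ≠ Sph.base k}
        (left f (sphereProdTopCell m k).attach a₀) (left f _ (f s)) := by
      obtain ⟨γ⟩ := PathConnectedSpace.joined a₀ (f s)
      refine ⟨γ.map (left f _).continuous, fun t => ?_⟩
      simpa using (Sph.neg_ne_self _)
    refine e1.trans ⟨⟨⟨fun t => cyl f _ (s, t * h), by fun_prop⟩, by simp, by simp⟩, fun t => ?_⟩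
    change (coord f (cyl f _ (s, t * h))).1 = _ ∧ (coord f (cyl f _ (s, t * h))).2 ≠ _
    rw [hc]
    refine ⟨rfl, ?_⟩
    rw [ne_eq, Sph.collapse_eq_base_iff, hn]
    have h1 : (t : ℝ) ≤ 1 := t.2.2
    have h2 : ((t * h : I) : ℝ) = t * (1 / 2) := rfl
    linarith
  · rw [hc, ← Sph.collapse_zero]
    intro e
    have := Sph.collapse_injOn (by rw [mem_ball_zero_iff, hn]; norm_num [h]) (by simp) e
    have := congrFun this ⟨0, hk⟩
    norm_num [h] at this

/-- The map from the connected sum to `Sᵐ`. -/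
noncomputable def toSphere : C(HomotopyPushout f (sphereProdTopCell m k).attach, Sph m) :=
  ⟨fun p => (coord f p).1, by fun_prop⟩

@[simp]
theorem toSphere_left (a : A) : toSphere f (left f _ a) = Sph.base m :=
  congrArg Prod.fst (coord_left f a)

/-- The part of the homotopy fibre with second coordinate different from the base point. -/
abbrev Part := {e : HomotopyFiber (toSphere f) (Sph.base m) //
  (coord f (HomotopyFiber.proj _ _ e)).2 ≠ Sph.base k}

/-- The paths that end at the base point. -/
abbrev Paths (m : ℕ) := HomotopyFiber (ContinuousMap.id (Sph m)) (Sph.base m)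

-- Where the first coordinate is not the base point, an element of `Part` is determined by its path,
-- whose start is the first coordinate, and by a second coordinate in `Sᵏ ∖ {base}`. Contracting the
-- latter to `-base` yields a map that depends on the path alone. The predicates `QK` and `QV` allow
-- the same argument on `{0 < τ}` and on the intersection of the cover.
open HomotopyFiber in
theorem isHomotopyEquiv_section_part
    {j : C({y : Sph m × Sph k // y ≠ (Sph.base m, -Sph.base k)},
      HomotopyPushout f (sphereProdTopCell m k).attach)}
    (hj : ∀ y, coord f (j y) = y) (hj' : ∀ p h, j ⟨coord f p, h⟩ = p)
    {s : C(Paths m, Part f)} (hs : ∀ x t, path _ _ ((s x).1, t) = path _ _ (x, t))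
    {QK : Paths m → Prop} {QV : Part f → Prop}
    (hK : ∀ x, QK x → path _ _ (x, 0) ≠ Sph.base m)
    (hV : ∀ v x, (∀ t, path _ _ (v.1, t) = path _ _ (x, t)) → (QK x ↔ QV v))
    (s' : C({x // QK x}, {v // QV v})) (hs' : ∀ x, (s' x).1 = s x.1) : IsHomotopyEquiv s' := by
  obtain ⟨κ, κ0, κ1, κn, -⟩ := Sph.exists_contraction (k := k) (neg_neg (Sph.base k)).symm
  let r₀ : C(Part f, Paths m) := lift (E := Sph m) ⟨fun v => path _ _ (v.1, 0), by fun_prop⟩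
    ⟨fun v => path _ _ (v.1.1, v.2), by fun_prop⟩ (fun _ => rfl) (fun v => path_one v.1)
  have hr₀ : ∀ v, QV v → QK (r₀ v) := fun v h => (hV v _ fun _ => rfl).2 h
  have hz : ∀ v : {v // QV v}, toSphere f (proj _ _ v.1.1) ≠ Sph.base m := fun v => by
    rw [← path_zero]
    exact hK _ (hr₀ _ v.2)
  let e : C({v // QV v} × I, HomotopyPushout f (sphereProdTopCell m k).attach) :=
    ⟨fun x => j ⟨(toSphere f (proj _ _ x.1.1.1), κ (⟨_, x.1.1.2⟩, x.2)),
      fun h => hz x.1 (congrArg Prod.fst h)⟩, by fun_prop⟩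
  have he : ∀ x, coord f (e x) = (toSphere f (proj _ _ x.1.1.1), κ (⟨_, x.1.1.2⟩, x.2)) :=
    fun x => hj _
  let l : C({v // QV v} × I, HomotopyFiber (toSphere f) (Sph.base m)) :=
    lift e ⟨fun x => path _ _ (x.1.1.1.1, x.2), by fun_prop⟩
      (fun x => (path_zero _).trans (congrArg Prod.fst (he x)).symm) (fun x => path_one x.1.1.1)
  have hl : ∀ x, (coord f (proj _ _ (l x))).2 ≠ Sph.base k := fun x => by
    change (coord f (e x)).2 ≠ _
    rw [he]
    exact κn _ _
  let Γ : C({v // QV v} × I, {v // QV v}) := ⟨fun x => ⟨⟨l x, hl x⟩,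
    (hV ⟨l x, hl x⟩ (r₀ x.1.1) fun _ => rfl).1 (hr₀ _ x.1.2)⟩, by fun_prop⟩
  refine IsHomotopyEquiv.of_section (r := ⟨fun v => ⟨r₀ v.1, hr₀ _ v.2⟩, by fun_prop⟩) ?_ Γ ?_ ?_
  · intro x
    have h : ∀ t, path _ _ ((s' x).1.1, t) = path _ _ (x.1, t) := fun t => by rw [hs', hs]
    refine Subtype.ext (HomotopyFiber.ext ?_ h)
    exact (h 0).trans (path_zero x.1)
  · intro v
    refine Subtype.ext (Subtype.ext (HomotopyFiber.ext ?_ fun _ => rfl))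
    change e (v, 0) = _
    have : coord f (proj _ _ v.1.1) ≠ (Sph.base m, -Sph.base k) :=
      fun h => hz v (congrArg Prod.fst h)
    rw [← hj' _ this]
    refine congrArg j (Subtype.ext (Prod.ext rfl ?_))
    exact κ0 _
  · intro v
    have h : ∀ t, path _ _ ((s' ⟨r₀ v.1, hr₀ _ v.2⟩).1.1, t) = path _ _ (v.1.1, t) :=
      fun t => by rw [hs', hs]; rfl
    refine Subtype.ext (Subtype.ext (HomotopyFiber.ext ?_ fun t => (h t).symm))
    refine congrArg j (Subtype.ext (Prod.ext ?_ ?_))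
    · exact (path_zero _).symm.trans ((h 0).symm.trans (path_zero _))
    · exact (κ1 _).trans (κ1 _).symm

open HomotopyFiber in
/-- The path space contracts to the constant path. -/
theorem exists_paths_contraction (m : ℕ) : ∃ C : C(Paths m × I, Paths m),
    (∀ x, C (x, 0) = x) ∧ ∀ x y, C (x, 1) = C (y, 1) := by
  refine ⟨lift (E := Sph m) (path _ _)
    ⟨fun x => path _ _ (x.1.1, clampI (x.1.2 + (1 - x.1.2) * x.2)), by fun_prop⟩ ?_ ?_, ?_, ?_⟩
  · intro x
    change path _ _ (x.1, _) = path _ _ (x.1, _)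
    congr 2
    simp [clampI_coe]
  · intro x
    change path _ _ (x.1, _) = _
    rw [clampI_of_ge (by simp), path_one]
  · intro x
    refine HomotopyFiber.ext (path_zero x) fun t => ?_
    change path _ _ (x, _) = path _ _ (x, _)
    congr 2
    simp [clampI_coe]
  · intro x y
    refine HomotopyFiber.ext ?_ fun t => ?_
    · exact (path_one x).trans (path_one y).symm
    · change path _ _ (x, _) = path _ _ (y, _)
      rw [clampI_of_ge (by simp), path_one, path_one]

open HomotopyFiber in
/-- The part of the homotopy fibre where the second coordinate is not the base point. -/
theorem nonempty_part [PathConnectedSpace A] (hk : 1 ≤ k) (a₀ : A) :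
    Nonempty (Part f ≃ₕ HomotopyPushout
      (⟨fun ω => (a₀, ω), by fun_prop⟩ : C(Path (Sph.base m) (Sph.base m), A × Path _ _))
      (.const _ PUnit.unit : C(_, PUnit.{1}))) := by
  obtain ⟨j, hj, hj'⟩ := exists_inverse f
  obtain ⟨p₁, ⟨δ, hδ⟩, hp₁⟩ := exists_joinedIn f hk a₀
  have hp₁b : (coord f p₁).2 ≠ Sph.base k := by simpa using (hδ 1).2
  have hp₁m : (coord f p₁).1 = Sph.base m := by simpa using (hδ 1).1
  -- The antipode inside `height` makes `τ = 1` occur at first coordinate `-base` and `τ = 0` at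
  -- `base`.
  let τ : C(Part f, I) := ⟨fun v => Sph.height m (-toSphere f (proj _ _ v.1)), by fun_prop⟩
  let τK : C(Paths m, I) := ⟨fun x => Sph.height m (-path _ _ (x, 0)), by fun_prop⟩
  have hτ1 : ∀ v, τ v < 1 ↔ path _ _ (v.1, 0) ≠ -Sph.base m := fun v => by
    rw [path_zero]
    exact (Sph.height_lt_one_iff _).trans (not_congr neg_eq_iff_eq_neg)
  have hτK1 : ∀ x, τK x < 1 ↔ path _ _ (x, 0) ≠ -Sph.base m := fun v =>
    (Sph.height_lt_one_iff _).trans (not_congr neg_eq_iff_eq_neg)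
  have hτK0 : ∀ x, 0 < τK x ↔ path _ _ (x, 0) ≠ Sph.base m := fun v =>
    (Sph.height_pos_iff _).trans (not_congr neg_inj)
  have hττ : ∀ v x, (∀ t, path _ _ (v.1, t) = path _ _ (x, t)) → τ v = τK x := fun v x h => by
    change Sph.height m (-toSphere f (proj _ _ v.1)) = Sph.height m _
    rw [← h, path_zero]
  -- The section of `Part` over the path space keeps the second coordinate at that of `p₁`. This is
  -- neither `-base`, so the missing point is avoided, nor `base`, so the section stays in `Part`.
  let e : C(Paths m, HomotopyPushout f (sphereProdTopCell m k).attach) :=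
    ⟨fun x => j ⟨(path _ _ (x, 0), (coord f p₁).2), fun h => hp₁ (congrArg Prod.snd h)⟩,
      by fun_prop⟩
  have he : ∀ x, coord f (e x) = (path _ _ (x, 0), (coord f p₁).2) := fun x => hj _
  let s : C(Paths m, Part f) := ⟨fun x => ⟨lift e (path _ _)
    (fun x => (congrArg Prod.fst (he x)).symm) (fun x => path_one x) x, by
      change (coord f (e x)).2 ≠ _
      rw [he]
      exact hp₁b⟩, by fun_prop⟩
  have hs : ∀ x t, path _ _ ((s x).1, t) = path _ _ (x, t) := fun _ _ => rfl
  have hK : ∀ x, τK x = τ (s x) := fun x => (hττ (s x) x (hs x)).symm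
  let sU : C({x // τK x < 1}, {v // τ v < 1}) := ⟨fun x => ⟨s x.1, hK x.1 ▸ x.2⟩, by fun_prop⟩
  obtain ⟨eq⟩ := nonempty_cover_section τ s τK hK sU (fun _ => rfl)
    ⟨fun x => ⟨s x.1, hK x.1 ▸ x.2⟩, by fun_prop⟩ (fun _ => rfl)
    ⟨fun x => ⟨s x.1, hK x.1 ▸ x.2⟩, by fun_prop⟩ (fun _ => rfl)
    (isHomotopyEquiv_section_part f hj hj' hs (fun x h => (hτK0 x).1 h)
      (fun v x h => by rw [hττ v x h]) _ fun _ => rfl)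
    (isHomotopyEquiv_section_part f hj hj' hs (fun x h => (hτK0 x).1 h.1)
      (fun v x h => by rw [hττ v x h]) _ fun _ => rfl)
  obtain ⟨r, ρ, ρ0, ρ1, ρb, ρA⟩ := (sphereProdTopCell m k).exists_deformation f a₀
  have hbody : ∀ v : {v // τ v < 1},
      (sphereProdTopCell m k).pinch f (proj _ _ v.1.1) ∉ (sphereProdTopCell m k).body := by
    intro v
    rw [pinch_mem_body_iff, not_or]
    have := (hτ1 _).1 v.2
    rw [path_zero] at this
    exact ⟨this, v.1.2⟩
  have hrange : ∀ y : HomotopyFiber (toSphere f) (Sph.base m),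
      (sphereProdTopCell m k).pinch f (proj _ _ y) ∉ (sphereProdTopCell m k).body →
      y ∈ Set.range fun v : {v // τ v < 1} => v.1.1 := by
    intro y hy
    rw [pinch_mem_body_iff, not_or] at hy
    exact ⟨⟨⟨y, hy.2⟩, (hτ1 ⟨y, hy.2⟩).2 (by rw [path_zero]; exact hy.1)⟩, rfl⟩
  let U : C({v // τ v < 1}, {p // (sphereProdTopCell m k).pinch f p ∉ (sphereProdTopCell m k).body})
    := ⟨fun v => ⟨_, hbody v⟩, by fun_prop⟩
  -- Where `τ < 1`, the point of the connected sum is off the body of the sphere product, so it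
  -- deforms to `A`. The piece is therefore `A × ΩSᵐ`.
  obtain ⟨φ, hφ, hφ1, hφ2⟩ := exists_isHomotopyEquiv_prod_loops (p := toSphere f) (b := Sph.base m)
    (v := fun v : {v // τ v < 1} => v.1.1) (IsEmbedding.subtypeVal.comp IsEmbedding.subtypeVal)
    (left f _) (toSphere_left f)
    (fun a y h => hrange y (by
      rw [h, TopCell.pinch_left]; exact TopCell.char_zero_notMem _))
    (ρ.comp ⟨fun x => (U x.1, x.2), by fun_prop⟩) (r.comp U) (fun x => ρ0 _) (fun x => ρ1 _)
    (fun x t y h => hrange y (by rw [h]; exact ρb _ _)) (fun x a h => ρA _ a h)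
  obtain ⟨κ, κ0, κ1, κn, κa⟩ := Sph.exists_contraction (k := m) (a := Sph.base m) rfl
  -- The same argument for the identity of `Sᵐ`, with the base point in place of `A`: paths that do
  -- not start at `-base` form a copy of `ΩSᵐ`.
  obtain ⟨β, hβ, hβ1, hβ2⟩ := exists_isHomotopyEquiv_prod_loops (p := .id (Sph m))
    (b := Sph.base m) (A := PUnit.{1}) (v := fun v : {v // τK v < 1} => v.1)
    IsEmbedding.subtypeVal (.const _ (Sph.base m)) (fun _ => rfl)
    (fun a y h => ⟨⟨y, (hτK1 y).2 (by rw [path_zero]; exact h ▸ (Sph.neg_ne_self _).symm)⟩, rfl⟩)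
    (κ.comp ⟨fun x => (⟨path _ _ (x.1.1, 0), (hτK1 _).1 x.1.2⟩, x.2), by fun_prop⟩)
    (.const _ PUnit.unit) (fun x => (κ0 _).trans (path_zero x.1)) (fun x => κ1 _)
    (fun x t y h => ⟨⟨y, (hτK1 y).2 (by rw [path_zero]; exact h ▸ κn _ _)⟩, rfl⟩)
    (fun x a h => ⟨rfl, fun t => κa _ _ ((path_zero x.1).trans h)⟩)
  obtain ⟨C, C0, C1⟩ := exists_paths_contraction m
  have hPaths : ∀ {Z : Type} [TopologicalSpace Z] (u v : C(Z, Paths m)), u.Homotopic v := by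
    intro Z _ u v
    have h1 : ∀ u : C(Z, Paths m), u.Homotopic ⟨fun z => C (u z, 1), by fun_prop⟩ := fun u =>
      homotopic_of_prod ⟨fun z => C (u z.1, z.2), by fun_prop⟩ (fun z => C0 _) fun z => rfl
    have h2 : (⟨fun z => C (u z, 1), by fun_prop⟩ : C(Z, Paths m)) =
        ⟨fun z => C (v z, 1), by fun_prop⟩ :=
      ContinuousMap.ext fun z => C1 _ _
    exact (h1 u).trans (h2 ▸ (h1 v).symm)
  let c₀ : Paths m := lift (E := Sph m) (Z := PUnit.{1}) (.const _ (Sph.base m))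
    (.const _ (Sph.base m)) (fun _ => rfl) (fun _ => rfl) PUnit.unit
  have hc₀ : IsHomotopyEquiv (.const _ c₀ : C(PUnit.{1}, Paths m)) :=
    ⟨.const _ PUnit.unit, by
      have : (ContinuousMap.const (Paths m) PUnit.unit).comp (.const _ c₀) = .id PUnit.{1} := rfl
      rw [this], hPaths _ _⟩
  have hΩ : IsHomotopyEquiv (β.comp
      (⟨fun ω => (PUnit.unit, ω), by fun_prop⟩ : C(Path (Sph.base m) (Sph.base m), _))) :=
    hβ.comp ⟨⟨Prod.snd, by fun_prop⟩, .refl _, .refl _⟩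
  refine ⟨eq.trans (nonempty_homotopyEquiv hφ hΩ hc₀ ?_ (hPaths _ _)).some.symm⟩
  have hδ1 : ∀ t, toSphere f (δ t) = Sph.base m := fun t => (hδ t).1
  -- The section over a loop sits at `p₁`, whereas the half-smash needs it at `a₀`. The path `δ`
  -- joins the two inside the fibre, so the loop can be carried along unchanged.
  let l : C(Path (Sph.base m) (Sph.base m) × I, HomotopyFiber (toSphere f) (Sph.base m)) :=
    lift ⟨fun x => δ x.2, by fun_prop⟩ ⟨fun x => x.1.1 x.2, by fun_prop⟩
      (fun x => by simp [hδ1]) (by simp)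
  have hl : ∀ x, (coord f (proj _ _ (l x))).2 ≠ Sph.base k := fun x => (hδ _).2
  have hl' : ∀ x, τ ⟨l x, hl x⟩ < 1 := fun x => (hτ1 _).2 (by
    rw [path_zero]
    exact (hδ1 x.2).symm ▸ (Sph.neg_ne_self _).symm)
  refine homotopic_of_prod ⟨fun x => ⟨⟨l x, hl x⟩, hl' x⟩, by fun_prop⟩ ?_ ?_
  · intro ω
    refine Subtype.ext (Subtype.ext (HomotopyFiber.ext ?_ fun t => ?_))
    · refine Eq.trans ?_ (hφ1 _).symm
      exact δ.source
    · exact (hφ2 (a₀, ω) t).symm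
  · intro ω
    refine Subtype.ext (Subtype.ext (HomotopyFiber.ext ?_ fun t => ?_))
    · have h0 : path _ _ ((β (PUnit.unit, ω)).1, 0) = Sph.base m := (hβ2 _ 0).trans ω.source
      refine δ.target.trans ?_
      change p₁ = j ⟨(path _ _ ((β (PUnit.unit, ω)).1, 0), (coord f p₁).2), _⟩
      have hne : coord f p₁ ≠ (Sph.base m, -Sph.base k) := fun h => hp₁ (congrArg Prod.snd h)
      exact (hj' p₁ hne).symm.trans
        (congrArg j (Subtype.ext (Prod.ext (hp₁m.trans h0.symm) rfl)))
    · exact (hβ2 (PUnit.unit, ω) t).symm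

end SphereProd

/-! ### Path-connectedness and homotopies. -/

section PathConnected

variable {X : Type u₁} {Y : Type u₂} [TopologicalSpace X] [TopologicalSpace Y]

theorem ContinuousMap.Homotopic.joined {f g : C(X, Y)} (h : f.Homotopic g) (x : X) :
    Joined (f x) (g x) := by
  obtain ⟨F, h0, h1⟩ := h.exists_prod
  exact ⟨⟨⟨fun t => F (x, t), by fun_prop⟩, h0 x, h1 x⟩⟩

theorem Joined.homotopic_const {y y' : Y} (h : Joined y y') :
    (ContinuousMap.const X y).Homotopic (.const X y') := by
  obtain ⟨γ⟩ := h
  exact homotopic_of_prod ⟨fun x => γ x.2, by fun_prop⟩ (by simp) (by simp)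

theorem IsHomotopyEquiv.pathConnectedSpace {f : C(X, Y)} (h : IsHomotopyEquiv f)
    [PathConnectedSpace X] : PathConnectedSpace Y := by
  obtain ⟨g, -, h2⟩ := h
  refine ⟨⟨f (Classical.arbitrary X)⟩, fun y y' => ?_⟩
  exact (h2.joined y).symm.trans (((PathConnectedSpace.joined (g y) (g y')).map f.continuous).trans
    (h2.joined y'))

end PathConnected

/-! ### The homotopy fibre as a wedge up to homotopy. -/

namespace SphereProd

open HomotopyPushout

variable {m k : ℕ} {A : Type u₁} [TopologicalSpace A]
  (f : C(sphere (0 : Fin (m + k) → ℝ) 1, A))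

-- Where the second coordinate is not `-base`, the first coordinate is free to move. It is pushed
-- along its path to the base point while the path shrinks, and the result depends only on the
-- second coordinate.
open HomotopyFiber in
theorem isHomotopyEquiv_section_fiber
    {j : C({y : Sph m × Sph k // y ≠ (Sph.base m, -Sph.base k)},
      HomotopyPushout f (sphereProdTopCell m k).attach)}
    (hj : ∀ y, coord f (j y) = y) (hj' : ∀ p h, j ⟨coord f p, h⟩ = p)
    {s : C(Sph k, HomotopyFiber (toSphere f) (Sph.base m))}
    (hs : ∀ x, (coord f (proj _ _ (s x))).2 = x) {QK : Sph k → Prop}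
    {QV : HomotopyFiber (toSphere f) (Sph.base m) → Prop} (hK : ∀ x, QK x → x ≠ -Sph.base k)
    (hV : ∀ v, QV v ↔ QK (coord f (proj _ _ v)).2)
    (s' : C({x // QK x}, {v // QV v})) (hs' : ∀ x, (s' x).1 = s x.1) : IsHomotopyEquiv s' := by
  have hne : ∀ v : {v // QV v}, (coord f (proj _ _ v.1)).2 ≠ -Sph.base k :=
    fun v => hK _ ((hV _).1 v.2)
  let e : C({v // QV v} × I, HomotopyPushout f (sphereProdTopCell m k).attach) :=
    ⟨fun x => j ⟨(path _ _ (x.1.1, x.2), (coord f (proj _ _ x.1.1)).2),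
      fun h => hne x.1 (congrArg Prod.snd h)⟩, by fun_prop⟩
  have he : ∀ x, coord f (e x) = (path _ _ (x.1.1, x.2), (coord f (proj _ _ x.1.1)).2) :=
    fun x => hj _
  let l : C({v // QV v} × I, HomotopyFiber (toSphere f) (Sph.base m)) :=
    lift e ⟨fun x => path _ _ (x.1.1.1, clampI (x.1.2 + (1 - x.1.2) * x.2)), by fun_prop⟩
      (fun x => by
        refine Eq.trans ?_ (congrArg Prod.fst (he x)).symm
        change path _ _ (x.1.1, clampI _) = path _ _ (x.1.1, _)
        congr 2
        simp [clampI_coe])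
      (fun x => by
        change path _ _ (x.1.1, clampI _) = _
        rw [clampI_of_ge (by simp), path_one])
  let Γ : C({v // QV v} × I, {v // QV v}) := ⟨fun x => ⟨l x, by
    rw [hV]
    change QK (coord f (e x)).2
    rw [he]
    exact (hV _).1 x.1.2⟩, by fun_prop⟩
  refine IsHomotopyEquiv.of_section (r := ⟨fun v => ⟨(coord f (proj _ _ v.1)).2, (hV _).1 v.2⟩,
    by fun_prop⟩) ?_ Γ ?_ ?_
  · intro x
    refine Subtype.ext ?_
    change (coord f (proj _ _ (s' x).1)).2 = _
    rw [hs', hs]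
  · intro v
    refine Subtype.ext (HomotopyFiber.ext ?_ fun t => ?_)
    · change e (v, 0) = _
      have h : coord f (proj _ _ v.1) ≠ (Sph.base m, -Sph.base k) :=
        fun h => hne v (congrArg Prod.snd h)
      rw [← hj' _ h]
      refine congrArg j (Subtype.ext (Prod.ext ?_ rfl))
      exact path_zero _
    · change path _ _ (v.1, clampI _) = path _ _ (v.1, _)
      congr 2
      simp [clampI_coe]
  · intro v
    have h : (coord f (proj _ _ (s' ⟨(coord f (proj _ _ v.1)).2, (hV _).1 v.2⟩).1)).2 =
        (coord f (proj _ _ v.1)).2 := by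
      rw [hs', hs]
    refine Subtype.ext (HomotopyFiber.ext ?_ fun t => ?_)
    · refine congrArg j (Subtype.ext (Prod.ext ?_ h.symm))
      exact (path_one _).trans (path_one _).symm
    · refine Eq.trans (b := Sph.base m) ?_ (Eq.symm ?_)
      · change path _ _ (v.1, clampI _) = _
        rw [clampI_of_ge (by simp), path_one]
      · change path _ _ (Subtype.val (s' _), clampI _) = _
        rw [clampI_of_ge (by simp), path_one]

open HomotopyFiber in
/-- The homotopy fibre is obtained from its part by attaching a sphere at a point. -/
theorem nonempty_fiber (hm : 1 ≤ m) (hk : 1 ≤ k) {Z : Type u₂} [TopologicalSpace Z]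
    [PathConnectedSpace Z] (z₀ : Z) (hZ : Nonempty (Part f ≃ₕ Z)) :
    Nonempty (HomotopyFiber (toSphere f) (Sph.base m) ≃ₕ HomotopyPushout
      (.const PUnit.{1} z₀) (.const PUnit.{1} (Sph.base k))) := by
  have := Sph.pathConnectedSpace hm
  have := Sph.pathConnectedSpace hk
  obtain ⟨j, hj, hj'⟩ := exists_inverse f
  let τ : C(HomotopyFiber (toSphere f) (Sph.base m), I) :=
    ⟨fun v => Sph.height k (coord f (proj _ _ v)).2, by fun_prop⟩
  have hτ : ∀ v, τ v = Sph.height k (coord f (proj _ _ v)).2 := fun _ => rfl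
  obtain ⟨δ⟩ := PathConnectedSpace.joined (-Sph.base m) (Sph.base m)
  -- The slice over `base` would meet the missing point `(base, -base)`; the one over `-base` does
  -- not, and `δ` makes it a map to the homotopy fibre.
  let e : C(Sph k, HomotopyPushout f (sphereProdTopCell m k).attach) :=
    ⟨fun x => j ⟨(-Sph.base m, x), fun h => Sph.neg_ne_self _ (congrArg Prod.fst h)⟩, by fun_prop⟩
  have he : ∀ x, coord f (e x) = (-Sph.base m, x) := fun x => hj _
  let s : C(Sph k, HomotopyFiber (toSphere f) (Sph.base m)) := lift e ⟨fun x => δ x.2, by fun_prop⟩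
    (fun x => δ.source.trans (congrArg Prod.fst (he x)).symm) (fun x => δ.target)
  have hs : ∀ x, (coord f (proj _ _ (s x))).2 = x := fun x => congrArg Prod.snd (he x)
  have hK : ∀ x, Sph.height k x = τ (s x) := fun x => by rw [hτ, hs]
  let sU : C({x // Sph.height k x < 1}, {v // τ v < 1}) :=
    ⟨fun x => ⟨s x.1, hK x.1 ▸ x.2⟩, by fun_prop⟩
  obtain ⟨eq⟩ := nonempty_cover_section τ s (Sph.height k) hK sU (fun _ => rfl)
    ⟨fun x => ⟨s x.1, hK x.1 ▸ x.2⟩, by fun_prop⟩ (fun _ => rfl)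
    ⟨fun x => ⟨s x.1, hK x.1 ▸ x.2⟩, by fun_prop⟩ (fun _ => rfl)
    (isHomotopyEquiv_section_fiber f hj hj' hs (fun x h => (Sph.height_pos_iff _).1 h)
      (fun v => Iff.rfl) _ fun _ => rfl)
    (isHomotopyEquiv_section_fiber f hj hj' hs (fun x h => (Sph.height_pos_iff _).1 h.1)
      (fun v => Iff.rfl) _ fun _ => rfl)
  let hU : Part f ≃ₜ {v // τ v < 1} :=
    (Homeomorph.refl _).subtype fun v => (Sph.height_lt_one_iff _).symm
  have ha := IsHomotopyEquiv.of_equiv (hZ.some.symm.trans hU.toHomotopyEquiv)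
  have := ha.pathConnectedSpace
  obtain ⟨κ, κ0, κ1, κn, -⟩ := Sph.exists_contraction (k := k) (neg_neg (Sph.base k)).symm
  let q : {x // Sph.height k x < 1} :=
    ⟨-Sph.base k, (Sph.height_lt_one_iff _).2 (Sph.neg_ne_self _)⟩
  -- The sphere minus its base point is contractible, so the attachment takes place along a single
  -- point. Path-connectedness allows that point to be any in either space.
  have hq : IsHomotopyEquiv (.const PUnit.{1} q) := by
    refine ⟨.const _ PUnit.unit, .refl _, Homotopic.symm ?_⟩
    refine homotopic_of_prod ⟨fun x => ⟨κ (⟨x.1.1, (Sph.height_lt_one_iff _).1 x.1.2⟩, x.2),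
      (Sph.height_lt_one_iff _).2 (κn _ _)⟩, by fun_prop⟩ ?_ ?_
    · intro x; exact Subtype.ext (κ0 _)
    · intro x; exact Subtype.ext (κ1 _)
  refine ⟨eq.trans (nonempty_homotopyEquiv ha hq .id ?_ ?_).some.symm⟩
  · have h := fun x y : {v // τ v < 1} =>
      (PathConnectedSpace.joined x y).homotopic_const (X := PUnit.{1})
    exact h ((hZ.some.symm.trans hU.toHomotopyEquiv).toFun z₀) (sU q)
  · have h := fun x y : Sph k => (PathConnectedSpace.joined x y).homotopic_const (X := PUnit.{1})
    exact h _ _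

end SphereProd

/-! ### Well-pointed spaces and strict pushouts. -/

/-- The base point has a neighbourhood, given by a function `u`, that a homotopy of the identity
relative to the base point contracts to the base point. -/
def IsWellPointed (X : Type u₁) [TopologicalSpace X] (x₀ : X) : Prop :=
  ∃ (H : C(X × I, X)) (u : C(X, I)), (∀ x, H (x, 0) = x) ∧ (∀ t, H (x₀, t) = x₀) ∧ u x₀ = 1 ∧
    ∀ x, 1 / 2 ≤ (u x : ℝ) → H (x, 1) = x₀

namespace HomotopyPushout

variable {T : Type u₁} {Z : Type u₂} {B : Type u₃} {R : Type u₄} [TopologicalSpace T]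
  [TopologicalSpace Z] [TopologicalSpace B] [TopologicalSpace R]

/-- The homotopy pushout along a cofibration is equivalent to the strict pushout. -/
theorem nonempty_strict_pushout {i : C(T, Z)} {g : C(T, B)} {qZ : C(Z, R)} {qB : C(B, R)}
    (hq : ∀ t, qZ (i t) = qB (g t))
    (hD : ∀ (a : C(Z, HomotopyPushout i g)) (b : C(B, HomotopyPushout i g)),
      (∀ t, a (i t) = b (g t)) → ∃ c : C(R, HomotopyPushout i g),
        (∀ z, c (qZ z) = a z) ∧ ∀ y, c (qB y) = b y)
    (hR : ∀ (a : C(Z, C(I, R))) (b : C(B, C(I, R))),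
      (∀ t, a (i t) = b (g t)) → ∃ c : C(R, C(I, R)),
        (∀ z, c (qZ z) = a z) ∧ ∀ y, c (qB y) = b y)
    (hs : ∀ r, (∃ z, qZ z = r) ∨ ∃ y, qB y = r)
    (H : C(Z × I, Z)) (u : C(Z, I)) (ρ : C(Z, T)) (H0 : ∀ z, H (z, 0) = z)
    (Hi : ∀ t r, H (i t, r) = i t) (ui : ∀ t, u (i t) = 1) (ρi : ∀ t, ρ (i t) = t)
    (H1 : ∀ z, 1 / 2 ≤ (u z : ℝ) → H (z, 1) = i (ρ z)) :
    Nonempty (HomotopyPushout i g ≃ₕ R) := by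
  let φ : C(HomotopyPushout i g, R) := desc qZ ⟨fun x => qZ (i x.1), by fun_prop⟩ qB
    (fun s => rfl) hq
  -- `L (·, 1)` is the inverse on `Z`: after the push `H (·, 1)`, the neighbourhood `{1/2 ≤ u}` lies
  -- in `T` and is spread over the cylinder with coordinate `2u - 1`. The parameter `r` scales this
  -- coordinate.
  obtain ⟨L, L1, L2⟩ : ∃ L : C(Z × I, HomotopyPushout i g),
      (∀ z r, (u z : ℝ) ≤ 1 / 2 → L (z, r) = left i g (H (z, 1))) ∧
      ∀ z r, 1 / 2 ≤ (u z : ℝ) → L (z, r) = cyl i g (ρ z, clampI (r * (2 * u z - 1))) := by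
    have key : ∀ z r, (u z : ℝ) = 1 / 2 →
        left i g (H (z, 1)) = cyl i g (ρ z, clampI ((r : I) * (2 * u z - 1))) := by
      intro z r h
      rw [h, clampI_of_le (by norm_num), cyl_zero, H1 z h.ge]
    refine ⟨⟨fun x => if (u x.1 : ℝ) ≤ 1 / 2 then left i g (H (x.1, 1)) else
      cyl i g (ρ x.1, clampI (x.2 * (2 * u x.1 - 1))), Continuous.if_le (by fun_prop)
      (by fun_prop) (by fun_prop) (by fun_prop) fun x hx => key _ _ hx⟩,
      fun z r h => if_pos h, fun z r h => ?_⟩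
    rcases h.eq_or_lt with h' | h'
    · exact (if_pos h'.ge).trans (key z r h'.symm)
    · exact if_neg h'.not_ge
  have Li : ∀ t r, L (i t, r) = cyl i g (t, r) := fun t r => by
    rw [L2 _ _ (by rw [ui]; norm_num), ui, ρi]
    norm_num [clampI_coe]
  obtain ⟨ψ, ψ1, ψ2⟩ := hD ⟨fun z => L (z, 1), by fun_prop⟩ (right i g)
    (fun t => by simp [Li])
  have hφL : ∀ z r, φ (L (z, r)) = qZ (H (z, 1)) := by
    intro z r
    rcases le_total (u z : ℝ) (1 / 2) with h | h
    · rw [L1 _ _ h]; rfl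
    · rw [L2 _ _ h, H1 _ h]; rfl
  refine IsHomotopyEquiv.nonempty (f := φ) ⟨ψ, Homotopic.symm ?_, Homotopic.symm ?_⟩
  -- The homotopy has two stages: `H` acts on `Z` alone, and then `L` spreads the neighbourhood
  -- while the cylinder coordinate is raised to at least `r`.
  · let φ₁ : C(HomotopyPushout i g, HomotopyPushout i g) :=
      desc ⟨fun z => left i g (H (z, 1)), by fun_prop⟩ (cyl i g) (right i g)
        (fun t => by simp [Hi]) (fun t => by simp)
    have e1 : (ContinuousMap.id _).Homotopic φ₁ :=
      homotopic_of ⟨fun x => left i g (H x), by fun_prop⟩ ⟨fun x => cyl i g x.1, by fun_prop⟩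
        ⟨fun x => right i g x.1, by fun_prop⟩ (by simp [Hi]) (by simp) (by simp [H0])
        (by simp [φ₁]) (by simp) (by simp [φ₁]) (by simp) (by simp [φ₁])
    refine e1.trans (homotopic_of L ⟨fun x => cyl i g (x.1.1, x.1.2 ⊔ x.2), by fun_prop⟩
        ⟨fun x => right i g x.1, by fun_prop⟩ ?_ ?_ ?_ ?_ ?_ ?_ ?_ ?_)
    · intro t r
      rw [Li]
      change cyl i g (t, 0 ⊔ r) = _
      rw [sup_eq_right.2 unitInterval.nonneg']
    · intro t r
      change cyl i g (t, 1 ⊔ r) = _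
      rw [sup_eq_left.2 unitInterval.le_one', cyl_one]; rfl
    · intro z
      rcases le_total (u z : ℝ) (1 / 2) with h | h
      · rw [L1 _ _ h]; rfl
      · rw [L2 _ _ h]
        change _ = left i g (H (z, 1))
        rw [H1 _ h, clampI_of_le (by simp), cyl_zero]
    · intro z
      exact (ψ1 z).symm
    · intro t r
      change cyl i g (t, r ⊔ 0) = cyl i g (t, r)
      rw [sup_eq_left.2 unitInterval.nonneg']
    · intro t r
      change cyl i g (t, r ⊔ 1) = ψ (qZ (i t))
      rw [sup_eq_right.2 unitInterval.le_one', ψ1]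
      exact (Li t 1).symm
    · intro y; rfl
    · intro y; exact (ψ2 y).symm
  -- `H` fixes `T` and so descends to `R`. As a map to `C(I, R)` it descends by the universal
  -- property of `R` itself, with no product of a quotient with `I`.
  · obtain ⟨c, c1, c2⟩ := hR (qZ.comp H).curry ⟨fun y => .const _ (qB y),
      (ContinuousMap.const'.comp qB).continuous⟩ (fun t => by
        ext r
        change qZ (H (i t, r)) = qB (g t)
        rw [Hi, hq])
    refine homotopic_of_prod c.uncurry ?_ ?_
    · intro r
      change c r 0 = r
      rcases hs r with ⟨z, rfl⟩ | ⟨y, rfl⟩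
      · rw [c1]
        change qZ (H (z, 0)) = _
        rw [H0]
      · rw [c2]; rfl
    · intro r
      change c r 1 = φ (ψ r)
      rcases hs r with ⟨z, rfl⟩ | ⟨y, rfl⟩
      · rw [c1, ψ1]
        exact (hφL z 1).symm
      · rw [c2, ψ2]; rfl

/-- The contraction of a neighbourhood of `a₀`, constant in `W`, retracts a neighbourhood of `{a₀} ×
W`; this makes `{a₀} × W → A × W` a cofibration of the kind required. -/
theorem nonempty_halfSmash {A : Type u₁} {W : Type u₂} [TopologicalSpace A] [TopologicalSpace W]
    [Inhabited W] {a₀ : A} (h : IsWellPointed A a₀) :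
    Nonempty (HomotopyPushout (⟨fun ω => (a₀, ω), by fun_prop⟩ : C(W, A × W))
      (.const _ PUnit.unit : C(_, PUnit.{1})) ≃ₕ HalfSmash A W a₀) := by
  obtain ⟨H, u, H0, Hx, ux, H1⟩ := h
  have key : ∀ {Y : Type (max u₁ u₂)} [TopologicalSpace Y] (a : C(A × W, Y)) (b : C(PUnit.{1}, Y)),
      (∀ t, a (a₀, t) = b PUnit.unit) → ∃ c : C(HalfSmash A W a₀, Y),
        (∀ z, c (Quot.mk _ z) = a z) ∧ ∀ y, c (HalfSmash.base a₀) = b y := by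
    intro Y _ a b h
    refine ⟨⟨Quot.lift a ?_, continuous_quot_lift _ a.continuous⟩, fun _ => rfl, fun _ => h _⟩
    rintro ⟨_, w⟩ ⟨_, w'⟩ ⟨rfl, rfl⟩
    rw [h, h]
  refine nonempty_strict_pushout (qZ := ⟨Quot.mk _, continuous_quot_mk⟩)
    (qB := .const _ (HalfSmash.base a₀)) ?_ key key ?_
    ⟨fun x => (H (x.1.1, x.2), x.1.2), by fun_prop⟩ ⟨fun x => u x.1, by fun_prop⟩
    ⟨Prod.snd, by fun_prop⟩ ?_ ?_ ?_ ?_ ?_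
  · intro t
    exact Quot.sound ⟨rfl, rfl⟩
  · intro r
    induction r using Quot.ind with
    | mk x => exact Or.inl ⟨x, rfl⟩
  · intro z; simp [H0]
  · intro t r; simp [Hx]
  · intro t; simp [ux]
  · intro t; rfl
  · intro z hz
    simp [H1 _ hz]

theorem nonempty_wedge {X : Type u₁} {Y : Type u₂} [TopologicalSpace X] [TopologicalSpace Y]
    {x₀ : X} {y₀ : Y} (h : IsWellPointed Y y₀) :
    Nonempty (HomotopyPushout (.const PUnit.{1} y₀) (.const PUnit.{1} x₀) ≃ₕ Wedge X Y x₀ y₀) := by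
  obtain ⟨H, u, H0, Hx, ux, H1⟩ := h
  have key : ∀ {V : Type (max u₁ u₂)} [TopologicalSpace V] (a : C(Y, V)) (b : C(X, V)),
      (∀ _ : PUnit.{1}, a y₀ = b x₀) → ∃ c : C(Wedge X Y x₀ y₀, V),
        (∀ z, c (Quot.mk _ (.inr z)) = a z) ∧ ∀ y, c (Quot.mk _ (.inl y)) = b y := by
    intro V _ a b h
    refine ⟨⟨Quot.lift (Sum.elim b a) ?_, continuous_quot_lift _
      (continuous_sumElim.2 ⟨b.continuous, a.continuous⟩)⟩, fun _ => rfl, fun _ => rfl⟩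
    rintro _ _ ⟨rfl, rfl⟩
    exact (h PUnit.unit).symm
  refine nonempty_strict_pushout
    (qZ := ⟨fun y => Quot.mk _ (.inr y), continuous_quot_mk.comp continuous_inr⟩)
    (qB := ⟨fun x => Quot.mk _ (.inl x), continuous_quot_mk.comp continuous_inl⟩) ?_ key key ?_
    H u (.const _ PUnit.unit) H0 ?_ ?_ ?_ ?_
  · intro t
    exact (Quot.sound ⟨rfl, rfl⟩).symm
  · intro r
    induction r using Quot.ind with
    | mk x =>
      rcases x with x | y
      exacts [Or.inr ⟨x, rfl⟩, Or.inl ⟨y, rfl⟩]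
  · intro t r; exact Hx r
  · intro t; exact ux
  · intro t; rfl
  · intro z hz; exact H1 _ hz

end HomotopyPushout

/-! ### Permanence of well-pointedness. -/

namespace IsWellPointed

variable {X : Type u₁} {Y : Type u₂} [TopologicalSpace X] [TopologicalSpace Y] {x₀ : X} {y₀ : Y}

/-- A homotopy extension property. -/
theorem exists_extension (h : IsWellPointed X x₀) (f : C(X, Y)) (γ : C(I, Y)) (hγ : γ 0 = f x₀) :
    ∃ F : C(X × I, Y), (∀ x, F (x, 0) = f x) ∧ ∀ t, F (x₀, t) = γ (clampI (2 * t - 1)) := by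
  obtain ⟨H, u, H0, Hx, ux, H1⟩ := h
  -- In the first half of the time `H` pushes the neighbourhood of `x₀` into `x₀`. In the second
  -- half these points follow `γ`, to an extent that falls to `0` where `u = 1/2`.
  refine ⟨⟨fun x => if min (2 * (x.2 : ℝ) - 1) (2 * u x.1 - 1) ≤ 0 then
      f (H (x.1, clampI (2 * x.2))) else γ (clampI (2 * x.2 - 1) * clampI (2 * u x.1 - 1)),
      Continuous.if_le (by fun_prop) (by fun_prop) (by fun_prop) (by fun_prop) ?_⟩, ?_, ?_⟩
  · rintro ⟨x, t⟩ h
    change min (2 * (t : ℝ) - 1) (2 * u x - 1) = 0 at h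
    change f (H (x, _)) = γ (clampI (2 * t - 1) * clampI (2 * u x - 1))
    have h1 : 0 ≤ 2 * (t : ℝ) - 1 := h ▸ min_le_left _ _
    have h2 : 0 ≤ 2 * (u x : ℝ) - 1 := h ▸ min_le_right _ _
    rw [clampI_of_ge (by linarith), H1 x (by linarith)]
    have : clampI (2 * t - 1) * clampI (2 * u x - 1) = 0 := by
      rcases min_choice (2 * (t : ℝ) - 1) (2 * u x - 1) with h' | h'
      · rw [clampI_of_le (x := 2 * (t : ℝ) - 1) (by linarith), zero_mul]
      · rw [clampI_of_le (x := 2 * (u x : ℝ) - 1) (by linarith), mul_zero]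
    rw [this, hγ]
  · intro x
    refine (if_pos ?_).trans ?_
    · exact (min_le_left _ _).trans (by simp)
    · change f (H (x, clampI (2 * ((0 : I) : ℝ)))) = f x
      rw [clampI_of_le (by simp), H0]
  · intro t
    change (if min (2 * (t : ℝ) - 1) (2 * u x₀ - 1) ≤ 0 then
      f (H (x₀, _)) else γ (clampI (2 * t - 1) * clampI (2 * u x₀ - 1))) = _
    rw [ux, Hx]
    have ht : (t : ℝ) ≤ 1 := t.2.2
    have : min (2 * (t : ℝ) - 1) (2 * ((1 : I) : ℝ) - 1) = 2 * t - 1 :=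
      min_eq_left (by simp only [Set.Icc.coe_one]; linarith)
    rw [this]
    split_ifs with h
    · rw [clampI_of_le h, hγ]
    · rw [clampI_of_ge (x := 2 * ((1 : I) : ℝ) - 1) (by norm_num), mul_one]

theorem halfSmash {A : Type u₁} {W : Type u₂} [TopologicalSpace A] [TopologicalSpace W]
    [Inhabited W] {a₀ : A} (h : IsWellPointed A a₀) :
    IsWellPointed (HalfSmash A W a₀) (HalfSmash.base a₀) := by
  obtain ⟨H, u, H0, Hx, ux, H1⟩ := h
  have hb : ∀ w w' : W, (Quot.mk _ (a₀, w) : HalfSmash A W a₀) = Quot.mk _ (a₀, w') :=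
    fun _ _ => Quot.sound ⟨rfl, rfl⟩
  let q : C(A × W, HalfSmash A W a₀) := ⟨Quot.mk _, continuous_quot_mk⟩
  let K : C(A × W, C(I, HalfSmash A W a₀)) :=
    ContinuousMap.curry ⟨fun x => q (H (x.1.1, x.2), x.1.2), by fun_prop⟩
  let H' : C(HalfSmash A W a₀, C(I, HalfSmash A W a₀)) := ⟨Quot.lift K (by
    rintro ⟨x, w⟩ ⟨x', w'⟩ ⟨hx, hx'⟩
    ext t
    change q (H (x, t), w) = q (H (x', t), w')
    rw [show x = a₀ from hx, show x' = a₀ from hx', Hx]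
    exact hb _ _), continuous_quot_lift _ K.continuous⟩
  refine ⟨H'.uncurry, ⟨Quot.lift (fun x => u x.1) ?_, continuous_quot_lift _ (by fun_prop)⟩,
    ?_, ?_, ?_, ?_⟩
  · rintro ⟨_, w⟩ ⟨_, w'⟩ ⟨rfl, rfl⟩
    rfl
  · intro x
    induction x using Quot.ind with
    | mk x =>
      change q (H (x.1, 0), x.2) = q x
      rw [H0]
  · intro t
    change q (H (a₀, t), default) = q (a₀, default)
    rw [Hx]
  · exact ux
  · intro x
    induction x using Quot.ind with
    | mk x =>
      intro hx
      change q (H (x.1, 1), x.2) = q (a₀, default)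
      rw [H1 _ hx]
      exact hb _ _

theorem wedge (hX : IsWellPointed X x₀) (hY : IsWellPointed Y y₀) :
    IsWellPointed (Wedge X Y x₀ y₀) (Wedge.base x₀ y₀) := by
  obtain ⟨H, u, H0, Hx, ux, H1⟩ := hX
  obtain ⟨G, v, G0, Gy, vy, G1⟩ := hY
  let qX : C(X, Wedge X Y x₀ y₀) := ⟨fun x => Quot.mk _ (.inl x),
    continuous_quot_mk.comp continuous_inl⟩
  let qY : C(Y, Wedge X Y x₀ y₀) := ⟨fun x => Quot.mk _ (.inr x),
    continuous_quot_mk.comp continuous_inr⟩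
  have hq : qX x₀ = qY y₀ := Quot.sound ⟨rfl, rfl⟩
  let K : C(X ⊕ Y, C(I, Wedge X Y x₀ y₀)) := ⟨Sum.elim (qX.comp H).curry (qY.comp G).curry,
    continuous_sumElim.2 ⟨ContinuousMap.continuous _, ContinuousMap.continuous _⟩⟩
  let H' : C(Wedge X Y x₀ y₀, C(I, Wedge X Y x₀ y₀)) := ⟨Quot.lift K (by
    rintro _ _ ⟨rfl, rfl⟩
    ext t
    change qX (H (x₀, t)) = qY (G (y₀, t))
    rw [Hx, Gy, hq]), continuous_quot_lift _ K.continuous⟩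
  refine ⟨H'.uncurry, ⟨Quot.lift (Sum.elim u v) ?_, continuous_quot_lift _
    (continuous_sumElim.2 ⟨u.continuous, v.continuous⟩)⟩, ?_, ?_, ?_, ?_⟩
  · rintro _ _ ⟨rfl, rfl⟩
    exact ux.trans vy.symm
  · intro x
    induction x using Quot.ind with
    | mk x =>
      rcases x with x | y
      · exact congrArg qX (H0 x)
      · exact congrArg qY (G0 y)
  · intro t
    exact congrArg qX (Hx t)
  · exact ux
  · intro x
    induction x using Quot.ind with
    | mk x =>
      rcases x with x | y
      · intro hx
        exact congrArg qX (H1 x hx)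
      · intro hy
        exact (congrArg qY (G1 y hy)).trans hq.symm

/-- The map that slides a collar over a homotopy. -/
theorem exists_collar {S : Type u₃} [TopologicalSpace S] (c : C(S × I, Y)) (K : C(S × I, Y))
    (h : ∀ s, c (s, 0) = K (s, 0)) : ∃ L : C((S × I) × I, Y), (∀ s r, L ((s, r), 0) = c (s, r)) ∧
      (∀ s t, L ((s, 0), t) = K (s, clampI (3 * t))) ∧ (∀ s t, L ((s, 1), t) = c (s, 1)) ∧
      ∀ s (r : I), (r : ℝ) ≤ 1 / 4 → L ((s, r), 1) = K (s, 1) := by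
  obtain ⟨l, l1, l2⟩ : ∃ l : C(S × ℝ, Y), (∀ s x, x ≤ 0 → l (s, x) = c (s, clampI (-x))) ∧
      ∀ s x, 0 ≤ x → l (s, x) = K (s, clampI x) := by
    refine ⟨lineMap (c.comp ⟨fun x => (x.1, σ x.2), by fun_prop⟩) K (by simpa using h),
      fun s x hx => ?_, fun s x hx => lineMap_of_nonneg _ s hx⟩
    rw [lineMap_of_nonpos _ s hx]
    change c (s, σ _) = _
    rw [symm_clampI]
    congr 3
    ring
  -- The position is `-r` at time `0`, `3t` on the inner end and `-1` on the outer end. At time `1`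
  -- it is at least `2` for `r ≤ 1/4`, so `K` has been run through completely.
  refine ⟨l.comp ⟨fun x => (x.1.1, (1 - (x.1.2 : ℝ)) * (1 + 3 * x.2) - 1), by fun_prop⟩,
    ?_, ?_, ?_, ?_⟩
  · intro s r
    change l (s, (1 - (r : ℝ)) * (1 + 3 * ((0 : I) : ℝ)) - 1) = _
    have e : (1 - (r : ℝ)) * (1 + 3 * ((0 : I) : ℝ)) - 1 = -r := by simp
    rw [e, l1 _ _ (by simpa using r.2.1), neg_neg, clampI_coe]
  · intro s t
    change l (s, (1 - ((0 : I) : ℝ)) * (1 + 3 * (t : ℝ)) - 1) = _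
    have e : (1 - ((0 : I) : ℝ)) * (1 + 3 * (t : ℝ)) - 1 = 3 * t := by simp
    rw [e, l2 _ _ (by have : (0 : ℝ) ≤ t := t.2.1
                      positivity)]
  · intro s t
    change l (s, (1 - ((1 : I) : ℝ)) * (1 + 3 * (t : ℝ)) - 1) = _
    have e : (1 - ((1 : I) : ℝ)) * (1 + 3 * (t : ℝ)) - 1 = -1 := by simp
    rw [e, l1 _ _ (by norm_num), neg_neg, clampI_of_ge le_rfl]
  · intro s r hr
    change l (s, (1 - (r : ℝ)) * (1 + 3 * ((1 : I) : ℝ)) - 1) = _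
    have h1 : (1 : ℝ) ≤ (1 - (r : ℝ)) * (1 + 3 * ((1 : I) : ℝ)) - 1 := by
      simp only [Set.Icc.coe_one]
      linarith
    rw [l2 _ _ (by linarith), clampI_of_ge h1]

-- The contraction in `A` is extended over the cylinder by a collar. The function `u` is damped by
-- `1 - 2r`, so that `u ≥ 1/2` forces `r ≤ 1/4`, where the collar has reached the end of the
-- contraction.
open HomotopyPushout in
theorem homotopyPushout {S : Type u₃} {A : Type u₄} {B : Type u₅} [TopologicalSpace S]
    [TopologicalSpace A] [TopologicalSpace B] {a₀ : A} (h : IsWellPointed A a₀) (f : C(S, A))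
    (g : C(S, B)) : IsWellPointed (HomotopyPushout f g) (left f g a₀) := by
  obtain ⟨H, u, H0, Hx, ux, H1⟩ := h
  obtain ⟨L, L0, Ll, Lr, L1⟩ := exists_collar (cyl f g)
    ⟨fun x : S × I => left f g (H (f x.1, x.2)), by fun_prop⟩ (fun s => by simp [H0])
  let K : C(HomotopyPushout f g, C(I, HomotopyPushout f g)) :=
    desc (ContinuousMap.curry ⟨fun x => left f g (H (x.1, clampI (3 * x.2))), by fun_prop⟩) L.curry
      ⟨fun b => .const _ (right f g b), (ContinuousMap.const'.comp (right f g)).continuous⟩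
      (fun s => by ext t; exact Ll s t)
      (fun s => by ext t; exact (Lr s t).trans (cyl_one f g s))
  refine ⟨K.uncurry, desc u ⟨fun x => clampI (1 - 2 * x.2) * u (f x.1), by fun_prop⟩ (.const _ 0)
    (fun s => ?_) (fun s => ?_), fun x => ?_, fun t => ?_, ux, fun x => ?_⟩
  · change clampI (1 - 2 * ((0 : I) : ℝ)) * u (f s) = _
    rw [clampI_of_ge (by simp), one_mul]
  · change clampI (1 - 2 * ((1 : I) : ℝ)) * u (f s) = _
    rw [clampI_of_le (by norm_num), zero_mul]; rfl
  · induction x using HomotopyPushout.ind with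
    | hl a =>
      change left f g (H (a, clampI (3 * ((0 : I) : ℝ)))) = _
      rw [clampI_of_le (by simp), H0]
    | hc s r => exact L0 s r
    | hr b => rfl
  · exact congrArg (left f g) (Hx _)
  · induction x using HomotopyPushout.ind with
    | hl a =>
      intro ha
      change left f g (H (a, clampI (3 * ((1 : I) : ℝ)))) = _
      rw [clampI_of_ge (by norm_num), H1 _ ha]
    | hc s r =>
      intro ha
      have ha : (1 : ℝ) / 2 ≤ clampI (1 - 2 * r) * u (f s) := ha
      have h1 : (1 : ℝ) / 2 ≤ u (f s) :=
        ha.trans (mul_le_of_le_one_left (u (f s)).2.1 (clampI _).2.2)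
      have h2 : (1 : ℝ) / 2 ≤ clampI (1 - 2 * r) :=
        ha.trans (mul_le_of_le_one_right (clampI _).2.1 (u (f s)).2.2)
      rw [coe_clampI] at h2
      have h3 : (1 : ℝ) / 2 ≤ 1 - 2 * r := by
        rcases le_max_iff.1 h2 with h | h
        · norm_num at h
        · exact h.trans (min_le_right _ _)
      refine (L1 s r (by linarith)).trans ?_
      exact congrArg (left f g) (H1 _ h1)
    | hr b =>
      intro hb
      have hb : (1 : ℝ) / 2 ≤ ((0 : I) : ℝ) := hb
      norm_num at hb

/-- Points move on the projected segment to the base point. The speed `2 * height`, cut off at `1`,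
vanishes at the antipode, where the segment would hit the origin, and is full on the upper half. -/
theorem sphere (k : ℕ) : IsWellPointed (Sph k) (Sph.base k) := by
  let c : Sph k × I → ℝ := fun x => (x.2 : ℝ) * clampI (2 * Sph.height k x.1)
  have hc0 : ∀ x, 0 ≤ c x := fun x => mul_nonneg x.2.2.1 (clampI _).2.1
  have hc1 : ∀ x, c x ≤ 1 := fun x => mul_le_one₀ x.2.2.2 (clampI _).2.1 (clampI _).2.2
  have hcc : Continuous c := by fun_prop
  let w : Sph k × I → EuclideanSpace ℝ (Fin (k + 1)) := fun x =>
    (1 - c x) • x.1.1 + c x • (Sph.base k).1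
  have hw : ∀ x, w x ≠ 0 := fun x h => by
    by_cases hx : x.1 = -Sph.base k
    · have hh : Sph.height k x.1 = 0 := by
        by_contra h'
        exact (Sph.height_pos_iff x.1).1 (unitInterval.pos_iff_ne_zero.2 h') hx
      have hc : c x = 0 := by simp only [c, hh]; simp
      have hx1 := Sph.norm_eq_one x.1
      simp only [w, hc] at h
      simp at h
      simp [h] at hx1
    · exact Sph.smul_ne_neg_smul hx (sub_nonneg.2 (hc1 x)) (hc0 x) (by simp)
        (eq_neg_of_add_eq_zero_left h)
  have hn : ∀ x, 0 < ‖w x‖ := fun x => norm_pos_iff.2 (hw x)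
  have hwc : Continuous w := by fun_prop
  let H : C(Sph k × I, Sph k) := ⟨fun x => ⟨‖w x‖⁻¹ • w x, by simp [norm_smul, (hn x).ne']⟩,
    by
      refine Continuous.subtype_mk ?_ _
      exact (hwc.norm.inv₀ fun x => (hn x).ne').smul hwc⟩
  have hH : ∀ x y, w x = y.1 → H x = y := by
    intro x y h
    refine Subtype.ext ?_
    change ‖w x‖⁻¹ • w x = _
    rw [h, Sph.norm_eq_one]; simp
  refine ⟨H, Sph.height k, fun x => hH _ _ ?_, fun t => hH _ _ ?_, ?_, fun x hx => hH _ _ ?_⟩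
  · simp [w, c]
  · simp only [w]; module
  · refine Subtype.ext ?_
    rw [Sph.coe_height, Sph.base_zero_coord]; norm_num
  · have : c (x, 1) = 1 := by
      simp only [c]
      rw [clampI_of_ge (by linarith)]; simp
    simp [w, this]

-- First `H` contracts the point of `E`, with transport of the path; then `G` contracts the path in
-- `B`, value by value. The second stage succeeds for paths that lie entirely in the neighbourhood
-- of `b₀`, which is measured by a supremum norm.
open HomotopyFiber in
theorem homotopyFiber {E : Type u₁} {B : Type u₂} [TopologicalSpace E] [TopologicalSpace B]
    {e₀ : E} {b₀ : B} (hE : IsWellPointed E e₀) (hB : IsWellPointed B b₀) (p : C(E, B))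
    (hp : p e₀ = b₀) : IsWellPointed (HomotopyFiber p b₀) (HomotopyFiber.base p e₀ hp) := by
  obtain ⟨H, u, H0, Hx, ux, H1⟩ := hE
  obtain ⟨G, v, G0, Gx, vx, G1⟩ := hB
  obtain ⟨T, T1, T2, T3⟩ := exists_transport (p := p) (b := b₀)
    (H.comp ⟨fun x : HomotopyFiber p b₀ × I => (proj _ _ x.1, x.2), by fun_prop⟩) (path p b₀)
    (fun x => by simp [H0]) (fun x => path_one x)
  have T1' : ∀ z r, proj _ _ (T (z, r)) = H (proj _ _ z, r) := T1
  have hb : ∀ t, path p b₀ (HomotopyFiber.base p e₀ hp, t) = b₀ := fun _ => rfl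
  have hb' : proj p b₀ (HomotopyFiber.base p e₀ hp) = e₀ := rfl
  have T3' : ∀ r t, path _ _ (T (HomotopyFiber.base p e₀ hp, r), t) = b₀ := by
    intro r t
    rcases T3 (HomotopyFiber.base p e₀ hp) r t with ⟨r', h⟩ | ⟨t', h⟩
    · rw [h]
      change p (H (proj _ _ (HomotopyFiber.base p e₀ hp), r')) = _
      rw [hb', Hx, hp]
    · rw [h, hb]
  -- The time for `G` is positive only if `t > 1/2` and `u > 1/2`. Then `H` has already reached
  -- `e₀`, so the start of the path is `b₀` and `G` does not tear it from the point of `E`.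
  let l : C(HomotopyFiber p b₀ × I, I) :=
    ⟨fun x => clampI (2 * x.2 - 1) * clampI (4 * u (proj _ _ x.1) - 2), by fun_prop⟩
  let e : C(HomotopyFiber p b₀ × I, E) := ⟨fun x => H (proj _ _ x.1, clampI (2 * x.2)), by fun_prop⟩
  let γ : C((HomotopyFiber p b₀ × I) × I, B) :=
    ⟨fun x => G (path _ _ (T (x.1.1, clampI (2 * x.1.2)), x.2), l x.1), by fun_prop⟩
  have hγ0 : ∀ x, γ (x, 0) = p (e x) := by
    rintro ⟨z, t⟩
    change G (path _ _ (T (z, clampI (2 * t)), 0), l (z, t)) = p (H (proj _ _ z, clampI (2 * t)))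
    rw [path_zero, T1']
    rcases le_or_gt (2 * (t : ℝ) - 1) 0 with h | h
    · have : l (z, t) = 0 := by
        change clampI (2 * t - 1) * _ = 0
        rw [clampI_of_le h, zero_mul]
      rw [this, G0]
    rcases le_or_gt (4 * (u (proj _ _ z) : ℝ) - 2) 0 with h' | h'
    · have : l (z, t) = 0 := by
        change clampI (2 * t - 1) * clampI (4 * u (proj _ _ z) - 2) = 0
        rw [clampI_of_le h', mul_zero]
      rw [this, G0]
    · rw [clampI_of_ge (by linarith), H1 _ (by linarith), hp, Gx]
  have hγ1 : ∀ x, γ (x, 1) = b₀ := by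
    intro x
    change G (path _ _ (T _, 1), _) = _
    rw [path_one, Gx]
  -- `‖w z‖ ≤ 1/2` means that `v ≥ 1/2` along the whole transported path.
  let w : C(HomotopyFiber p b₀, C(I, ℝ)) :=
    ContinuousMap.curry ⟨fun x => 1 - (v (path _ _ (T (x.1, 1), x.2)) : ℝ), by fun_prop⟩
  have hw : ∀ z t, w z t = 1 - (v (path _ _ (T (z, 1), t)) : ℝ) := fun _ _ => rfl
  refine ⟨lift e γ hγ0 hγ1,
    ⟨fun z => clampI (2 * u (proj _ _ z) - 1) * clampI (1 - ‖w z‖), by fun_prop⟩, ?_, ?_, ?_, ?_⟩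
  · intro z
    refine HomotopyFiber.ext ?_ fun t => ?_
    · change H (_, clampI (2 * ((0 : I) : ℝ))) = _
      rw [clampI_of_le (by simp), H0]
    · change G (path _ _ (T (z, clampI (2 * ((0 : I) : ℝ))), t),
        clampI (2 * ((0 : I) : ℝ) - 1) * _) = _
      rw [clampI_of_le (x := 2 * ((0 : I) : ℝ)) (by simp),
        clampI_of_le (x := 2 * ((0 : I) : ℝ) - 1) (by simp), zero_mul, G0, T2]
  · intro t
    refine HomotopyFiber.ext ?_ fun s => ?_
    · exact Hx _
    · change G (path _ _ (T (_, _), s), _) = _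
      rw [T3', Gx, hb]
  · change clampI (2 * u e₀ - 1) * clampI (1 - ‖w (HomotopyFiber.base p e₀ hp)‖) = 1
    have : w (HomotopyFiber.base p e₀ hp) = 0 := by
      ext t
      rw [hw, T3', vx]; simp
    rw [this, ux, clampI_of_ge (by norm_num), clampI_of_ge (by simp), one_mul]
  · intro z hz
    have hz : (1 : ℝ) / 2 ≤ clampI (2 * u (proj _ _ z) - 1) * clampI (1 - ‖w z‖) := hz
    have aux : ∀ x : ℝ, (1 : ℝ) / 2 ≤ clampI x → 1 / 2 ≤ x := by
      intro x hx
      rw [coe_clampI] at hx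
      rcases le_max_iff.1 hx with h | h
      · norm_num at h
      · exact h.trans (min_le_right _ _)
    have h1 := aux _ (hz.trans (mul_le_of_le_one_right (clampI _).2.1 (clampI _).2.2))
    have h2 := aux _ (hz.trans (mul_le_of_le_one_left (clampI _).2.1 (clampI _).2.2))
    have hl : l (z, 1) = 1 := by
      change clampI (2 * ((1 : I) : ℝ) - 1) * clampI (4 * u (proj _ _ z) - 2) = 1
      rw [clampI_of_ge (by norm_num), clampI_of_ge (by linarith), one_mul]
    refine HomotopyFiber.ext ?_ fun t => ?_
    · change H (_, clampI (2 * ((1 : I) : ℝ))) = e₀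
      rw [clampI_of_ge (by norm_num), H1 _ (by linarith)]
    · change G (path _ _ (T (z, clampI (2 * ((1 : I) : ℝ))), t), l (z, 1)) = b₀
      rw [hl, clampI_of_ge (by norm_num)]
      refine G1 _ ?_
      have h3 := (ContinuousMap.norm_coe_le_norm (w z) t)
      rw [hw, Real.norm_eq_abs] at h3
      have := (abs_le.1 h3).2
      linarith

end IsWellPointed

/-! ### From free to pointed homotopy equivalences. -/

section Pointed

variable {X : Type u₁} {Y : Type u₂} {Z : Type u₃} [TopologicalSpace X] [TopologicalSpace Y]
  [TopologicalSpace Z] {x₀ : X} {y₀ : Y}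

theorem ContinuousMap.homotopicRel_of_prod {f g : C(X, Y)} (F : C(X × I, Y))
    (h0 : ∀ x, F (x, 0) = f x) (h1 : ∀ x, F (x, 1) = g x) (h : ∀ t, F (x₀, t) = f x₀) :
    f.HomotopicRel g {x₀} :=
  ⟨⟨⟨F.comp ⟨Prod.swap, continuous_swap⟩, fun x => by simp [h0], fun x => by simp [h1]⟩, by
    rintro t x rfl
    exact h t⟩⟩

theorem ContinuousMap.HomotopicRel.comp_pointed {f g : C(Y, Z)} (h : f.HomotopicRel g {y₀})
    (k : C(X, Y)) (hk : k x₀ = y₀) : (f.comp k).HomotopicRel (g.comp k) {x₀} := by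
  obtain ⟨F⟩ := h
  refine ⟨⟨F.toHomotopy.compContinuousMap k, ?_⟩⟩
  rintro t x rfl
  exact F.prop t (k x) hk

namespace IsWellPointed

/-- A pointed self-map that is freely homotopic to the identity has a pointed left inverse. -/
theorem exists_left_inverse (h : IsWellPointed X x₀) {u : C(X, X)} (hu : u x₀ = x₀)
    (hu' : u.Homotopic (.id X)) :
    ∃ v : C(X, X), v x₀ = x₀ ∧ (v.comp u).HomotopicRel (.id X) {x₀} := by
  obtain ⟨F, F0, F1⟩ := hu'.exists_prod
  let α : C(I, X) := ⟨fun t => F (x₀, t), by fun_prop⟩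
  have hα0 : α 0 = x₀ := (F0 _).trans hu
  have hα1 : α 1 = x₀ := F1 _
  -- `F` drags the base point around the loop `α`. The map `v` is the end of a homotopy of the
  -- identity that drags it around the same loop, so the two cancel.
  obtain ⟨G, G0, Gx⟩ := h.exists_extension (.id X) α hα0
  let v : C(X, X) := ⟨fun x => G (x, 1), by fun_prop⟩
  have hv : v x₀ = x₀ := by
    change G (x₀, 1) = x₀
    rw [Gx, clampI_of_ge (by norm_num), hα1]
  refine ⟨v, hv, ?_⟩
  let K : C(X × I, X) := ⟨fun x => if (x.2 : ℝ) ≤ 1 / 2 then G (u x.1, clampI (1 - 2 * x.2)) else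
    F (x.1, clampI (2 * x.2 - 1)), Continuous.if_le (by fun_prop) (by fun_prop) (by fun_prop)
      (by fun_prop) fun x hx => by
        rw [clampI_of_le (x := 1 - 2 * (x.2 : ℝ)) (by linarith),
          clampI_of_le (x := 2 * (x.2 : ℝ) - 1) (by linarith), G0, F0]; rfl⟩
  have K0 : ∀ x, K (x, 0) = v (u x) := fun x => by
    refine (if_pos (by simp)).trans ?_
    change G (u x, clampI (1 - 2 * ((0 : I) : ℝ))) = _
    rw [clampI_of_ge (by simp)]; rfl
  have K1 : ∀ x, K (x, 1) = x := fun x => by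
    refine (if_neg (by norm_num)).trans ?_
    change F (x, clampI (2 * ((1 : I) : ℝ) - 1)) = _
    rw [clampI_of_ge (by norm_num), F1]; rfl
  let μ : C(I, I) := ⟨fun t => clampI (1 - 4 * t) ⊔ clampI (2 * t - 1), by fun_prop⟩
  have μ0 : μ 0 = 1 := by
    change clampI _ ⊔ _ = _
    rw [clampI_of_ge (by simp)]
    exact sup_eq_left.2 le_top
  have μ1 : μ 1 = 1 := by
    change _ ⊔ clampI _ = _
    rw [clampI_of_ge (x := 2 * ((1 : I) : ℝ) - 1) (by norm_num)]
    exact sup_eq_right.2 le_top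
  have Kx : ∀ t, K (x₀, t) = α (μ t) := fun t => by
    have hcl : ∀ x, 0 ≤ clampI x := fun _ => bot_le
    rcases le_or_gt (t : ℝ) (1 / 2) with ht | ht
    · refine (if_pos ht).trans ?_
      change G (u x₀, _) = α (clampI (1 - 4 * t) ⊔ clampI (2 * t - 1))
      rw [hu, Gx, clampI_of_le (x := 2 * (t : ℝ) - 1) (by linarith), sup_eq_left.2 (hcl _),
        coe_clampI_of_mem (by linarith) (by have := t.2.1; linarith)]
      congr 2
      ring
    · refine (if_neg ht.not_ge).trans ?_
      change F (x₀, _) = α (clampI (1 - 4 * t) ⊔ clampI (2 * t - 1))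
      rw [clampI_of_le (x := 1 - 4 * (t : ℝ)) (by linarith), sup_eq_right.2 (hcl _)]
      rfl
  -- `K` joins `v ∘ u` to the identity, and its base point runs along `α` from `1` to `0` and back.
  -- Raising the parameter to at least `s` contracts this track. The contraction extends over `X`,
  -- and the three other sides of the square give a pointed homotopy.
  let γ : C(I, C(I, X)) := ContinuousMap.curry ⟨fun x => α (μ x.2 ⊔ x.1), by fun_prop⟩
  have hγ : ∀ s t, γ s t = α (μ t ⊔ s) := fun _ _ => rfl
  obtain ⟨L, L0, Lx⟩ := h.exists_extension K.curry γ (by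
    ext t
    rw [hγ, sup_eq_left.2 unitInterval.nonneg']
    exact (Kx t).symm)
  have hL : ∀ s t, L (x₀, s) t = α (μ t ⊔ clampI (2 * s - 1)) := fun s t => by rw [Lx, hγ]
  have htop : ∀ s : I, (1 : I) ⊔ s = 1 := fun s => sup_eq_left.2 le_top
  have htop' : ∀ s : I, s ⊔ (1 : I) = 1 := fun s => sup_eq_right.2 le_top
  have e1 : (v.comp u).HomotopicRel ⟨fun x => L (x, 1) 0, by fun_prop⟩ {x₀} :=
    homotopicRel_of_prod ⟨fun x => L x 0, by fun_prop⟩ (fun x => by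
      change L (x, 0) 0 = _
      rw [L0]
      exact K0 x) (fun x => rfl) fun t => by
        change L (x₀, t) 0 = v (u x₀)
        rw [hL, μ0, htop, hα1, hu, hv]
  have e2 : HomotopicRel (⟨fun x => L (x, 1) 0, by fun_prop⟩ : C(X, X))
      ⟨fun x => L (x, 1) 1, by fun_prop⟩ {x₀} :=
    homotopicRel_of_prod ⟨fun x => L (x.1, 1) x.2, by fun_prop⟩ (fun x => rfl) (fun x => rfl)
      fun t => by
        change L (x₀, 1) t = L (x₀, 1) 0
        rw [hL, hL, clampI_of_ge (by norm_num), htop', htop']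
  have e3 : HomotopicRel (.id X) ⟨fun x => L (x, 1) 1, by fun_prop⟩ {x₀} :=
    homotopicRel_of_prod ⟨fun x => L x 1, by fun_prop⟩ (fun x => by
      change L (x, 0) 1 = _
      rw [L0]
      exact K1 x) (fun x => rfl) fun t => by
        change L (x₀, t) 1 = x₀
        rw [hL, μ1, htop, hα1]
  exact (e1.trans e2).trans e3.symm

theorem exists_pointed (h : IsWellPointed X x₀) (f : C(X, Y)) (hf : Joined (f x₀) y₀) :
    ∃ g : C(X, Y), g x₀ = y₀ ∧ f.Homotopic g := by
  obtain ⟨γ⟩ := hf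
  obtain ⟨F, F0, Fx⟩ := h.exists_extension f γ γ.source
  refine ⟨⟨fun x => F (x, 1), by fun_prop⟩, ?_, homotopic_of_prod F F0 fun _ => rfl⟩
  change F (x₀, 1) = _
  rw [Fx, clampI_of_ge (by norm_num)]
  exact γ.target

/-- Homotopy equivalent well-pointed spaces are pointed homotopy equivalent. -/
theorem exists_isPointedHomotopyEquiv (hX : IsWellPointed X x₀) (hY : IsWellPointed Y y₀)
    [PathConnectedSpace X] (e : X ≃ₕ Y) : ∃ φ : C(X, Y), IsPointedHomotopyEquiv φ x₀ y₀ := by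
  have := (IsHomotopyEquiv.of_equiv e).pathConnectedSpace
  obtain ⟨φ, hφ, eφ⟩ := hX.exists_pointed e.toFun (PathConnectedSpace.joined _ y₀)
  obtain ⟨ψ, hψ, eψ⟩ := hY.exists_pointed e.invFun (PathConnectedSpace.joined _ x₀)
  have h1 : (ψ.comp φ).Homotopic (.id X) :=
    ((eφ.symm.comp_left ψ).trans (eψ.symm.comp_right e.toFun)).trans e.left_inv
  have h2 : (φ.comp ψ).Homotopic (.id Y) :=
    ((eψ.symm.comp_left φ).trans (eφ.symm.comp_right e.invFun)).trans e.right_inv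
  obtain ⟨v, hv, ev⟩ := hX.exists_left_inverse (u := ψ.comp φ)
    (by rw [comp_apply, hφ, hψ]) h1
  have h3 : (φ.comp (v.comp ψ)).Homotopic (.id Y) := by
    have a1 : (v.comp ψ).Homotopic ψ := by
      have a2 : v.Homotopic (.id X) := (h1.symm.comp_left v).trans ev.homotopic
      exact a2.comp_right ψ
    exact (a1.comp_left φ).trans h2
  obtain ⟨w, hw, ew⟩ := hY.exists_left_inverse (u := φ.comp (v.comp ψ))
    (by rw [comp_apply, comp_apply, hψ, hv, hφ]) h3
  refine ⟨φ, hφ, v.comp ψ, by rw [comp_apply, hψ, hv], ev, ?_⟩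
  -- `w ∘ φ ∘ v ∘ ψ ∘ φ` reduces to `w ∘ φ` by `ev` and to `φ` by `ew`. So `v ∘ ψ`, a left inverse
  -- of `φ` by `ev`, is also a right inverse.
  have h4 : (w.comp φ).HomotopicRel φ {x₀} := by
    have b1 : ((w.comp φ).comp (v.comp (ψ.comp φ))).HomotopicRel (w.comp φ) {x₀} :=
      ev.comp_continuousMap (w.comp φ)
    have b2 : ((w.comp (φ.comp (v.comp ψ))).comp φ).HomotopicRel φ {x₀} := ew.comp_pointed φ hφ
    exact b1.symm.trans b2
  have h5 : ((w.comp φ).comp (v.comp ψ)).HomotopicRel (φ.comp (v.comp ψ)) {y₀} :=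
    h4.comp_pointed (v.comp ψ) (by rw [comp_apply, hψ, hv])
  exact h5.symm.trans ew

end IsWellPointed

end Pointed

theorem HalfSmash.pathConnectedSpace {A : Type u₁} {W : Type u₂} [TopologicalSpace A]
    [TopologicalSpace W] [Inhabited W] [PathConnectedSpace A] (a₀ : A) :
    PathConnectedSpace (HalfSmash A W a₀) := by
  have h : ∀ x : HalfSmash A W a₀, Joined x (HalfSmash.base a₀) := by
    intro x
    induction x using Quot.ind with
    | mk x =>
      have hc : Continuous fun a => (Quot.mk _ (a, x.2) : HalfSmash A W a₀) :=
        continuous_quot_mk.comp (by fun_prop)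
      have e : (Quot.mk _ (a₀, x.2) : HalfSmash A W a₀) = HalfSmash.base a₀ :=
        Quot.sound ⟨rfl, rfl⟩
      exact e ▸ (PathConnectedSpace.joined x.1 a₀).map hc
  exact ⟨⟨HalfSmash.base a₀⟩, fun x y => (h x).trans (h y).symm⟩

theorem Wedge.pathConnectedSpace {X : Type u₁} {Y : Type u₂} [TopologicalSpace X]
    [TopologicalSpace Y] [PathConnectedSpace X] [PathConnectedSpace Y] (x₀ : X) (y₀ : Y) :
    PathConnectedSpace (Wedge X Y x₀ y₀) := by
  have h : ∀ x : Wedge X Y x₀ y₀, Joined x (Wedge.base x₀ y₀) := by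
    intro x
    induction x using Quot.ind with
    | mk x =>
      rcases x with x | y
      · exact (PathConnectedSpace.joined x x₀).map
          (f := fun x => (Quot.mk _ (.inl x) : Wedge X Y x₀ y₀))
          (continuous_quot_mk.comp continuous_inl)
      · have e : (Quot.mk _ (.inr y₀) : Wedge X Y x₀ y₀) = Wedge.base x₀ y₀ :=
          (Quot.sound ⟨rfl, rfl⟩).symm
        exact e ▸ (PathConnectedSpace.joined y y₀).map
          (f := fun x => (Quot.mk _ (.inr x) : Wedge X Y x₀ y₀))
          (continuous_quot_mk.comp continuous_inr)
  exact ⟨⟨Wedge.base x₀ y₀⟩, fun x y => (h x).trans (h y).symm⟩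

/-! ### The section and the homotopy fibration. -/

namespace SphereProd

open HomotopyPushout

variable {m k : ℕ} {A : Type u₁} [TopologicalSpace A]
  (f : C(sphere (0 : Fin (m + k) → ℝ) 1, A))

/-- The slice through `p₁` is a strict section that misses the base point. Homotopy extension drags
it there along `δ`, which stays in the fibre over the base point of `Sᵐ`; hence the homotopy is
pointed after projection. -/
theorem hasRightHomotopyInverse [PathConnectedSpace A] (hk : 1 ≤ k) (a₀ : A) :
    HasRightHomotopyInverse (toSphere f) (left f _ a₀) (Sph.base m) := by
  obtain ⟨j, hj, hj'⟩ := exists_inverse f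
  obtain ⟨p₁, ⟨δ, hδ⟩, hp₁⟩ := exists_joinedIn f hk a₀
  have hp₁m : (coord f p₁).1 = Sph.base m := by simpa using (hδ 1).1
  let s : C(Sph m, HomotopyPushout f (sphereProdTopCell m k).attach) :=
    ⟨fun z => j ⟨(z, (coord f p₁).2), fun h => hp₁ (congrArg Prod.snd h)⟩, by fun_prop⟩
  have hs : ∀ z, toSphere f (s z) = z := fun z => congrArg Prod.fst (hj _)
  have hsb : s (Sph.base m) = p₁ := by
    have hne : coord f p₁ ≠ (Sph.base m, -Sph.base k) := fun h => hp₁ (congrArg Prod.snd h)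
    refine Eq.trans ?_ (hj' p₁ hne)
    exact congrArg j (Subtype.ext (Prod.ext hp₁m.symm rfl))
  obtain ⟨F, F0, Fb⟩ := (IsWellPointed.sphere m).exists_extension s δ.symm
    (δ.symm.source.trans hsb.symm)
  have hF : ∀ t, toSphere f (F (Sph.base m, t)) = Sph.base m := fun t => by
    rw [Fb]
    exact (hδ _).1
  refine ⟨⟨fun z => F (z, 1), by fun_prop⟩, ?_, HomotopicRel.symm ?_⟩
  · change F (Sph.base m, 1) = _
    rw [Fb, clampI_of_ge (by norm_num)]
    exact δ.symm.target
  · exact homotopicRel_of_prod ((toSphere f).comp F)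
      (fun z => (congrArg (toSphere f) (F0 z)).trans (hs z)) (fun _ => rfl) hF

/-- The free equivalence becomes a pointed one `φ` because both sides are well-pointed and
path-connected. The map `i` is defined as `φ` followed by the projection, so that `φ` lifts it by
construction. -/
theorem exists_isHomotopyFibration [PathConnectedSpace A] (hm : 1 ≤ m) (hk : 1 ≤ k) {a₀ : A}
    (h : IsWellPointed A a₀) :
    ∃ i : C(Wedge (Sph k) (HalfSmash A (LoopSpace (Sph m) (Sph.base m)) a₀)
        (Sph.base k) (HalfSmash.base a₀), HomotopyPushout f (sphereProdTopCell m k).attach),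
      IsHomotopyFibration i (toSphere f) (Wedge.base (Sph.base k) (HalfSmash.base a₀))
        (left f _ a₀) (Sph.base m) := by
  have := Sph.pathConnectedSpace hk
  have := HalfSmash.pathConnectedSpace (W := LoopSpace (Sph m) (Sph.base m)) a₀
  have := Wedge.pathConnectedSpace (Sph.base k)
    (HalfSmash.base (B := LoopSpace (Sph m) (Sph.base m)) a₀)
  have hZ := h.halfSmash (W := LoopSpace (Sph m) (Sph.base m))
  have e1 : Nonempty (Part f ≃ₕ HalfSmash A (LoopSpace (Sph m) (Sph.base m)) a₀) :=
    ⟨(nonempty_part f hk a₀).some.trans (nonempty_halfSmash h).some⟩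
  have e2 := (nonempty_fiber f hm hk (HalfSmash.base a₀) e1).some.trans
    (nonempty_wedge (x₀ := Sph.base k) hZ).some
  obtain ⟨φ, hφ⟩ := ((IsWellPointed.sphere k).wedge hZ).exists_isPointedHomotopyEquiv
    ((h.homotopyPushout f (sphereProdTopCell m k).attach).homotopyFiber (IsWellPointed.sphere m)
      (toSphere f) (toSphere_left f a₀)) e2.symm
  exact ⟨(HomotopyFiber.proj _ _).comp φ, congrArg (HomotopyFiber.proj _ _) hφ.1,
    toSphere_left f a₀, φ, fun _ => rfl, hφ⟩

end SphereProd

/-! ### Cell attachments and well-pointedness of skeleta. -/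

/-- The space `X` arises from `Y` by attaching `N`-cells, indexed by `J`. -/
structure IsCellAttachment {X : Type u₁} {Y : Type u₂} {J : Type u₃} [TopologicalSpace X]
    [TopologicalSpace Y] {N : ℕ} (ι : C(Y, X))
    (Φ : J → C(closedBall (0 : Fin N → ℝ) 1, X)) : Prop where
  isEmbedding : IsClosedEmbedding ι
  mem_range : ∀ j v, ‖v.1‖ = 1 → Φ j v ∈ Set.range ι
  notMem_range : ∀ j v, ‖v.1‖ < 1 → Φ j v ∉ Set.range ι
  injective : ∀ j j' v v', ‖v.1‖ < 1 → ‖v'.1‖ < 1 → Φ j v = Φ j' v' → j = j' ∧ v = v'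
  exists_eq : ∀ x, x ∈ Set.range ι ∨ ∃ j v, ‖v.1‖ < 1 ∧ Φ j v = x
  isClosed_of : ∀ s, IsClosed (ι ⁻¹' s) → (∀ j, IsClosed (Φ j ⁻¹' s)) → IsClosed s

namespace IsCellAttachment

variable {X : Type u₁} {Y : Type u₂} {J : Type u₃} {T : Type u₄} [TopologicalSpace X]
  [TopologicalSpace Y] [TopologicalSpace T] {N : ℕ} {ι : C(Y, X)}
  {Φ : J → C(closedBall (0 : Fin N → ℝ) 1, X)}

theorem norm_le (v : closedBall (0 : Fin N → ℝ) 1) : ‖v.1‖ ≤ 1 :=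
  mem_closedBall_zero_iff.1 v.2

theorem norm_eq_one (h : IsCellAttachment ι Φ) {j : J} {v : closedBall (0 : Fin N → ℝ) 1} {y : Y}
    (hy : ι y = Φ j v) : ‖v.1‖ = 1 := by
  by_contra h'
  exact h.notMem_range j v (lt_of_le_of_ne (norm_le v) h') ⟨y, hy⟩

theorem exists_desc (h : IsCellAttachment ι Φ) (a : C(Y, T))
    (c : J → C(closedBall (0 : Fin N → ℝ) 1, T)) (hac : ∀ j v y, ι y = Φ j v → c j v = a y) :
    ∃ F : C(X, T), (∀ y, F (ι y) = a y) ∧ ∀ j v, F (Φ j v) = c j v := by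
  have key : ∀ x, ∃ t, (∀ y, ι y = x → a y = t) ∧ ∀ j v, Φ j v = x → c j v = t := by
    intro x
    rcases h.exists_eq x with ⟨y, rfl⟩ | ⟨j, v, hv, rfl⟩
    · exact ⟨a y, fun y' hy' => by rw [h.isEmbedding.injective hy'],
        fun j v hv => hac j v y hv.symm⟩
    · refine ⟨c j v, fun y hy => absurd ⟨y, hy⟩ (h.notMem_range j v hv), fun j' v' hv' => ?_⟩
      have hlt : ‖v'.1‖ < 1 := by
        refine lt_of_le_of_ne (norm_le v') fun h1 => h.notMem_range j v hv ?_
        rw [← hv']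
        exact h.mem_range _ _ h1
      obtain ⟨rfl, rfl⟩ := h.injective j' j v' v hlt hv hv'
      rfl
  choose F hF1 hF2 using key
  refine ⟨⟨F, ?_⟩, fun y => (hF1 _ y rfl).symm, fun j v => (hF2 _ j v rfl).symm⟩
  rw [continuous_iff_isClosed]
  intro s hs
  refine h.isClosed_of _ ?_ fun j => ?_
  · convert hs.preimage a.continuous using 1
    ext y
    rw [Set.mem_preimage, Set.mem_preimage, Set.mem_preimage, ← hF1 _ y rfl]
  · convert hs.preimage (c j).continuous using 1
    ext v
    rw [Set.mem_preimage, Set.mem_preimage, Set.mem_preimage, ← hF2 _ j v rfl]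

/-- The radial retraction to the unit ball. -/
noncomputable def radial (N : ℕ) : C(Fin N → ℝ, closedBall (0 : Fin N → ℝ) 1) where
  toFun w := ⟨(max 1 ‖w‖)⁻¹ • w, by
    have h : 0 < max 1 ‖w‖ := lt_max_of_lt_left one_pos
    rw [mem_closedBall_zero_iff, norm_smul, norm_inv, Real.norm_of_nonneg h.le,
      inv_mul_le_iff₀ h, mul_one]
    exact le_max_right _ _⟩
  continuous_toFun := by
    refine Continuous.subtype_mk ?_ _
    exact ((continuous_const.max continuous_norm).inv₀
      fun w => (lt_max_of_lt_left one_pos).ne').smul continuous_id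

theorem radial_of_norm_le {w : Fin N → ℝ} (h : ‖w‖ ≤ 1) : (radial N w).1 = w := by
  change (max 1 ‖w‖)⁻¹ • w = w
  rw [max_eq_left h]; simp

theorem radial_smul {v : Fin N → ℝ} {r : ℝ} (h : 1 ≤ ‖r • v‖) (hr : 0 ≤ r) :
    (radial N (r • v)).1 = ‖v‖⁻¹ • v := by
  change (max 1 ‖r • v‖)⁻¹ • r • v = _
  have h0 : r ≠ 0 := by rintro rfl; norm_num at h
  rw [max_eq_right h, norm_smul, Real.norm_of_nonneg hr, smul_smul, mul_inv, mul_right_comm,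
    inv_mul_cancel₀ h0, one_mul]

theorem norm_radial {w : Fin N → ℝ} (h : 1 ≤ ‖w‖) : ‖(radial N w).1‖ = 1 := by
  change ‖(max 1 ‖w‖)⁻¹ • w‖ = 1
  have : ‖w‖ ≠ 0 := by linarith
  rw [max_eq_right h, norm_smul, norm_inv, norm_norm, inv_mul_cancel₀ this]

/-- Attaching cells away from a base point preserves well-pointedness. -/
theorem isWellPointed_of_mem (h : IsCellAttachment ι Φ) {y₀ : Y} (hy : IsWellPointed Y y₀) :
    IsWellPointed X (ι y₀) := by
  obtain ⟨H, u, H0, Hx, ux, H1⟩ := hy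
  have key : ∀ j (w : Fin N → ℝ), ∃ y, 1 ≤ ‖w‖ → ι y = Φ j (radial N w) := by
    intro j w
    by_cases hw : 1 ≤ ‖w‖
    · obtain ⟨y, hy⟩ := h.mem_range j _ (norm_radial hw)
      exact ⟨y, fun _ => hy⟩
    · exact ⟨y₀, fun h => absurd h hw⟩
  -- `g j w` is the point of `Y` to which the boundary point of the cell in the direction of `w` is
  -- attached. It matters only for `‖w‖ ≥ 1`; `y₀` is a default elsewhere.
  choose g hg using key
  have hgc : ∀ j, ContinuousOn (g j) {w | 1 ≤ ‖w‖} := by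
    intro j
    rw [h.isEmbedding.isInducing.continuousOn_iff]
    refine ((Φ j).comp (radial N)).continuous.continuousOn.congr fun w hw => hg j w hw
  have hgv : ∀ j (v : closedBall (0 : Fin N → ℝ) 1) (r : ℝ) y, 1 ≤ r → ι y = Φ j v →
      g j (r • v.1) = y := by
    intro j v r y hr hy
    have h1 := h.norm_eq_one hy
    have hn : 1 ≤ ‖r • v.1‖ := by
      rw [norm_smul, h1, mul_one, Real.norm_of_nonneg (by linarith)]; exact hr
    refine h.isEmbedding.injective ?_
    rw [hg j _ hn, hy]
    congr 1
    refine Subtype.ext ?_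
    rw [radial_smul hn (by linarith), h1]; simp
  -- The cell is stretched by the factor `1 + 3t`. What leaves the unit ball is moved to `Y` and
  -- follows `H` for the time `‖w‖ - 1`.
  let w : closedBall (0 : Fin N → ℝ) 1 × I → Fin N → ℝ := fun x => (1 + 3 * (x.2 : ℝ)) • x.1.1
  have hw : Continuous w := by fun_prop
  have hwn : ∀ v t, ‖w (v, t)‖ = (1 + 3 * t) * ‖v.1‖ := by
    intro v t
    have : (0 : ℝ) ≤ t := t.2.1
    rw [norm_smul, Real.norm_of_nonneg (by positivity)]
  let c : J → C(closedBall (0 : Fin N → ℝ) 1 × I, X) := fun j =>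
    ⟨fun x => if ‖w x‖ ≤ 1 then Φ j (radial N (w x)) else ι (H (g j (w x), clampI (‖w x‖ - 1))), by
      refine continuous_if_le hw.norm continuous_const (by fun_prop) ?_ ?_
      · refine (ι.comp H).continuous.comp_continuousOn (ContinuousOn.prodMk ?_ (by fun_prop))
        exact (hgc j).comp hw.continuousOn fun x hx => hx
      · intro x hx
        rw [hx, sub_self, clampI_of_le le_rfl, H0, hg j _ hx.ge]⟩
  have c1 : ∀ j x, ‖w x‖ ≤ 1 → c j x = Φ j (radial N (w x)) := fun j x hx => if_pos hx
  have c2 : ∀ j x, 1 ≤ ‖w x‖ → c j x = ι (H (g j (w x), clampI (‖w x‖ - 1))) := by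
    intro j x hx
    rcases hx.eq_or_lt with h' | h'
    · rw [c1 j x h'.ge, ← h', sub_self, clampI_of_le le_rfl, H0, hg j _ hx]
    · exact if_neg h'.not_ge
  -- The damping `2‖v‖ - 1` makes the value at least `1/2` only for `‖v‖ ≥ 3/4`. There the stretched
  -- norm at time `1` is at least `3`, so `H` is run to its end.
  let cu : J → C(closedBall (0 : Fin N → ℝ) 1, I) := fun j =>
    ⟨fun v => if ‖(2 : ℝ) • v.1‖ ≤ 1 then 0 else
        clampI (‖(2 : ℝ) • v.1‖ - 1) * u (g j ((2 : ℝ) • v.1)), by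
      refine continuous_if_le (by fun_prop) continuous_const (by fun_prop) ?_ ?_
      · refine ContinuousOn.mul (by fun_prop) (u.continuous.comp_continuousOn ?_)
        exact (hgc j).comp (by fun_prop) fun x hx => hx
      · intro v hv
        rw [hv, sub_self, clampI_of_le le_rfl, zero_mul]⟩
  obtain ⟨F, F1, F2⟩ := h.exists_desc
    (ContinuousMap.curry ⟨fun x => ι (H (x.1, clampI (3 * x.2))), by fun_prop⟩ : C(Y, C(I, X)))
    (fun j => (c j).curry) (by
      intro j v y hy
      ext t
      change c j (v, t) = ι (H (y, clampI (3 * t)))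
      have ht : (0 : ℝ) ≤ t := t.2.1
      have hn : ‖w (v, t)‖ = 1 + 3 * t := by rw [hwn, h.norm_eq_one hy, mul_one]
      rw [c2 _ _ (by rw [hn]; linarith), hn, hgv j v _ y (by linarith) hy]
      congr 4
      ring)
  obtain ⟨U, U1, U2⟩ := h.exists_desc u cu (by
      intro j v y hy
      have hn : ‖(2 : ℝ) • v.1‖ = 2 := by rw [norm_smul, h.norm_eq_one hy]; norm_num
      refine (if_neg (by rw [hn]; norm_num)).trans ?_
      rw [hgv j v 2 y (by norm_num) hy, hn, clampI_of_ge (by norm_num), one_mul])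
  have F1' : ∀ y t, F (ι y) t = ι (H (y, clampI (3 * t))) := fun y t => by rw [F1]; rfl
  have F2' : ∀ j v t, F (Φ j v) t = c j (v, t) := fun j v t => by rw [F2]; rfl
  refine ⟨F.uncurry, U, fun x => ?_, fun t => ?_, (U1 _).trans ux, fun x => ?_⟩
  · change F x 0 = x
    rcases h.exists_eq x with ⟨y, rfl⟩ | ⟨j, v, hv, rfl⟩
    · rw [F1', clampI_of_le (by simp), H0]
    · have hw0 : w (v, 0) = v.1 := by simp [w]
      rw [F2', c1 _ _ (by rw [hw0]; exact hv.le), hw0]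
      congr 1
      exact Subtype.ext (radial_of_norm_le hv.le)
  · change F (ι y₀) t = ι y₀
    rw [F1', Hx]
  · intro hx
    change F x 1 = _
    rcases h.exists_eq x with ⟨y, rfl⟩ | ⟨j, v, hv, rfl⟩
    · rw [U1] at hx
      rw [F1', clampI_of_ge (by norm_num), H1 _ hx]
    · rw [U2] at hx
      by_cases hn : ‖(2 : ℝ) • v.1‖ ≤ 1
      · have : cu j v = 0 := if_pos hn
        rw [this] at hx
        norm_num at hx
      have e : cu j v = clampI (‖(2 : ℝ) • v.1‖ - 1) * u (g j ((2 : ℝ) • v.1)) := if_neg hn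
      rw [e] at hx
      have hx : (1 : ℝ) / 2 ≤ clampI (‖(2 : ℝ) • v.1‖ - 1) * u (g j ((2 : ℝ) • v.1)) := hx
      have h1 : (1 : ℝ) / 2 ≤ u (g j ((2 : ℝ) • v.1)) :=
        hx.trans (mul_le_of_le_one_left (u _).2.1 (clampI _).2.2)
      have h2 : (1 : ℝ) / 2 ≤ clampI (‖(2 : ℝ) • v.1‖ - 1) :=
        hx.trans (mul_le_of_le_one_right (clampI _).2.1 (u _).2.2)
      rw [coe_clampI] at h2
      have h3 : (1 : ℝ) / 2 ≤ ‖(2 : ℝ) • v.1‖ - 1 := by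
        rcases le_max_iff.1 h2 with h | h
        · norm_num at h
        · exact h.trans (min_le_right _ _)
      have h4 : ‖(2 : ℝ) • v.1‖ = 2 * ‖v.1‖ := by rw [norm_smul]; norm_num
      have h5 : ‖w (v, 1)‖ = 4 * ‖v.1‖ := by rw [hwn]; norm_num
      have h6 : g j (w (v, 1)) = g j ((2 : ℝ) • v.1) := by
        refine h.isEmbedding.injective ?_
        have h7 : w (v, 1) = (4 : ℝ) • v.1 := by simp only [w]; norm_num
        rw [hg j _ (by linarith), hg j _ (by linarith)]
        congr 1
        refine Subtype.ext ?_
        rw [h7] at h5 ⊢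
        rw [radial_smul (by linarith) (by norm_num), radial_smul (by linarith) (by norm_num)]
      rw [F2', c2 _ _ (by linarith), h6, clampI_of_ge (by linarith), H1 _ h1]

/-- A cell attachment is well-pointed at the interior points of the cells. -/
theorem isWellPointed_cell (h : IsCellAttachment ι Φ) (j₀ : J)
    (v₀ : closedBall (0 : Fin N → ℝ) 1) (hv₀ : ‖v₀.1‖ < 1) : IsWellPointed X (Φ j₀ v₀) := by
  classical
  -- The distance from `v₀` to the boundary is at least `1 - ‖v₀‖`, so `μ` vanishes on the boundary.
  -- The motion towards `v₀`, with speed `2μ` cut off at `1`, is then stationary there and extends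
  -- by constants.
  let μ : C(closedBall (0 : Fin N → ℝ) 1, I) :=
    ⟨fun v => clampI (1 - ‖v.1 - v₀.1‖ / (1 - ‖v₀.1‖)), by fun_prop⟩
  have hμ0 : ∀ v, ‖v.1‖ = 1 → μ v = 0 := by
    intro v hv
    refine clampI_of_le ?_
    rw [sub_nonpos, le_div_iff₀ (by linarith), one_mul]
    have := norm_sub_norm_le v.1 v₀.1
    linarith
  let l : closedBall (0 : Fin N → ℝ) 1 × I → ℝ := fun x => (x.2 : ℝ) * clampI (2 * μ x.1)
  have hl : Continuous l := by fun_prop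
  let c : C(closedBall (0 : Fin N → ℝ) 1 × I, X) := ⟨fun x => Φ j₀ ⟨x.1.1 + l x • (v₀.1 - x.1.1),
    (convex_closedBall _ _).add_smul_sub_mem x.1.2 v₀.2
      ⟨mul_nonneg x.2.2.1 (clampI _).2.1, mul_le_one₀ x.2.2.2 (clampI _).2.1 (clampI _).2.2⟩⟩,
    by fun_prop⟩
  have hc : ∀ v t, l (v, t) = 0 → c (v, t) = Φ j₀ v := by
    intro v t hlv
    refine congrArg (Φ j₀) (Subtype.ext ?_)
    change v.1 + l (v, t) • (v₀.1 - v.1) = v.1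
    rw [hlv]; simp
  have hc' : ∀ v, l (v, 1) = 1 → c (v, 1) = Φ j₀ v₀ := by
    intro v hlv
    refine congrArg (Φ j₀) (Subtype.ext ?_)
    change v.1 + l (v, 1) • (v₀.1 - v.1) = v₀.1
    rw [hlv]; simp
  obtain ⟨F, F1, F2⟩ := h.exists_desc (⟨fun y => .const I (ι y),
      (ContinuousMap.const'.comp ι).continuous⟩ : C(Y, C(I, X)))
    (fun j => if j = j₀ then c.curry else
      ⟨fun v => .const I (Φ j v), (ContinuousMap.const'.comp (Φ j)).continuous⟩) (by
      intro j v y hy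
      ext t
      by_cases hj : j = j₀
      · subst hj
        rw [if_pos rfl]
        refine (hc v t ?_).trans hy.symm
        simp only [l]
        rw [hμ0 v (h.norm_eq_one hy)]; simp
      · rw [if_neg hj]; exact hy.symm)
  obtain ⟨U, U1, U2⟩ := h.exists_desc (.const Y (0 : I)) (fun j => if j = j₀ then μ else .const _ 0)
    (by
      intro j v y hy
      by_cases hj : j = j₀
      · rw [if_pos hj, hμ0 v (h.norm_eq_one hy)]; rfl
      · rw [if_neg hj]; rfl)
  have hF : ∀ v t, F (Φ j₀ v) t = c (v, t) := fun v t => by rw [F2, if_pos rfl]; rfl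
  have hU : ∀ v, U (Φ j₀ v) = μ v := fun v => by rw [U2, if_pos rfl]
  refine ⟨F.uncurry, U, fun x => ?_, fun t => ?_, ?_, fun x hx => ?_⟩
  · change F x 0 = x
    rcases h.exists_eq x with ⟨y, rfl⟩ | ⟨j, v, hv, rfl⟩
    · rw [F1]; rfl
    · by_cases hj : j = j₀
      · subst hj
        rw [hF, hc _ _ (by simp [l])]
      · rw [F2, if_neg hj]; rfl
  · change F (Φ j₀ v₀) t = _
    rw [hF]
    refine congrArg (Φ j₀) (Subtype.ext ?_)
    change v₀.1 + l (v₀, t) • (v₀.1 - v₀.1) = v₀.1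
    simp
  · rw [hU]
    exact clampI_of_ge (by simp)
  · change F x 1 = _
    have h0 : ¬ (1 : ℝ) / 2 ≤ ((0 : I) : ℝ) := by norm_num
    rcases h.exists_eq x with ⟨y, rfl⟩ | ⟨j, v, hv, rfl⟩
    · rw [U1] at hx
      exact absurd hx h0
    · by_cases hj : j = j₀
      · subst hj
        rw [hU] at hx
        rw [hF, hc']
        simp only [l]
        rw [clampI_of_ge (by linarith)]; simp
      · rw [U2, if_neg hj] at hx
        exact absurd hx h0

end IsCellAttachment

namespace Topology.CWComplex

open RelCWComplex

variable {X : Type u₁} [TopologicalSpace X] [T2Space X] [CWComplex (Set.univ : Set X)]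

theorem cell_mem_skeletonLT {N : ℕ} (j : cell (Set.univ : Set X) N)
    (v : closedBall (0 : Fin N → ℝ) 1) :
    map N j v ∈ (skeletonLT (Set.univ : Set X) ((N + 1 : ℕ) : ℕ∞) : Set X) := by
  have := closedCell_subset_skeletonLT N j ⟨v.1, v.2, rfl⟩
  exact_mod_cast this

theorem skeletonLT_subset_succ (N : ℕ) : (skeletonLT (Set.univ : Set X) (N : ℕ∞) : Set X) ⊆
    (skeletonLT (Set.univ : Set X) ((N + 1 : ℕ) : ℕ∞) : Set X) :=
  skeletonLT_mono (by exact_mod_cast N.le_succ)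

/-- A skeleton arises from the preceding one by attaching cells. -/
theorem isCellAttachment_skeletonLT (N : ℕ) :
    IsCellAttachment
      (⟨Set.inclusion (skeletonLT_subset_succ N), by fun_prop⟩ :
        C((skeletonLT (Set.univ : Set X) (N : ℕ∞) : Set X),
          (skeletonLT (Set.univ : Set X) ((N + 1 : ℕ) : ℕ∞) : Set X)))
      (fun j : cell (Set.univ : Set X) N =>
        ⟨fun v => ⟨map N j v.1, cell_mem_skeletonLT j v⟩,
          Continuous.subtype_mk (continuousOn N j).domRestrict _⟩) where
  isEmbedding := by
    refine IsClosedEmbedding.inclusion (skeletonLT_subset_succ N) ?_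
    exact (Subcomplex.closed _).preimage continuous_subtype_val
  mem_range j v hv := by
    have : map N j v.1 ∈ (skeletonLT (Set.univ : Set X) (N : ℕ∞) : Set X) :=
      cellFrontier_subset_skeletonLT N j ⟨v.1, by simpa using hv, rfl⟩
    exact ⟨⟨_, this⟩, rfl⟩
  notMem_range j v hv := by
    rintro ⟨y, hy⟩
    have h1 : y.1 = map N j v.1 := congrArg Subtype.val hy
    have h2 : map N j v.1 ∈ openCell N j := ⟨v.1, by simpa using hv, rfl⟩
    exact Set.disjoint_left.1 (disjoint_skeletonLT_openCell (C := Set.univ) (j := j) le_rfl)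
      (h1 ▸ y.2) h2
  injective j j' v v' hv hv' h := by
    have h1 : map N j v.1 = map N j' v'.1 := congrArg Subtype.val h
    have e1 : map N j v.1 ∈ openCell N j := ⟨v.1, by simpa using hv, rfl⟩
    have e2 : map N j v.1 ∈ openCell N j' := ⟨v'.1, by simpa using hv', h1.symm⟩
    have hj : j = j' := by
      have := eq_of_not_disjoint_openCell (C := Set.univ) (j := j) (i := j')
        (Set.not_disjoint_iff.2 ⟨_, e1, e2⟩)
      exact eq_of_heq (Sigma.mk.inj this).2
    subst hj
    refine ⟨rfl, Subtype.ext ?_⟩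
    have hi := (map N j : PartialEquiv (Fin N → ℝ) X).injOn
    rw [source_eq] at hi
    exact hi (by simpa using hv) (by simpa using hv') h1
  exists_eq x := by
    obtain ⟨l, hl, j, hx⟩ := CWComplex.mem_skeletonLT_iff.1 x.2
    have hl' : l ≤ N := Nat.lt_succ_iff.1 (by exact_mod_cast hl)
    rcases hl'.lt_or_eq with h | rfl
    · exact Or.inl ⟨⟨x.1, CWComplex.mem_skeletonLT_iff.2 ⟨l, by exact_mod_cast h, j, hx⟩⟩, rfl⟩
    · obtain ⟨v, hv, hvx⟩ := hx
      exact Or.inr ⟨j, ⟨v, ball_subset_closedBall hv⟩, by simpa using hv, Subtype.ext hvx⟩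
  isClosed_of s h1 h2 := by
    have hcl : IsClosed ((skeletonLT (Set.univ : Set X) (N : ℕ∞) : Set X)) := Subcomplex.closed _
    have h1' := hcl.isClosedMap_subtype_val _ h1
    -- Closedness is tested cell by cell: lower cells lie in the preceding skeleton, `N`-cells give
    -- compact images, and higher open cells are disjoint from the set.
    have key : IsClosed (Subtype.val '' s) := by
      refine CWComplex.isClosed_of_disjoint_openCell_or_isClosed_inter_closedCell
        (C := Set.univ) (Set.subset_univ _) fun l _ j => ?_
      rcases lt_trichotomy l N with hl | rfl | hl
      · right
        convert h1'.inter (isClosed_closedCell (C := Set.univ) (i := j)) using 1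
        ext x
        constructor
        · rintro ⟨⟨y, hy, rfl⟩, hx⟩
          have hxs : y.1 ∈ (skeletonLT (Set.univ : Set X) (N : ℕ∞) : Set X) :=
            skeletonLT_mono (by exact_mod_cast hl) (closedCell_subset_skeletonLT l j hx)
          exact ⟨⟨⟨y.1, hxs⟩, hy, rfl⟩, hx⟩
        · rintro ⟨⟨y, hy, rfl⟩, hx⟩
          exact ⟨⟨_, hy, rfl⟩, hx⟩
      · right
        have hcomp := (h2 j).isCompact.image
          ((continuousOn l j).domRestrict : Continuous fun v : closedBall (0 : Fin l → ℝ) 1 =>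
            map (C := Set.univ) l j v.1)
        convert hcomp.isClosed using 1
        ext x
        constructor
        · rintro ⟨⟨y, hy, rfl⟩, v, hv, hx⟩
          refine ⟨⟨v, hv⟩, ?_, hx⟩
          have e : (⟨map l j v, cell_mem_skeletonLT j ⟨v, hv⟩⟩ :
            (skeletonLT (Set.univ : Set X) ((l + 1 : ℕ) : ℕ∞) : Set X)) = y := Subtype.ext hx
          change (⟨map l j v, _⟩ :
            (skeletonLT (Set.univ : Set X) ((l + 1 : ℕ) : ℕ∞) : Set X)) ∈ s
          rw [e]
          exact hy
        · rintro ⟨v, hv, rfl⟩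
          exact ⟨⟨_, hv, rfl⟩, ⟨v.1, v.2, rfl⟩⟩
      · left
        rw [Set.disjoint_left]
        rintro _ ⟨y, hy, rfl⟩ hx
        exact Set.disjoint_left.1 (disjoint_skeletonLT_openCell (C := Set.univ) (j := j)
          (by exact_mod_cast hl)) y.2 hx
    have := key.preimage (continuous_subtype_val (p := fun x =>
      x ∈ (skeletonLT (Set.univ : Set X) ((N + 1 : ℕ) : ℕ∞) : Set X)))
    rwa [Set.preimage_image_eq _ Subtype.val_injective] at this

/-- The finite skeleta of a CW complex are well-pointed at all points. -/
theorem isWellPointed_skeletonLT (N : ℕ)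
    (x₀ : (skeletonLT (Set.univ : Set X) (N : ℕ∞) : Set X)) : IsWellPointed _ x₀ := by
  induction N with
  | zero =>
    obtain ⟨l, hl, -⟩ := CWComplex.mem_skeletonLT_iff.1 x₀.2
    simp at hl
  | succ N ih =>
    have h := isCellAttachment_skeletonLT (X := X) N
    rcases h.exists_eq x₀ with ⟨y, rfl⟩ | ⟨j, v, hv, rfl⟩
    · exact h.isWellPointed_of_mem (ih y)
    · exact h.isWellPointed_cell j v hv

end Topology.CWComplex

/-! ### Path-connectedness of the skeleton. -/

namespace TopCell

/-- If a path-connected space arises by attaching a cell of dimension at least two, then the body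
is path-connected. -/
theorem pathConnectedSpace_body {n : ℕ} {X : Type u₁} [TopologicalSpace X] [T2Space X]
    [PathConnectedSpace X] (d : TopCell n X) (hn : 2 ≤ n) : PathConnectedSpace d.body := by
  have hS : IsPathConnected (sphere (0 : Fin n → ℝ) 1) := by
    refine isPathConnected_sphere ?_ 0 zero_le_one
    rw [← Module.finrank_eq_rank, Module.finrank_fin_fun]
    exact_mod_cast hn
  have := isPathConnected_iff_pathConnectedSpace.1 hS
  obtain ⟨s₀⟩ := (inferInstance : Nonempty (sphere (0 : Fin n → ℝ) 1))
  have key : ∀ a : d.body, Joined a (d.attach s₀) := by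
    intro a
    obtain ⟨γ⟩ := PathConnectedSpace.joined a.1 (d.attach s₀).1
    -- A path in `X` from `a` to the boundary of the cell is followed up to its first point in the
    -- closed cell. Until then it is in the body, which is closed, so that point lies on the
    -- boundary sphere, and the sphere is path-connected.
    have hD : IsClosed (d.char '' closedBall 0 1) :=
      ((isCompact_closedBall _ _).image_of_continuousOn d.continuousOn_char).isClosed
    let T : Set I := γ ⁻¹' (d.char '' closedBall 0 1)
    have hT : IsClosed T := hD.preimage γ.continuous
    have hT1 : T.Nonempty := ⟨1, s₀.1, sphere_subset_closedBall s₀.2, γ.target.symm⟩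
    have ht₀ : sInf T ∈ T := hT.sInf_mem hT1
    have hlt : ∀ t, t < sInf T → γ t ∈ d.body := by
      intro t ht
      by_contra h
      obtain ⟨v, hv, hvx⟩ := d.bijOn_compl.surjOn h
      exact ht.not_ge (sInf_le ⟨v, ball_subset_closedBall hv, hvx⟩)
    have hmem : γ (sInf T) ∈ d.body := by
      rcases eq_or_ne (sInf T) 0 with h0 | h0
      · rw [h0, γ.source]; exact a.2
      · have hcl : sInf T ∈ closure (Set.Iio (sInf T)) := by
          have hne : (Set.Iio (sInf T)).Nonempty := ⟨0, unitInterval.pos_iff_ne_zero.2 h0⟩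
          rw [closure_Iio' hne]
          exact le_refl (sInf T)
        exact (d.isClosed_body.preimage γ.continuous).closure_subset_iff.2 hlt hcl
    obtain ⟨v, hv, hvx⟩ := ht₀
    have hv1 : ‖v‖ = 1 := by
      rw [← d.char_mem_body_iff (by simpa using hv), hvx]
      exact hmem
    let s : sphere (0 : Fin n → ℝ) 1 := ⟨v, by simpa using hv1⟩
    have hmem' : ∀ t, γ (t ⊓ sInf T) ∈ d.body := by
      intro t
      rcases lt_or_ge t (sInf T) with h | h
      · rw [inf_eq_left.2 h.le]; exact hlt t h
      · rw [inf_eq_right.2 h]; exact hmem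
    have e1 : Joined a (d.attach s) := by
      refine ⟨⟨⟨fun t => ⟨γ (t ⊓ sInf T), hmem' t⟩, by fun_prop⟩, ?_, ?_⟩⟩
      · refine Subtype.ext ?_
        change γ (0 ⊓ sInf T) = a.1
        rw [inf_eq_left.2 unitInterval.nonneg', γ.source]
      · refine Subtype.ext ?_
        change γ (1 ⊓ sInf T) = d.char v
        rw [inf_eq_right.2 unitInterval.le_one', hvx]
    exact e1.trans ((PathConnectedSpace.joined s s₀).map d.attach.continuous)
  exact ⟨⟨d.attach s₀⟩, fun a b => (key a).trans (key b).symm⟩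

end TopCell

end

theorem theorem1p6 {M : Type u} [TopologicalSpace M] [T2Space M] [PathConnectedSpace M]
    [Topology.CWComplex (Set.univ : Set M)] {m k : ℕ} (hm : 2 ≤ m) (hmk : m ≤ k)
    (hM : IsPoincareDualityComplex (m + k) M) (hcell : HasSingleTopCell (m + k) M)
    (x₀ : hcell.topCell.body) :
    ∃ (i : C(Wedge (Sph k) (HalfSmash hcell.topCell.body (LoopSpace (Sph m) (Sph.base m)) x₀)
            (Sph.base k) (HalfSmash.base x₀),
          ConnectedSum hcell.topCell (sphereProdTopCell m k)))
      (h' : C(ConnectedSum hcell.topCell (sphereProdTopCell m k), Sph m)),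
      IsHomotopyFibration i h' (Wedge.base (Sph.base k) (HalfSmash.base x₀))
          (HomotopyPushout.inl _ _ x₀) (Sph.base m) ∧
        HasRightHomotopyInverse h' (HomotopyPushout.inl _ _ x₀) (Sph.base m) := by
  have := hcell.topCell.pathConnectedSpace_body (by omega)
  obtain ⟨i, hi⟩ := SphereProd.exists_isHomotopyFibration hcell.topCell.attach (by omega : 1 ≤ m)
    (by omega : 1 ≤ k) (Topology.CWComplex.isWellPointed_skeletonLT (X := M) (m + k) x₀)
  exact ⟨i, _, hi, SphereProd.hasRightHomotopyInverse hcell.topCell.attach (by omega) x₀⟩
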